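/- **Corollary 7.5.** Let $\overline S$ be a smooth proper connected complex curve and let $\pi\colon\overline X\to\overline S$ be a proper flat morphism with connected one-dimensional fibers, where $\overline X$ is a smooth complex surface and every fiber is reduced with at most ordinary double points as singularities. Let $s$ be a closed point of $\overline S$, with fiber $F=\overline X_s$. Let $\langle\cdot,\cdot\rangle_s$ be the local intersection pairing over $s$, extended $\mathbb Q$-bilinearly to $\mathbb Q$-divisors: for distinct prime divisors $Z\ne W$ it is $\langle Z,W\rangle_s=\sum_{x\in F}\operatorname{length}\,\mathcal O_{\overline X,x}/(I_{Z,x}+I_{W,x})$, where $I_Z,I_W$ are the ideal sheaves of $Z,W$; for an irreducible component $C$ of $F$ it is $\langle C,C\rangle_s=\deg\mathcal O_{\overline X}(C)|_C$; and $\langle C,C\rangle_s=0$ for a component $C$ of a fiber over another closed point. (The self-intersection of a prime divisor that dominates $\overline S$ is not defined locally; the statement holds for any rational values assigned to these, which play no role if the divisors below have no common such component.) Let $\Gamma$ be the reduction graph of $F$: its vertices are the irreducible components of $F$, its edges are the double points of $F$, and each double point joins the (possibly equal) components through it. Let $L$ be the Laplacian of $\Gamma$, let $L^+$ be its Moore–Penrose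 inverse, and put $g_\Gamma(a,b)={}^t a\,L^+\,b$ for divisors $a,b\in\mathbb Q^{\{\text{vertices}\}}$ on $\Gamma$. Let $D,E$ be divisors on $\overline X$ of relative degree zero (that is, of degree zero on the generic fiber of $\pi$), with reductions $\mathcal D=\sum_C\langle D,C\rangle_s\,C$ and $\mathcal E=\sum_C\langle E,C\rangle_s\,C$ on $\Gamma$, where $C$ runs over the irreducible components of $F$. Then there exist vertical $\mathbb Q$-divisors $\phi(D),\phi(E)$ on $\overline X$ such that $D+\phi(D)$ and $E+\phi(E)$ have zero intersection number with every irreducible component of $F$, and for every such choice the local Néron height pairing $$\langle D,E\rangle_{\mathrm a,s}=\langle D+\phi(D),E+\phi(E)\rangle_s=\langle D+\phi(D),E\rangle_s$$ satisfies $$\langle D,E\rangle_{\mathrm a,s}=\langle D,E\rangle_s+g_\Gamma(\mathcal D,\mathcal E)\quad\text{in }\mathbb Q.$$ -/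

import Mathlib

open CategoryTheory AlgebraicGeometry

noncomputable section

/-! ### The Moore-Penrose inverse of a rational matrix -/

namespace MoorePenrose

variable {n : Type*} [Fintype n] [DecidableEq n]

/-- The four Penrose conditions: `P` is the Moore-Penrose inverse of the square matrix `A`. -/
structure IsInverse (A P : Matrix n n ℚ) : Prop where
  mul_mul_left : A * P * A = A
  mul_mul_right : P * A * P = P
  symm_left : (A * P).IsSymm
  symm_right : (P * A).IsSymm

theorem IsInverse.eq {A P Q : Matrix n n ℚ} (hP : IsInverse A P) (hQ : IsInverse A Q) : P = Q := by
  have h1 : A * P = A * Q := by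
    calc A * P = (A * P).transpose := hP.symm_left.eq.symm
      _ = ((A * Q) * (A * P)).transpose := by
        rw [← Matrix.mul_assoc, hQ.mul_mul_left]
      _ = (A * P) * (A * Q) := by
        rw [Matrix.transpose_mul, hP.symm_left.eq, hQ.symm_left.eq]
      _ = A * Q := by rw [← Matrix.mul_assoc, hP.mul_mul_left]
  have h2 : P * A = Q * A := by
    calc P * A = P * A * (Q * A) := by
          rw [Matrix.mul_assoc P, ← Matrix.mul_assoc A, hQ.mul_mul_left]
      _ = ((Q * A) * (P * A)).transpose := by
        rw [Matrix.transpose_mul, hP.symm_right.eq, hQ.symm_right.eq]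
      _ = (Q * A).transpose := by
        rw [Matrix.mul_assoc Q, ← Matrix.mul_assoc A, hP.mul_mul_left]
      _ = Q * A := hQ.symm_right.eq
  calc P = P * A * P := hP.mul_mul_right.symm
    _ = Q * A * P := by rw [h2]
    _ = Q * (A * Q) := by rw [Matrix.mul_assoc, h1]
    _ = Q := by rw [← Matrix.mul_assoc, hQ.mul_mul_right]

theorem eq_zero_of_symm {S M : Matrix n n ℚ} (hS : S.IsSymm) (h : S * S * M = 0) : S * M = 0 := by
  have h0 : (S * M).transpose * (S * M) = 0 := by
    rw [Matrix.transpose_mul, hS.eq, Matrix.mul_assoc, ← Matrix.mul_assoc S, h, Matrix.mul_zero]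
  have h1 := Matrix.conjTranspose_mul_self_eq_zero (A := S * M)
  rw [Matrix.conjTranspose_eq_transpose_of_trivial] at h1
  exact h1.1 h0

theorem aeval_symm {S : Matrix n n ℚ} (hS : S.IsSymm) (p : Polynomial ℚ) :
    (Polynomial.aeval S p).IsSymm := by
  induction p using Polynomial.induction_on' with
  | add p q hp hq => rw [map_add]; exact hp.add hq
  | monomial k a =>
    rw [Polynomial.aeval_monomial, ← Algebra.smul_def]
    exact (hS.pow k).smul a

theorem exists_polynomial {S : Matrix n n ℚ} (hS : S.IsSymm) :
    ∃ u : Polynomial ℚ, Polynomial.aeval S u * (S * S) = S := by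
  set μ := minpoly ℚ S with hμ
  have hint : IsIntegral ℚ S := Algebra.IsIntegral.isIntegral S
  have hev : Polynomial.aeval S μ = 0 := minpoly.aeval ℚ S
  have e1 : μ = μ.divX * Polynomial.X + Polynomial.C (μ.coeff 0) := (Polynomial.divX_mul_X_add μ).symm
  have e2 : μ.divX = μ.divX.divX * Polynomial.X + Polynomial.C (μ.coeff 1) := by
    conv_lhs => rw [← Polynomial.divX_mul_X_add μ.divX]
    rw [Polynomial.coeff_divX]
  set h := μ.divX.divX with hh
  set H := Polynomial.aeval S h with hH
  have e3 : (H * S + algebraMap ℚ _ (μ.coeff 1)) * S + algebraMap ℚ _ (μ.coeff 0) = 0 := by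
    have := hev
    rw [e1, e2] at this
    simpa [← hH] using this
  have hc : Commute H S := by
    have := Polynomial.aeval_X (R := ℚ) S
    calc H * S = Polynomial.aeval S (h * Polynomial.X) := by simp [hH]
      _ = Polynomial.aeval S (Polynomial.X * h) := by rw [mul_comm]
      _ = S * H := by simp [hH]
  by_cases h0 : μ.coeff 0 = 0
  · by_cases h1 : μ.coeff 1 = 0
    · exfalso
      rw [h0, h1] at e3
      simp only [map_zero, add_zero] at e3
      have hz : S * S * H = 0 := by
        rw [Matrix.mul_assoc, ← hc.eq, ← Matrix.mul_assoc, ← hc.eq]; exact e3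
      have hz' := eq_zero_of_symm hS hz
      have hdiv : Polynomial.aeval S μ.divX = 0 := by
        rw [e2, h1]; simp only [map_zero, add_zero, map_mul, Polynomial.aeval_X]
        rw [← hH, hc.eq, hz']
      have hne : μ ≠ 0 := minpoly.ne_zero hint
      have hne' : μ.divX ≠ 0 := by
        intro h'
        rw [h', h0] at e1
        simp at e1
        exact hne e1
      have := minpoly.degree_le_of_ne_zero ℚ S hne' hdiv
      exact absurd (Polynomial.degree_divX_lt hne) (not_lt.2 this)
    · refine ⟨-(Polynomial.C (μ.coeff 1)⁻¹ * h), ?_⟩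
      rw [h0] at e3
      simp only [map_zero, add_zero] at e3
      rw [add_mul, Algebra.algebraMap_eq_smul_one, smul_mul_assoc, one_mul] at e3
      have e4 : H * S * S = -(μ.coeff 1 • S) := eq_neg_of_add_eq_zero_left e3
      rw [map_neg, map_mul, Polynomial.aeval_C, ← hH, Algebra.algebraMap_eq_smul_one,
        smul_mul_assoc, one_mul, neg_mul, smul_mul_assoc, ← Matrix.mul_assoc, e4, smul_neg, neg_neg,
        smul_smul, inv_mul_cancel₀ h1, one_smul]
  · refine ⟨-(Polynomial.C (μ.coeff 0)⁻¹ * (Polynomial.C (μ.coeff 1) + h * Polynomial.X)), ?_⟩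
    have e4 : (H * S + algebraMap ℚ _ (μ.coeff 1)) * S * S = -(μ.coeff 0 • S) := by
      apply eq_neg_of_add_eq_zero_left
      have := congrArg (· * S) e3
      simpa [add_mul, Algebra.algebraMap_eq_smul_one] using this
    rw [map_neg, map_mul, Polynomial.aeval_C, map_add, map_mul, Polynomial.aeval_C,
      Polynomial.aeval_X, ← hH, Algebra.algebraMap_eq_smul_one (μ.coeff 0)⁻¹, smul_mul_assoc,
      one_mul, neg_mul, smul_mul_assoc, ← Matrix.mul_assoc, add_comm, e4, smul_neg, neg_neg,
      smul_smul, inv_mul_cancel₀ h0, one_smul]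

theorem exists_of_symm {S : Matrix n n ℚ} (hS : S.IsSymm) :
    ∃ P : Matrix n n ℚ, P.IsSymm ∧ IsInverse S P := by
  obtain ⟨u, hu⟩ := exists_polynomial hS
  set U := Polynomial.aeval S u with hU
  have hc : U * S = S * U := by
    calc U * S = Polynomial.aeval S (u * Polynomial.X) := by simp [hU]
      _ = Polynomial.aeval S (Polynomial.X * u) := by rw [mul_comm]
      _ = S * U := by simp [hU]
  have hP : Polynomial.aeval S (u * u * Polynomial.X) = U * U * S := by simp [hU]
  have k1 : U * U * S * S = U * S := by
    rw [Matrix.mul_assoc, Matrix.mul_assoc, hu]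
  have k2 : S * (U * U * S) = U * S := by
    rw [← Matrix.mul_assoc, ← Matrix.mul_assoc, ← hc, Matrix.mul_assoc U S U, ← hc,
      ← Matrix.mul_assoc, k1]
  have k3 : (U * S).IsSymm := by
    have := aeval_symm hS (u * Polynomial.X)
    simpa [← hU] using this
  refine ⟨U * U * S, hP ▸ aeval_symm hS _, ⟨?_, ?_, ?_, ?_⟩⟩
  · rw [k2, Matrix.mul_assoc, hu]
  · rw [k1, Matrix.mul_assoc, k2, ← Matrix.mul_assoc]
  · rw [k2]; exact k3
  · rw [k1]; exact k3

theorem exists_isInverse (A : Matrix n n ℚ) : ∃ P, IsInverse A P := by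
  have hS : (A.transpose * A).IsSymm := by
    rw [Matrix.IsSymm, Matrix.transpose_mul, Matrix.transpose_transpose]
  obtain ⟨Q, hQs, hQ⟩ := exists_of_symm hS
  have key : A * Q * (A.transpose * A) = A := by
    have h0 : (A * (Q * (A.transpose * A) - 1)) = 0 := by
      have h1 := Matrix.conjTranspose_mul_self_eq_zero (A := A * (Q * (A.transpose * A) - 1))
      rw [Matrix.conjTranspose_eq_transpose_of_trivial] at h1
      apply h1.1
      rw [Matrix.transpose_mul, Matrix.mul_assoc, ← Matrix.mul_assoc A.transpose, mul_sub,
        ← Matrix.mul_assoc (A.transpose * A), hQ.mul_mul_left, mul_one, sub_self, Matrix.mul_zero]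
    rw [mul_sub, mul_one, sub_eq_zero, ← Matrix.mul_assoc] at h0
    exact h0
  refine ⟨Q * A.transpose, ⟨?_, ?_, ?_, ?_⟩⟩
  · simpa [Matrix.mul_assoc] using key
  · have := congrArg (· * A.transpose) hQ.mul_mul_right
    simpa [Matrix.mul_assoc] using this
  · rw [Matrix.IsSymm, Matrix.transpose_mul, Matrix.transpose_mul, Matrix.transpose_transpose,
      hQs.eq, Matrix.mul_assoc]
  · rw [Matrix.mul_assoc]; exact hQ.symm_right

/-- The Moore-Penrose pseudo-inverse `A⁺` of a rational square matrix `A`. -/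
def pinv (A : Matrix n n ℚ) : Matrix n n ℚ := (exists_isInverse A).choose

end MoorePenrose

/-! ### Laplacian and Green's function of a finite multigraph -/

namespace GraphGreen

variable {V E : Type*} (G : Graph V E)

theorem exists_ends (e : G.edgeSet) : ∃ p : V × V, G.IsLink e p.1 p.2 := by
  obtain ⟨x, y, h⟩ := (G.edge_mem_iff_exists_isLink e).1 e.2
  exact ⟨(x, y), h⟩

/-- An (arbitrarily chosen) orientation of the edges: source and target of an edge. -/
def source (e : G.edgeSet) : V := (exists_ends G e).choose.1

/-- See `source`. -/
def target (e : G.edgeSet) : V := (exists_ends G e).choose.2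

open scoped Classical in
/-- The coefficient of the vertex `v` in `d_* e = target e - source e`; equivalently, the value at
the edge `e` of the coboundary `d^* δ_v` of the function `δ_v`. -/
def boundary (v : V) (e : G.edgeSet) : ℚ :=
  (if target G e = v then 1 else 0) - (if source G e = v then 1 else 0)

/-- The Laplacian: the matrix of `d_* ∘ d^*` on functions on the vertices (of a graph with finitely
many edges). -/
def laplacian : Matrix V V ℚ :=
  fun v w => ∑ᶠ e : G.edgeSet, boundary G v e * boundary G w e

open scoped Classical in
/-- The Green's function `g_Γ(v, w) = L⁺(δ_v, δ_w)`, where `L⁺` is the Moore-Penrose inverse of the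
Laplacian, extended bilinearly to divisors `a, b ∈ ℚ^V` on the graph. -/
def green [Fintype V] (a b : V → ℚ) : ℚ :=
  ∑ v, ∑ w, a v * b w * MoorePenrose.pinv (laplacian G) v w

end GraphGreen

/-! ### Semistable families of curves over a smooth proper complex curve -/

/-- The local ring at `x` of the fibre of `f` through `x`, that is `𝒪_{X,x} / 𝔪_{f x} 𝒪_{X,x}`. -/
abbrev fiberLocalRing {X S : Scheme.{0}} (f : X ⟶ S) (x : X) : Type :=
  (X.presheaf.stalk x) ⧸
    (IsLocalRing.maximalIdeal (S.presheaf.stalk (f x))).map (f.stalkMap x).hom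

/-- A local ring is that of an ordinary double point of a complex curve if its completion
is isomorphic to `ℂ⟦u, v⟧ / (u v)`. -/
def IsOrdinaryDoublePoint (R : Type) [CommRing R] : Prop :=
  ∃ _ : IsLocalRing R, Nonempty (AdicCompletion (IsLocalRing.maximalIdeal R) R ≃+*
    MvPowerSeries (Fin 2) ℂ ⧸
      Ideal.span {(MvPowerSeries.X 0 * MvPowerSeries.X 1 : MvPowerSeries (Fin 2) ℂ)})

/-- A semistable surface over a smooth proper connected complex curve `S`: a proper flat morphism
`π : X ⟶ S` from a smooth complex surface, whose fibres are connected, reduced (hence curves) and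
have at most ordinary double points as singularities. `X` and `S` are smooth and connected,
hence integral. -/
structure SemistableSurface where
  X : Scheme.{0}
  S : Scheme.{0}
  structureMap : S ⟶ Spec (.of ℂ)
  π : X ⟶ S
  integral_S : IsIntegral S
  proper_S : IsProper structureMap
  smooth_S : SmoothOfRelativeDimension 1 structureMap
  integral_X : IsIntegral X
  smooth_X : SmoothOfRelativeDimension 2 (π ≫ structureMap)
  proper_π : IsProper π
  flat_π : Flat π
  connected_fibers : ∀ s : S, _root_.IsConnected (π ⁻¹' {s})
  reduced_fibers : ∀ x : X, IsReduced (fiberLocalRing π x)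
  nodal_fibers : ∀ x : X, IsClosed {π x} →
    IsRegularLocalRing (fiberLocalRing π x) ∨ IsOrdinaryDoublePoint (fiberLocalRing π x)

namespace SemistableSurface

attribute [instance] integral_S proper_S smooth_S integral_X smooth_X proper_π flat_π

variable (F : SemistableSurface)

instance isLocallyNoetherian_X : IsLocallyNoetherian F.X := by
  have : IsLocallyNoetherian (Spec (.of ℂ)) := inferInstance
  exact LocallyOfFiniteType.isLocallyNoetherian (F.π ≫ F.structureMap)

instance isNoetherian_X : IsNoetherian F.X where
  isCompact_univ := by
    have := (quasiCompact_iff_compactSpace (f := F.π ≫ F.structureMap)).1 inferInstance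
    exact isCompact_univ

/-- Prime divisors on `X`, represented by their generic points, the points of codimension one. -/
def PrimeDivisor : Type := {z : F.X // Order.coheight z = 1}

variable {F}

/-- The generic point of a prime divisor. -/
def PrimeDivisor.pt (Z : F.PrimeDivisor) : F.X := Z.1

/-- A prime divisor is horizontal if it dominates `S`; otherwise it is vertical, that is, contained
in a fibre over a closed point. -/
def PrimeDivisor.IsHorizontal (Z : F.PrimeDivisor) : Prop := F.π Z.pt = genericPoint F.S

variable (F) in
/-- Divisors on `X` (there is no difference between Weil and Cartier divisors as `X` is
smooth). -/
abbrev Divisor : Type := F.PrimeDivisor →₀ ℤ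

variable (F) in
/-- `ℚ`-divisors on `X`. -/
abbrev RatDivisor : Type := F.PrimeDivisor →₀ ℚ

/-- A divisor viewed as a `ℚ`-divisor. -/
def Divisor.toRat (D : F.Divisor) : F.RatDivisor := D.mapRange (fun k : ℤ => (k : ℚ)) Int.cast_zero

open scoped Classical in
/-- The relative degree of a divisor: the degree over `κ(η)` of its restriction to the generic
fibre of `π`. -/
def Divisor.relDegree (D : F.Divisor) : ℤ :=
  D.sum fun Z a => if Z.IsHorizontal then a * (F.π.residueDegree Z.pt : ℤ) else 0

/-! #### The local intersection pairing over a closed point `s` -/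

open scoped Classical in
/-- The stalk at `x` of the ideal sheaf of the prime divisor `Z`. It is the prime ideal of
`𝒪_{X,x}` attached to `Z` if `x` lies on `Z`, and the unit ideal otherwise. -/
def PrimeDivisor.idealAt (Z : F.PrimeDivisor) (x : F.X) : Ideal (F.X.presheaf.stalk x) :=
  if h : Z.pt ⤳ x then
    (IsLocalRing.maximalIdeal (F.X.presheaf.stalk Z.pt)).comap
      (F.X.presheaf.stalkSpecializes h).hom
  else ⊤

/-- The intersection multiplicity of two distinct prime divisors at the point `x`. -/
def multiplicity (Z W : F.PrimeDivisor) (x : F.X) : ℕ :=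
  (Module.length (F.X.presheaf.stalk x)
    (F.X.presheaf.stalk x ⧸ (Z.idealAt x ⊔ W.idealAt x))).toNat

/-- The local intersection number over `s` of two distinct prime divisors: the sum of the
intersection multiplicities at the points above `s` (all residue fields of closed points
are `ℂ`). -/
def properIntersection (s : F.S) (Z W : F.PrimeDivisor) : ℚ :=
  ∑ᶠ x : {x : F.X // F.π x = s}, (multiplicity Z W x : ℚ)

/-- A rational function with a simple zero along the prime divisor `Z`. -/
def movingFunction (Z : F.PrimeDivisor) : F.X.functionField :=
  Classical.epsilon fun f => AlgebraicGeometry.Scheme.ord f Z.pt = 1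

/-- The self-intersection number of a component `C` of the fibre over `s`, that is, the degree
of `𝒪_X(C)` on the complete curve `C`. Here `C` is moved to the linearly equivalent divisor
`C - div f`, which does not contain `C`, with `f` a rational function that has a simple zero
along `C`. -/
def selfIntersection (s : F.S) (C : F.PrimeDivisor) : ℚ :=
  ∑ᶠ W : {W : F.PrimeDivisor // W ≠ C},
    -(AlgebraicGeometry.Scheme.ord (movingFunction C) W.1.pt : ℚ) * properIntersection s W.1 C

open scoped Classical in
/-- The local intersection number over `s` of two prime divisors. No local intersection number of a
horizontal prime divisor with itself is defined; the function `c` assigns arbitrary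
values to these self-intersections. They are irrelevant for pairs of divisors without a common
horizontal component. -/
def primePairing (c : F.PrimeDivisor → ℚ) (s : F.S) (Z W : F.PrimeDivisor) : ℚ :=
  if Z = W then
    if F.π Z.pt = s then selfIntersection s Z
    else if Z.IsHorizontal then c Z
    else 0
  else properIntersection s Z W

/-- The local intersection pairing `⟨D, E⟩_s` of `ℚ`-divisors over `s`. -/
def pairing (c : F.PrimeDivisor → ℚ) (s : F.S) (D E : F.RatDivisor) : ℚ :=
  D.sum fun Z a => E.sum fun W b => a * b * primePairing c s Z W

/-! #### The reduction graph -/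

/-- The irreducible components of the fibre over `s`: the prime divisors whose generic
point is a maximal point of the fibre. -/
def Component (s : F.S) : Type :=
  {C : F.PrimeDivisor // F.π C.pt = s ∧ ∀ y : F.X, F.π y = s → y ⤳ C.pt → y = C.pt}

instance (s : F.S) : Finite (Component s) := by
  let T := F.π ⁻¹' {s}
  have hT : TopologicalSpace.NoetherianSpace T :=
    Topology.IsInducing.subtypeVal.noetherianSpace
  have hq : QuasiSober T := (F.π.fiberHomeo s).symm.isClosedEmbedding.quasiSober
  have hfin : (irreducibleComponents T).Finite :=
    TopologicalSpace.NoetherianSpace.finite_irreducibleComponents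
  have := hfin.to_subtype
  let g : Component s → irreducibleComponents T := fun C =>
    ⟨closure {(⟨C.1.pt, C.2.1⟩ : T)}, isIrreducible_singleton.closure, by
      intro Z hZ hle
      obtain ⟨y, hy⟩ := QuasiSober.sober hZ.closure isClosed_closure
      have hyC : y ⤳ (⟨C.1.pt, C.2.1⟩ : T) := by
        rw [specializes_iff_mem_closure, hy.def]
        exact subset_closure (hle (subset_closure rfl))
      have h2 : y = ⟨C.1.pt, C.2.1⟩ :=
        Subtype.ext (C.2.2 y.1 y.2 (hyC.map continuous_subtype_val))
      rw [← h2]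
      intro z hz
      rw [hy.def]
      exact subset_closure hz⟩
  apply Finite.of_injective g
  intro C C' h
  have h1 : closure {(⟨C.1.pt, C.2.1⟩ : T)} = closure {(⟨C'.1.pt, C'.2.1⟩ : T)} :=
    congrArg Subtype.val h
  have h2 := (inseparable_iff_closure_eq.2 h1).eq
  exact Subtype.ext (Subtype.ext (congrArg (fun t : T => t.1) h2))

instance (s : F.S) : Fintype (Component s) := Fintype.ofFinite _

/-- The reduction graph `Γ` of the fibre over `s`. The vertices are the irreducible components of
the fibre, the edges are its double points, and a double point `x` joins `C` and `C'`
(possibly equal) if `C` and `C'` are the components through `x`. -/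
def reductionGraph (s : F.S) : Graph (Component s) F.X where
  vertexSet := Set.univ
  IsLink x C C' := F.π x = s ∧ IsOrdinaryDoublePoint (fiberLocalRing F.π x) ∧
    ∀ B : Component s, B.1.pt ⤳ x ↔ B = C ∨ B = C'
  isLink_symm := by
    intro x _
    exact ⟨fun C C' h => ⟨h.1, h.2.1, fun B => (h.2.2 B).trans or_comm⟩⟩
  eq_or_eq_of_isLink_of_isLink := by
    intro x C C' B B' h h'
    exact (h'.2.2 C).1 ((h.2.2 C).2 (Or.inl rfl))
  left_mem_of_isLink := fun _ _ _ _ => Set.mem_univ _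

/-- A component of a fibre as a (`ℚ`-)divisor on `X`. -/
def Component.toDivisor {s : F.S} (C : Component s) : F.RatDivisor := Finsupp.single C.1 1

/-- The reduction `∑_C ⟨D, C⟩_s C` of the divisor `D` on the reduction graph at `s`. -/
def reduction (c : F.PrimeDivisor → ℚ) (s : F.S) (D : F.RatDivisor) : Component s → ℚ :=
  fun C => pairing c s D C.toDivisor

/-- `φ` is a vertical `ℚ`-divisor such that `D + φ` has intersection number zero
with each component of the fibre over `s`. -/
structure IsVerticalCorrection (c : F.PrimeDivisor → ℚ) (s : F.S) (D φ : F.RatDivisor) : Prop where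
  vertical : ∀ Z ∈ φ.support, ¬ Z.IsHorizontal
  orthogonal : ∀ C : Component s, pairing c s (D + φ) C.toDivisor = 0

end SemistableSurface

end

/-!
The proof rests on two facts about the local intersection pairing over `s`: its restriction to the
components of the fibre over `s` is minus the Laplacian `L` of the reduction graph
(`primePairing_component_eq`), and the reduction of a divisor has total degree equal to the relative
degree of the divisor (`sum_reduction_toRat`). Given these, `φ` is a vertical correction of `D` if
and only if its coefficients at these components form a solution of `L φ = 𝒟`
(`isVerticalCorrection_iff`). The fibre is connected, so that the kernel of `L` consists of the
constant functions (`eq_of_laplacian_mulVec_eq_zero`); as `𝒟` has degree zero, `L⁺ 𝒟` is a solution,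
and any solution has the form `L⁺ 𝒟 + constant`. Since `ℰ` has degree zero too, it pairs with each
solution to `𝒟 · L⁺ ℰ = g_Γ(𝒟, ℰ)`, which is the difference of `⟨D + φ, E⟩` and `⟨D, E⟩`
(`pairing_add_eq_add_green`). A correction of `E` does not contribute, as it is orthogonal to `D +
φ`.

Off the diagonal, the first fact says that two components of the reduced fibre meet transversally,
at ordinary double points. This is seen in the completed local ring `ℂ⟦u, v⟧ / (u v)` of the fibre
(`IsOrdinaryDoublePoint.sup_eq_maximalIdeal`, `multiplicity_eq_one`). On the diagonal, it says that
a component `C` has intersection number zero with the whole fibre (`sum_primePairing_component`).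
The fibre is the divisor near `s` of a local parameter `t` of the base curve, and the
self-intersection of `C` is defined by a function `f` with a simple zero along `C`. So it is to be
shown that the divisor of a rational function that is a unit `u` at the generic point of `C`, such
as `f / t`, has degree zero on `C` (`finsum_ord_mul_properIntersection_eq_zero`). The second fact
says that a horizontal curve `Z` meets the divisor of `t` with multiplicity the degree of `Z` over
the base (`finsum_ord_mul_properIntersection_eq_residueDegree`).

Both degrees are computed without normalizing curves as schemes, by sums over the valuation rings of
the function field of the curve. The local rings of a smooth surface are factorial
(`uniqueFactorizationMonoid_of_maximalIdeal_eq_span`), so the local contribution at `x` of the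
divisor of a function is the length of the quotient of the one-dimensional local ring of the curve
by this function (`localDegree_algebraMap`). By comparison with the finite normalization, this
length is the sum of the orders of the function at the valuations centered at `x`
(`hasOrdSum_ord_of_isLocalRing`, `hasOrdSum_localDegree`). By the valuative criterion, properness of
`π` means that the valuations with a center over `s` are exactly the nontrivial ones over `ℂ` for a
component of the fibre, and the nontrivial ones over the local ring of the base at `s` for a
horizontal curve; and each has only one center there. In the first case the orders of `u` add up to
zero by the product formula for function fields of one variable (`hasOrdSum_zero`), in the second
one the orders of `t` are ramification indices and add up to the degree of the extension of function
fields (`hasOrdSum_uniformizer`).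
-/

noncomputable section

/-! ### The Green's function as a solution of the Laplace equation -/

namespace MoorePenrose

variable {n : Type*} [Fintype n] [DecidableEq n]

theorem pinv_isInverse (A : Matrix n n ℚ) : IsInverse A (pinv A) :=
  (exists_isInverse A).choose_spec

theorem pinv_isSymm {A : Matrix n n ℚ} (hA : A.IsSymm) : (pinv A).IsSymm := by
  have h := pinv_isInverse A
  refine IsInverse.eq (A := A) ⟨?_, ?_, ?_, ?_⟩ h
  · have := congrArg Matrix.transpose h.mul_mul_left
    simpa [Matrix.transpose_mul, hA.eq, Matrix.mul_assoc] using this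
  · have := congrArg Matrix.transpose h.mul_mul_right
    simpa [Matrix.transpose_mul, hA.eq, Matrix.mul_assoc] using this
  · have := h.symm_right
    rw [Matrix.IsSymm, Matrix.transpose_mul, hA.eq] at this
    rw [this]; exact h.symm_right
  · have := h.symm_left
    rw [Matrix.IsSymm, Matrix.transpose_mul, hA.eq] at this
    rw [this]; exact h.symm_left

end MoorePenrose

namespace GraphGreen

open Matrix

section Symmetric

variable {n : Type*} [Fintype n] [DecidableEq n] {L : Matrix n n ℚ}

theorem mulVec_sub_pinv_mulVec (φ : n → ℚ) :
    L *ᵥ (φ - MoorePenrose.pinv L *ᵥ (L *ᵥ φ)) = 0 := by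
  rw [mulVec_sub, mulVec_mulVec, mulVec_mulVec,
    (MoorePenrose.pinv_isInverse L).mul_mul_left, sub_self]

/-- If the kernel of the symmetric matrix `L` consists of constant functions, then every function
with sum zero lies in the range of `L`. -/
theorem mulVec_pinv_mulVec (hL : L.IsSymm)
    (hone : L *ᵥ (fun _ => 1) = 0) (hker : ∀ f : n → ℚ, L *ᵥ f = 0 → ∀ v w, f v = f w)
    {a : n → ℚ} (ha : ∑ v, a v = 0) : L *ᵥ (MoorePenrose.pinv L *ᵥ a) = a := by
  set P := MoorePenrose.pinv L
  have hP := MoorePenrose.pinv_isInverse L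
  have h1 : L *ᵥ (a - L *ᵥ (P *ᵥ a)) = 0 := by
    have h2 : L * (L * P) = L := by
      have := congrArg transpose hP.mul_mul_left
      rwa [transpose_mul, hP.symm_left.eq, hL.eq] at this
    rw [mulVec_sub, mulVec_mulVec, mulVec_mulVec, Matrix.mul_assoc, h2, sub_self]
  have h2 := hker _ h1
  have h3 : ∑ v, (a - L *ᵥ (P *ᵥ a)) v = 0 := by
    have : ∑ v, (L *ᵥ (P *ᵥ a)) v = (fun _ => (1 : ℚ)) ⬝ᵥ (L *ᵥ (P *ᵥ a)) := by
      simp [dotProduct]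
    simp only [Pi.sub_apply, Finset.sum_sub_distrib, ha, this, dotProduct_mulVec]
    rw [← hL.eq, vecMul_transpose, hone]
    simp
  funext v
  have h4 : ∑ w, (a - L *ᵥ (P *ᵥ a)) w = Fintype.card n • (a - L *ᵥ (P *ᵥ a)) v := by
    rw [Finset.sum_congr rfl fun w _ => h2 w v]; simp [-Pi.sub_apply]
  rw [h3] at h4
  have h5 : (Fintype.card n : ℚ) ≠ 0 := by
    have : Nonempty n := ⟨v⟩
    exact_mod_cast Fintype.card_ne_zero (α := n)
  have h6 : (a - L *ᵥ (P *ᵥ a)) v = 0 := by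
    simpa [h5] using h4.symm
  exact (sub_eq_zero.1 h6).symm

/-- A solution `φ` of `L φ = a` pairs with a function `b` of sum zero as the Moore-Penrose
inverse of `L` pairs `a` with `b`. -/
theorem sum_mul_eq_pinv (hL : L.IsSymm)
    (hker : ∀ f : n → ℚ, L *ᵥ f = 0 → ∀ v w, f v = f w)
    {b φ : n → ℚ} (hb : ∑ v, b v = 0) :
    ∑ v, φ v * b v = ∑ v, ∑ w, (L *ᵥ φ) v * b w * MoorePenrose.pinv L v w := by
  set P := MoorePenrose.pinv L
  have h1 := hker _ (mulVec_sub_pinv_mulVec φ)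
  have h2 : ∑ v, (φ - P *ᵥ (L *ᵥ φ)) v * b v = 0 := by
    rcases isEmpty_or_nonempty n with h | ⟨⟨v₀⟩⟩
    · simp
    · rw [Finset.sum_congr rfl fun v _ => by rw [h1 v v₀], ← Finset.mul_sum, hb, mul_zero]
  have h3 : ∑ v, φ v * b v = ∑ v, (P *ᵥ (L *ᵥ φ)) v * b v := by
    rw [← sub_eq_zero, ← Finset.sum_sub_distrib, ← h2]
    refine Finset.sum_congr rfl fun v _ => ?_
    rw [Pi.sub_apply, sub_mul]
  rw [h3, Finset.sum_comm]
  refine Finset.sum_congr rfl fun v _ => ?_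
  have hs : ∀ w, P v w = P w v := fun w => (MoorePenrose.pinv_isSymm hL).apply w v
  rw [mulVec, dotProduct, Finset.sum_mul]
  refine Finset.sum_congr rfl fun w _ => ?_
  rw [hs]; ring

/-- A function in the kernel of `L` takes equal values at adjacent indices: twice the Dirichlet form
`∑ v, f v * (L f) v` is the sum of the terms `-L v w * (f v - f w) ^ 2`, none of which
is negative. -/
theorem eq_of_mulVec_eq_zero (hL : L.IsSymm) (hone : L *ᵥ (fun _ => 1) = 0)
    (hneg : ∀ v w, v ≠ w → L v w ≤ 0) {f : n → ℚ} (hf : L *ᵥ f = 0) {v w : n}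
    (hne : L v w ≠ 0) : f v = f w := by
  have hrow : ∀ v, ∑ w, L v w = 0 := fun v => by
    simpa [mulVec, dotProduct] using congrFun hone v
  have hcol : ∀ w, ∑ v, L v w = 0 := fun w => by
    rw [← hrow w]; exact Finset.sum_congr rfl fun v _ => hL.apply w v
  have h0 : ∀ v, ∑ w, L v w * f w = 0 := fun v => congrFun hf v
  have hsum : ∑ v, ∑ w, -(L v w) * (f v - f w) ^ 2 = 0 := by
    have e : ∀ v w, -(L v w) * (f v - f w) ^ 2 =
        -(f v ^ 2 * L v w) + 2 * (f v * (L v w * f w)) - f w ^ 2 * L v w := fun v w => by ring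
    simp only [e, Finset.sum_sub_distrib, Finset.sum_add_distrib, Finset.sum_neg_distrib,
      ← Finset.mul_sum, hrow, h0]
    rw [Finset.sum_comm]
    simp [← Finset.mul_sum, hcol]
  have hnn : ∀ v w, 0 ≤ -(L v w) * (f v - f w) ^ 2 := fun v w => by
    by_cases h : v = w
    · simp [h]
    · exact mul_nonneg (neg_nonneg.2 (hneg v w h)) (sq_nonneg _)
  have h1 := (Finset.sum_eq_zero_iff_of_nonneg
    fun v _ => Finset.sum_nonneg fun w _ => hnn v w).1 hsum v (Finset.mem_univ _)
  have h2 := (Finset.sum_eq_zero_iff_of_nonneg fun w _ => hnn v w).1 h1 w (Finset.mem_univ _)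
  rcases mul_eq_zero.1 h2 with h | h
  · exact absurd (neg_eq_zero.1 h) hne
  · exact sub_eq_zero.1 (pow_eq_zero_iff two_ne_zero |>.1 h)

end Symmetric

section Laplacian

variable {V E : Type*} (G : Graph V E)

theorem isLink_source_target (e : G.edgeSet) : G.IsLink e (source G e) (target G e) :=
  (exists_ends G e).choose_spec

theorem laplacian_isSymm : (laplacian G).IsSymm := by
  ext v w
  simp only [transpose_apply, laplacian, mul_comm]

open scoped Classical in
/-- Off the diagonal, the Laplacian counts the edges between two vertices with a minus sign. -/
theorem laplacian_apply_of_ne {v w : V} (hvw : v ≠ w) :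
    laplacian G v w = -∑ᶠ e : G.edgeSet, if G.IsLink e v w then (1 : ℚ) else 0 := by
  rw [laplacian, ← finsum_neg_distrib]
  refine finsum_congr fun e => ?_
  have h := isLink_source_target G e
  by_cases hl : G.IsLink e v w
  · rw [if_pos hl]
    rcases h.eq_and_eq_or_eq_and_eq hl with ⟨h1, h2⟩ | ⟨h1, h2⟩ <;>
      simp [boundary, h1, h2, hvw, hvw.symm]
  · rw [if_neg hl, neg_zero]
    have h1 : ¬ (source G e = v ∧ target G e = w) := fun h' => hl (h'.1 ▸ h'.2 ▸ h)
    have h2 : ¬ (source G e = w ∧ target G e = v) := fun h' => hl (h'.1 ▸ h'.2 ▸ h).symm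
    unfold boundary
    split_ifs <;> simp_all

/-- Finitely many edges that are not loops suffice here, as loops do not contribute to the
Laplacian. -/
theorem laplacian_mulVec_one [Fintype V]
    (hfin : {e : G.edgeSet | source G e ≠ target G e}.Finite) :
    laplacian G *ᵥ (fun _ => 1) = 0 := by
  classical
  funext v
  have hsup : ∀ w, (Function.support fun e : G.edgeSet => boundary G v e * boundary G w e) ⊆
      {e : G.edgeSet | source G e ≠ target G e} := by
    intro w e he h
    apply he
    simp [boundary, h]
  have : ∀ w, laplacian G v w = ∑ e ∈ hfin.toFinset, boundary G v e * boundary G w e := fun w =>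
    finsum_eq_sum_of_support_subset _ (by simpa using hsup w)
  simp only [mulVec, dotProduct, mul_one, this, Pi.zero_apply]
  rw [Finset.sum_comm]
  refine Finset.sum_eq_zero fun e _ => ?_
  rw [← Finset.mul_sum]
  simp [boundary]

end Laplacian

end GraphGreen

/-! ### Branches of an ordinary double point -/

namespace MvPowerSeries

/-- The multiplicity of `X s` in a power series is its order for the weight that counts only the
exponent of `X s`. -/
theorem X_dvd_iff_one_le_weightedOrder {σ R : Type*} [DecidableEq σ] [CommRing R] (s : σ)
    (φ : MvPowerSeries σ R) : X s ∣ φ ↔ 1 ≤ φ.weightedOrder (Pi.single s 1) := by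
  have hw : ∀ m : σ →₀ ℕ, Finsupp.weight (Pi.single s 1) m = m s := fun m => by
    rw [Finsupp.weight_apply, Finsupp.sum, Finset.sum_eq_single s]
    · simp
    · intro i _ hi; simp [hi]
    · intro h; simpa using h
  rw [X_dvd_iff]
  constructor
  · intro h
    refine nat_le_weightedOrder (n := 1) _ fun d hd => h d ?_
    rw [hw] at hd; omega
  · intro h m hm
    refine coeff_eq_zero_of_lt_weightedOrder (Pi.single s 1) (lt_of_lt_of_le ?_ h)
    rw [hw, hm]; simp

theorem X_dvd_mul {σ R : Type*} [CommRing R] [IsDomain R] (s : σ)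
    {φ ψ : MvPowerSeries σ R} (h : X s ∣ φ * ψ) : X s ∣ φ ∨ X s ∣ ψ := by
  classical
  simp only [X_dvd_iff_one_le_weightedOrder, weightedOrder_mul, Order.one_le_iff_ne_zero] at h ⊢
  by_contra! h'
  simp [h'.1, h'.2] at h

theorem exists_eq_X_mul_add_X_mul {R : Type*} [CommRing R] {φ : MvPowerSeries (Fin 2) R}
    (h : constantCoeff φ = 0) : ∃ γ δ, φ = X 0 * γ + X 1 * δ := by
  let ψ : MvPowerSeries (Fin 2) R := fun m => if m 0 = 0 then coeff m φ else 0
  have hψ : ∀ m, coeff m ψ = if m 0 = 0 then coeff m φ else 0 := fun m => rfl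
  obtain ⟨γ, hγ⟩ : X 0 ∣ φ - ψ := X_dvd_iff.2 fun m hm => by simp [hψ, hm]
  obtain ⟨δ, hδ⟩ : X 1 ∣ ψ := X_dvd_iff.2 fun m hm => by
    rw [hψ]
    split_ifs with h0
    · have : m = 0 := by ext i; fin_cases i <;> simpa
      rw [this]; simpa using h
    · rfl
  exact ⟨γ, δ, by rw [← hγ, ← hδ]; ring⟩

/-- The variables are coprime. -/
theorem X_zero_mul_X_one_dvd {R : Type*} [CommRing R] [IsDomain R]
    {φ : MvPowerSeries (Fin 2) R} (h0 : X 0 ∣ φ) (h1 : X 1 ∣ φ) : X 0 * X 1 ∣ φ := by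
  obtain ⟨γ, rfl⟩ := h0
  have h2 : ¬ (X 1 : MvPowerSeries (Fin 2) R) ∣ X 0 := fun h => by
    have := X_dvd_iff.1 h (Finsupp.single 0 1) (by simp)
    simp [coeff_index_single_self_X] at this
  obtain ⟨δ, rfl⟩ := (X_dvd_mul 1 h1).resolve_left h2
  exact ⟨δ, by ring⟩

end MvPowerSeries

section MinimalPrimes

variable {R : Type*} [CommRing R]

/-- In a Noetherian ring, some element avoids a given minimal prime `p` and lies in all the
others. -/
theorem exists_notMem_forall_mem_minimalPrimes [IsNoetherianRing R] {p : Ideal R}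
    (hp : p ∈ minimalPrimes R) :
    ∃ a, a ∉ p ∧ ∀ q ∈ minimalPrimes R, q ≠ p → a ∈ q := by
  classical
  have hfin := minimalPrimes.finite_of_isNoetherianRing R
  have : p.IsPrime := hp.1.1
  have hex : ∀ q ∈ hfin.toFinset.erase p, ∃ x, x ∈ q ∧ x ∉ p := fun q hq => by
    rw [Finset.mem_erase, Set.Finite.mem_toFinset] at hq
    by_contra! h
    exact hq.1 (le_antisymm h (hp.2 hq.2.1 h))
  choose! x hx using hex
  refine ⟨∏ q ∈ hfin.toFinset.erase p, x q, ?_, fun q hq hne => ?_⟩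
  · rw [Ideal.IsPrime.prod_mem_iff]
    rintro ⟨q, hq, h⟩
    exact (hx q hq).2 h
  · have hq' : q ∈ hfin.toFinset.erase p := by simp [hne, hq]
    exact Ideal.mem_of_dvd q (Finset.dvd_prod_of_mem _ hq') (hx q hq').1

theorem eq_zero_of_forall_mem_minimalPrimes [IsReduced R] {a : R}
    (h : ∀ q ∈ minimalPrimes R, a ∈ q) : a = 0 := by
  have : a ∈ nilradical R := by
    rw [nilradical, ← Ideal.sInf_minimalPrimes, Ideal.mem_sInf]
    exact fun {q} hq => h q hq
  simpa using this

end MinimalPrimes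

/-- In the completion of a Noetherian ring, an annihilator of an element of the ring is, modulo
every power of the ideal, generated by annihilators in the ring. -/
theorem AdicCompletion.evalₐ_mem_map_of_algebraMap_mul_eq_zero {R : Type*} [CommRing R]
    [IsNoetherianRing R] {I p : Ideal R} {a : R} (hp : ∀ b, a * b = 0 → b ∈ p)
    {x : AdicCompletion I R} (hx : algebraMap R (AdicCompletion I R) a * x = 0) (n : ℕ) :
    AdicCompletion.evalₐ I n x ∈ p.map (Ideal.Quotient.mk (I ^ n)) := by
  have h : ∑ i : Fin 1, (fun _ => a) i • (fun _ => x) i = 0 := by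
    simpa [Algebra.smul_def] using hx
  obtain ⟨k, c, y, h1, h2⟩ := Module.Flat.isTrivialRelation_of_sum_smul_eq_zero h
  have h3 := h1 0
  simp only at h3
  rw [h3, map_sum]
  refine Ideal.sum_mem _ fun j _ => ?_
  rw [map_smul, Algebra.smul_def]
  refine Ideal.mul_mem_right _ _ (Ideal.mem_map_of_mem _ (hp _ ?_))
  simpa using h2 j

/-- Through an ordinary double point there are at most two branches, and if there are two
then they meet transversally. For a minimal prime `r` let `a r` be a function that vanishes on all
branches except that of `r`. As `a r * a r' = 0` for `r ≠ r'`, in the completion `ℂ⟦u, v⟧ / (u v)`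
each of `u` and `v` divides one of `a r` and `a r'`, whereas no `a r ≠ 0` is divisible by both. So
there are at most two branches, and if `p` and `q` are these then `u` and `v` annihilate `a p` and
`a q`, in some order; since the completion is flat, `p + q` is the maximal ideal. -/
theorem IsOrdinaryDoublePoint.sup_eq_maximalIdeal {R : Type} [CommRing R] [IsLocalRing R]
    [IsNoetherianRing R] [IsReduced R] (h : IsOrdinaryDoublePoint R)
    {p q : Ideal R} (hp : p ∈ minimalPrimes R) (hq : q ∈ minimalPrimes R) (hpq : p ≠ q) :
    p ⊔ q = IsLocalRing.maximalIdeal R ∧ ∀ r ∈ minimalPrimes R, r = p ∨ r = q := by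
  classical
  set m := IsLocalRing.maximalIdeal R with hm
  obtain ⟨_, ⟨e⟩⟩ := h
  change AdicCompletion m R ≃+* _ at e
  let g : MvPowerSeries (Fin 2) ℂ →+* AdicCompletion m R :=
    e.symm.toRingHom.comp (Ideal.Quotient.mk _)
  have hg : Function.Surjective g := e.symm.surjective.comp Ideal.Quotient.mk_surjective
  have hg0 : ∀ β, g β = 0 ↔ MvPowerSeries.X 0 * MvPowerSeries.X 1 ∣ β := fun β => by
    simp only [g, RingHom.comp_apply, RingEquiv.toRingHom_eq_coe, RingHom.coe_coe,
      EmbeddingLike.map_eq_zero_iff, Ideal.Quotient.eq_zero_iff_mem, Ideal.mem_span_singleton]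
  let ι := algebraMap R (AdicCompletion m R)
  have hι : Function.Injective ι := by
    have : IsHausdorff m R := inferInstance
    exact AdicCompletion.of_injective m R
  -- The function `a r` vanishes on all branches except that of `r`, and `α r` represents it in
  -- `ℂ⟦u, v⟧`.
  choose! a ha1 ha2 using fun (r : Ideal R) (hr : r ∈ minimalPrimes R) =>
    exists_notMem_forall_mem_minimalPrimes hr
  choose α hα using fun r => hg (ι (a r))
  have hann : ∀ r ∈ minimalPrimes R, ∀ b, a r * b = 0 → b ∈ r := fun r hr b hb => by
    have : r.IsPrime := hr.1.1
    exact (this.mem_or_mem (hb ▸ r.zero_mem : a r * b ∈ r)).resolve_left (ha1 r hr)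
  have hne : ∀ r ∈ minimalPrimes R, ¬ (MvPowerSeries.X 0 ∣ α r ∧ MvPowerSeries.X 1 ∣ α r) := by
    rintro r hr ⟨h0, h1⟩
    have := (hg0 _).2 (MvPowerSeries.X_zero_mul_X_one_dvd h0 h1)
    rw [hα, map_eq_zero_iff ι hι] at this
    exact ha1 r hr (this ▸ r.zero_mem)
  have hmul : ∀ r ∈ minimalPrimes R, ∀ r' ∈ minimalPrimes R, r ≠ r' →
      MvPowerSeries.X 0 * MvPowerSeries.X 1 ∣ α r * α r' := fun r hr r' hr' hrr' => by
    rw [← hg0, map_mul, hα, hα, ← map_mul, map_eq_zero_iff ι hι]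
    refine eq_zero_of_forall_mem_minimalPrimes fun s hs => ?_
    by_cases h : s = r
    · exact Ideal.mul_mem_left _ _ (ha2 r' hr' s hs (h ▸ hrr'))
    · exact Ideal.mul_mem_right _ _ (ha2 r hr s hs h)
  have h0 : ∀ r ∈ minimalPrimes R, ∀ r' ∈ minimalPrimes R, r ≠ r' →
      MvPowerSeries.X 0 ∣ α r ∨ MvPowerSeries.X 0 ∣ α r' := fun r hr r' hr' hrr' =>
    MvPowerSeries.X_dvd_mul _ ((Dvd.intro _ rfl).trans (hmul r hr r' hr' hrr'))
  have h1 : ∀ r ∈ minimalPrimes R, ∀ r' ∈ minimalPrimes R, r ≠ r' →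
      MvPowerSeries.X 1 ∣ α r ∨ MvPowerSeries.X 1 ∣ α r' := fun r hr r' hr' hrr' =>
    MvPowerSeries.X_dvd_mul _ ((Dvd.intro_left _ rfl).trans (hmul r hr r' hr' hrr'))
  -- Each of `u` and `v` kills `a p` or `a q`, hence lies in `p ⊔ q` up to second order.
  have key : ∀ x ∈ ({MvPowerSeries.X 0, MvPowerSeries.X 1} : Set (MvPowerSeries (Fin 2) ℂ)),
      AdicCompletion.evalₐ m 2 (g x) ∈ (p ⊔ q).map (Ideal.Quotient.mk (m ^ 2)) := by
    have aux : ∀ r ∈ minimalPrimes R, r ≤ p ⊔ q → ∀ x,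
        MvPowerSeries.X 0 * MvPowerSeries.X 1 ∣ α r * x →
        AdicCompletion.evalₐ m 2 (g x) ∈ (p ⊔ q).map (Ideal.Quotient.mk (m ^ 2)) := by
      intro r hr hle x hx
      refine Ideal.map_mono hle
        (AdicCompletion.evalₐ_mem_map_of_algebraMap_mul_eq_zero (hann r hr) ?_ 2)
      change ι (a r) * g x = 0
      rw [← hα, ← map_mul, hg0]
      exact hx
    intro x hx
    rcases hx with rfl | rfl
    · rcases h1 p hp q hq hpq with h | h
      · exact aux p hp le_sup_left _ (mul_comm (α p) _ ▸ mul_dvd_mul_left _ h)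
      · exact aux q hq le_sup_right _ (mul_comm (α q) _ ▸ mul_dvd_mul_left _ h)
    · rcases h0 p hp q hq hpq with h | h
      · exact aux p hp le_sup_left _ (mul_dvd_mul_right h _)
      · exact aux q hq le_sup_right _ (mul_dvd_mul_right h _)
  constructor
  · have hple : p ⊔ q ≤ m :=
      sup_le (IsLocalRing.le_maximalIdeal hp.1.1.ne_top) (IsLocalRing.le_maximalIdeal hq.1.1.ne_top)
    refine le_antisymm hple ?_
    refine Submodule.le_of_le_smul_of_le_jacobson_bot (I := m) (IsNoetherian.noetherian _)
      (IsLocalRing.maximalIdeal_le_jacobson _) ?_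
    intro b hb
    obtain ⟨β, hβ⟩ := hg (ι b)
    have hβ0 : MvPowerSeries.constantCoeff β = 0 := by
      by_contra hne
      have h2 := (MvPowerSeries.isUnit_iff_constantCoeff.2 (Ne.isUnit hne)).map g
      rw [hβ] at h2
      have h3 := h2.map (AdicCompletion.evalOneₐ m)
      have h4 : AdicCompletion.evalOneₐ m (ι b) = 0 := by
        rw [AlgHom.commutes]
        exact Ideal.Quotient.eq_zero_iff_mem.2 hb
      rw [h4] at h3
      exact not_isUnit_zero h3
    obtain ⟨γ, δ, hγδ⟩ := MvPowerSeries.exists_eq_X_mul_add_X_mul hβ0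
    have h5 : AdicCompletion.evalₐ m 2 (ι b) ∈ (p ⊔ q).map (Ideal.Quotient.mk (m ^ 2)) := by
      rw [← hβ, hγδ, map_add, map_add, map_mul, map_mul, map_mul, map_mul]
      exact Ideal.add_mem _ (Ideal.mul_mem_right _ _ (key _ (Or.inl rfl)))
        (Ideal.mul_mem_right _ _ (key _ (Or.inr rfl)))
    rw [AlgHom.commutes] at h5
    change Ideal.Quotient.mk _ b ∈ _ at h5
    rw [← Ideal.mem_comap, Ideal.comap_map_of_surjective _ Ideal.Quotient.mk_surjective,
      ← RingHom.ker_eq_comap_bot, Ideal.mk_ker, pow_two] at h5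
    exact h5
  · intro r hr
    by_contra! hcon
    have e0 : MvPowerSeries.X 0 ∣ α r := by
      by_contra hn
      have k1 := (h0 p hp r hr hcon.1.symm).resolve_right hn
      have k2 := (h0 q hq r hr hcon.2.symm).resolve_right hn
      rcases h1 p hp q hq hpq with h | h
      · exact hne p hp ⟨k1, h⟩
      · exact hne q hq ⟨k2, h⟩
    have e1 : MvPowerSeries.X 1 ∣ α r := by
      by_contra hn
      have k1 := (h1 p hp r hr hcon.1.symm).resolve_right hn
      have k2 := (h1 q hq r hr hcon.2.symm).resolve_right hn
      rcases h0 p hp q hq hpq with h | h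
      · exact hne p hp ⟨h, k1⟩
      · exact hne q hq ⟨h, k2⟩
    exact hne r hr ⟨e0, e1⟩

/-! ### Regular local rings of dimension at most two -/

section RegularLocal

open IsLocalRing

variable {R : Type*} [CommRing R] [IsLocalRing R] [IsNoetherianRing R]

theorem exists_eq_unit_mul_pow {y : R} (hy : maximalIdeal R = Ideal.span {y}) {r : R} (hr : r ≠ 0) :
    ∃ (u : Rˣ) (n : ℕ), r = u * y ^ n := by
  have h1 : ∃ n, r ∉ maximalIdeal R ^ n := by
    by_contra! h
    have := Ideal.iInf_pow_eq_bot_of_isLocalRing (maximalIdeal R)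
      (Ideal.IsPrime.ne_top inferInstance)
    exact hr (by simpa [this] using (Ideal.mem_iInf.2 h : r ∈ ⨅ n, maximalIdeal R ^ n))
  classical
  have h2 := Nat.find_spec h1
  have h3 : Nat.find h1 ≠ 0 := fun h => by rw [h] at h2; simp at h2
  obtain ⟨n, hn⟩ := Nat.exists_eq_succ_of_ne_zero h3
  have h4 : r ∈ maximalIdeal R ^ n := by
    by_contra h
    have := Nat.find_min' h1 h
    omega
  rw [hy, Ideal.span_singleton_pow, Ideal.mem_span_singleton] at h4
  obtain ⟨u, rfl⟩ := h4
  have hu : IsUnit u := by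
    by_contra h
    have h5 : u ∈ maximalIdeal R := h
    apply h2
    rw [hn, hy, Ideal.span_singleton_pow, Ideal.mem_span_singleton, pow_succ]
    rw [hy, Ideal.mem_span_singleton] at h5
    exact mul_dvd_mul_left _ h5
  exact ⟨hu.unit, n, by simp [mul_comm]⟩

theorem isDomain_of_maximalIdeal_eq_span {y : R} (hy : maximalIdeal R = Ideal.span {y})
    (hnil : ¬ IsNilpotent y) : IsDomain R := by
  have : NoZeroDivisors R := ⟨fun {a b} hab => by
    by_contra! h
    obtain ⟨u, n, rfl⟩ := exists_eq_unit_mul_pow hy h.1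
    obtain ⟨v, k, rfl⟩ := exists_eq_unit_mul_pow hy h.2
    apply hnil
    refine ⟨n + k, ?_⟩
    have : ((u * v : Rˣ) : R) * y ^ (n + k) = 0 := by
      rw [← hab, Units.val_mul]; ring
    exact (Units.mul_right_eq_zero _).1 this⟩
  exact NoZeroDivisors.to_isDomain R

theorem isPrincipalIdealRing_of_maximalIdeal_eq_span [IsDomain R] {y : R}
    (hy : maximalIdeal R = Ideal.span {y}) : IsPrincipalIdealRing R := by
  refine ⟨fun I => ?_⟩
  by_cases hI : I = ⊥
  · rw [hI]; infer_instance
  obtain ⟨n, rfl⟩ := exists_maximalIdeal_pow_eq_of_principal R ⟨y, hy⟩ I hI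
  rw [hy, Ideal.span_singleton_pow]
  exact ⟨_, rfl⟩

omit [IsNoetherianRing R] in
theorem not_isNilpotent_of_one_le_ringKrullDim {y : R} (hy : maximalIdeal R = Ideal.span {y})
    (hdim : 1 ≤ ringKrullDim R) : ¬ IsNilpotent y := by
  intro h
  have : Ring.KrullDimLE 0 R := .mk₀ fun I hI => by
    have : I = maximalIdeal R := by
      refine le_antisymm (le_maximalIdeal hI.ne_top) ?_
      rw [hy, Ideal.span_singleton_le_iff_mem]
      obtain ⟨n, hn⟩ := h
      exact hI.mem_of_pow_mem n (hn ▸ I.zero_mem)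
    rw [this]; infer_instance
  have h1 := (Ring.krullDimLE_iff (n := 0) (R := R)).1 this
  exact absurd (hdim.trans h1) (by norm_num)

/-- A regular local ring of dimension at most one is a domain. -/
theorem IsRegularLocalRing.isDomain_of_ringKrullDim_le_one {R : Type*} [CommRing R]
    [IsRegularLocalRing R] (hdim : ringKrullDim R ≤ 1) : IsDomain R := by
  have h := IsRegularLocalRing.spanFinrank_maximalIdeal (R := R)
  have hfg : (maximalIdeal R).FG := IsNoetherian.noetherian _
  have hle : (maximalIdeal R).spanFinrank ≤ 1 := by
    rw [← h] at hdim; exact_mod_cast hdim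
  rcases Nat.le_one_iff_eq_zero_or_eq_one.1 hle with h0 | h1
  · have : maximalIdeal R = ⊥ := (Submodule.spanFinrank_eq_zero_iff_eq_bot hfg).1 h0
    exact (IsLocalRing.isField_iff_maximalIdeal_eq.2 this).isDomain
  · obtain ⟨⟨y, hy⟩, -⟩ := (Submodule.spanFinrank_eq_one_iff _).1 h1
    exact isDomain_of_maximalIdeal_eq_span hy
      (not_isNilpotent_of_one_le_ringKrullDim hy (by rw [← h, h1]; norm_num))

theorem one_le_ringKrullDim_quotient {x : R} (hx : x ∈ maximalIdeal R) (hdim : 2 ≤ ringKrullDim R) :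
    1 ≤ ringKrullDim (R ⧸ Ideal.span {x}) := by
  have h := Ideal.height_le_ringKrullDim_quotient_add_one hx
  rw [IsLocalRing.maximalIdeal_height_eq_ringKrullDim] at h
  by_contra! h1
  have h2 : ringKrullDim (R ⧸ Ideal.span {x}) ≤ 0 := by
    generalize ringKrullDim (R ⧸ Ideal.span {x}) = d at h1
    induction d with
    | bot => simp
    | coe e =>
      have : e < 1 := by exact_mod_cast h1
      rw [Order.lt_one_iff] at this
      simp [this]
  have h3 := hdim.trans (h.trans (add_le_add_left h2 1))
  exact absurd h3 (by norm_num)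

variable {x y : R}

/-- A member of a system of two parameters of a two-dimensional regular local ring is prime, and the
quotient by it is a principal ideal domain. -/
theorem isPrime_span_singleton (hm : maximalIdeal R = Ideal.span {x, y})
    (hdim : 2 ≤ ringKrullDim R) :
    (Ideal.span {x}).IsPrime ∧ IsPrincipalIdealRing (R ⧸ Ideal.span {x}) := by
  have hx : x ∈ maximalIdeal R := by rw [hm]; exact Ideal.subset_span (by simp)
  have h1 := one_le_ringKrullDim_quotient hx hdim
  have hne : Ideal.span {x} ≠ ⊤ := fun h => by
    rw [Ideal.span_singleton_eq_top] at h; exact hx h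
  have : Nontrivial (R ⧸ Ideal.span {x}) := Ideal.Quotient.nontrivial_iff.2 hne
  have : IsLocalRing (R ⧸ Ideal.span {x}) := .of_surjective' _ Ideal.Quotient.mk_surjective
  have hmax : maximalIdeal (R ⧸ Ideal.span {x}) = Ideal.span {Ideal.Quotient.mk _ y} := by
    have : maximalIdeal (R ⧸ Ideal.span {x}) = (maximalIdeal R).map (Ideal.Quotient.mk _) :=
      (IsLocalRing.map_maximalIdeal_of_surjective _ Ideal.Quotient.mk_surjective).symm
    rw [this, hm, Ideal.map_span, Set.image_pair, Ideal.Quotient.eq_zero_iff_mem.2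
      (Ideal.mem_span_singleton_self x), Ideal.span_insert]
    simp
  have hd := isDomain_of_maximalIdeal_eq_span hmax (not_isNilpotent_of_one_le_ringKrullDim hmax h1)
  exact ⟨(Ideal.Quotient.isDomain_iff_prime _).1 hd,
    isPrincipalIdealRing_of_maximalIdeal_eq_span hmax⟩

variable [IsDomain R]

/-- A two-dimensional regular local domain is factorial: if the parameter `x` does not lie in the
prime `p`, then `p` is principal since `p / x p` embeds into the principal ideal ring `R / x`. -/
theorem uniqueFactorizationMonoid_of_maximalIdeal_eq_span
    (hm : maximalIdeal R = Ideal.span {x, y}) (hdim : 2 ≤ ringKrullDim R) :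
    UniqueFactorizationMonoid R := by
  obtain ⟨hp, hpir⟩ := isPrime_span_singleton hm hdim
  have hx : x ∈ maximalIdeal R := by rw [hm]; exact Ideal.subset_span (by simp)
  have hx0 : x ≠ 0 := by
    rintro rfl
    have hm' : maximalIdeal R = Ideal.span {y} := by rw [hm, Ideal.span_insert]; simp
    have := isPrincipalIdealRing_of_maximalIdeal_eq_span hm'
    have h3 : ringKrullDim R ≤ 1 := (Ring.krullDimLE_iff (n := 1) (R := R)).1 inferInstance
    exact absurd (hdim.trans h3) (by norm_num)
  refine UniqueFactorizationMonoid.iff_exists_prime_mem_of_isPrime.2 fun I hI hIp => ?_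
  by_cases hxI : x ∈ I
  · exact ⟨x, hxI, (Ideal.span_singleton_prime hx0).1 hp⟩
  obtain ⟨b, hb⟩ := (hpir.principal (I.map (Ideal.Quotient.mk (Ideal.span {x})))).principal
  have hb' : b ∈ I.map (Ideal.Quotient.mk (Ideal.span {x})) := by
    rw [hb]; exact Submodule.mem_span_singleton_self b
  obtain ⟨c, hc, rfl⟩ := (Ideal.mem_map_iff_of_surjective _ Ideal.Quotient.mk_surjective).1 hb'
  have hIc : I = Ideal.span {c} := by
    refine le_antisymm ?_ ((Ideal.span_singleton_le_iff_mem _).2 hc)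
    refine Submodule.le_of_le_smul_of_le_jacobson_bot (I := maximalIdeal R)
      (IsNoetherian.noetherian _) (IsLocalRing.maximalIdeal_le_jacobson _) ?_
    intro a ha
    have h1 : Ideal.Quotient.mk (Ideal.span {x}) a ∈
        Ideal.span {Ideal.Quotient.mk (Ideal.span {x}) c} := by
      have := Ideal.mem_map_of_mem (Ideal.Quotient.mk (Ideal.span {x})) ha
      rw [hb] at this; exact this
    obtain ⟨d, hd⟩ := Ideal.mem_span_singleton.1 h1
    obtain ⟨d, rfl⟩ := Ideal.Quotient.mk_surjective d
    rw [← map_mul, Ideal.Quotient.eq, Ideal.mem_span_singleton] at hd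
    obtain ⟨e, he⟩ := hd
    have h2 : e ∈ I := (hIp.mem_or_mem
      (he ▸ I.sub_mem ha (I.mul_mem_right _ hc) : x * e ∈ I)).resolve_left hxI
    rw [sub_eq_iff_eq_add.1 he, add_comm]
    exact Submodule.add_mem_sup (Ideal.mul_mem_right _ _ (Ideal.mem_span_singleton_self c))
      (Submodule.smul_mem_smul hx h2)
  refine ⟨c, hc, ?_⟩
  rw [← Ideal.span_singleton_prime]
  · rw [← hIc]; exact hIp
  · rintro rfl; simp at hIc; exact hI hIc

end RegularLocal

/-! ### Local rings of smooth algebras at closed points -/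

section Smooth

/-- Every maximal ideal of a polynomial ring in `n` variables over a field has height `n`. -/
theorem MvPolynomial.height_eq_card_of_isMaximal {k : Type*} [Field k] {ι : Type*} [Finite ι]
    (M : Ideal (MvPolynomial ι k)) [M.IsMaximal] : M.height = Nat.card ι := by
  induction ι using Finite.induction_empty_option with
  | @of_equiv α β e H =>
    let f := (renameEquiv k e).toRingEquiv
    have : (M.comap f).IsMaximal := Ideal.comap_isMaximal_of_equiv f
    rw [← Nat.card_congr e, ← H (M.comap f), RingEquiv.height_comap]
  | h_empty =>
    have : IsField (MvPolynomial PEmpty k) :=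
      (isEmptyRingEquiv k PEmpty).toMulEquiv.isField (Field.toIsField k)
    let := this.toField
    have h : M = ⊥ := Ideal.eq_bot_of_prime M
    rw [h]; simp
  | @h_option α _ H =>
    let f := (optionEquivLeft k α).toRingEquiv.symm
    have h1 : (M.comap f).IsMaximal := Ideal.comap_isMaximal_of_equiv f
    have h2 : ((M.comap f).comap Polynomial.C).IsMaximal :=
      Polynomial.isMaximal_comap_C_of_isJacobsonRing _
    have h3 : (M.comap f).LiesOver ((M.comap f).comap Polynomial.C) := ⟨rfl⟩
    rw [← RingEquiv.height_comap f M,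
      Polynomial.height_eq_height_add_one ((M.comap f).comap Polynomial.C), H]
    simp

variable {k A : Type*} [Field k] [CommRing A] [Algebra k A] {n : ℕ}

/-- A standard smooth algebra of relative dimension `n` is the quotient of a polynomial ring in `n +
c` variables by `c` relations, so that maximal ideals have height at least `n` by Krull's height
theorem. -/
theorem Algebra.IsStandardSmoothOfRelativeDimension.le_height
    [h : Algebra.IsStandardSmoothOfRelativeDimension n k A] (m : Ideal A) [m.IsMaximal] :
    n ≤ m.height := by
  obtain ⟨ι, σ, hσ, hι, P, hP⟩ := h.out
  let f : P.Ring →+* A := algebraMap P.Ring A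
  have hf : Function.Surjective f := P.algebraMap_surjective
  let M := m.comap f
  have hM : M.IsMaximal := Ideal.comap_isMaximal_of_surjective f hf
  have h1 : M.height = Nat.card ι := MvPolynomial.height_eq_card_of_isMaximal M
  have hle : RingHom.ker f ≤ M := Ideal.comap_mono bot_le
  have h2 := Ideal.height_le_height_add_spanFinrank_of_le hle
  have h3 : (RingHom.ker f).spanFinrank ≤ Nat.card σ := by
    have : RingHom.ker f = Ideal.span (Set.range P.relation) := P.span_range_relation_eq_ker.symm
    rw [this]
    refine (Submodule.spanFinrank_span_le_ncard_of_finite (Set.finite_range _)).trans ?_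
    rw [← Set.image_univ, ← Set.ncard_univ]
    exact Set.ncard_image_le
  have h4 : (M.map (Ideal.Quotient.mk (RingHom.ker f))).height = m.height := by
    let e := RingHom.quotientKerEquivOfSurjective hf
    rw [← RingEquiv.height_comap e m]
    congr 1
    exact Ideal.map_comap_of_surjective _ Ideal.Quotient.mk_surjective (m.comap e)
  rw [h1, h4] at h2
  have h5 : Nat.card ι - Nat.card σ = n := hP
  have h6 := P.card_relations_le_card_vars_of_isFinite
  have h7 : (Nat.card ι : ℕ∞) ≤ m.height + Nat.card σ := h2.trans (by gcongr)
  have h8 : ((n + Nat.card σ : ℕ) : ℕ∞) ≤ m.height + Nat.card σ := by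
    rw [← h5, Nat.sub_add_cancel h6]; exact h7
  push_cast at h8
  exact (ENat.add_le_add_iff_right (ENat.natCast_ne_top _)).1 h8

/-- The maximal ideal of a `k`-rational point of a smooth algebra of relative dimension `n` is
generated by `n` elements modulo its square: the derivation `a ↦ a - a(m)` exhibits `m / m ^ 2`
as a quotient of the module of differentials. -/
theorem Algebra.IsStandardSmoothOfRelativeDimension.exists_le_span_sup_sq
    [h : Algebra.IsStandardSmoothOfRelativeDimension n k A] (m : Ideal A) [m.IsMaximal]
    (hm : Function.Bijective (algebraMap k (A ⧸ m))) :
    ∃ x : Fin n → A, (∀ i, x i ∈ m) ∧ m ≤ Ideal.span (Set.range x) ⊔ m ^ 2 := by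
  have : Nontrivial (A ⧸ m) := Ideal.Quotient.nontrivial_iff.2 (Ideal.IsMaximal.ne_top ‹_›)
  have : Nontrivial A := (Ideal.Quotient.mk m).domain_nontrivial
  have := Algebra.IsStandardSmoothOfRelativeDimension.isStandardSmooth n (R := k) (S := A)
  have hrank : Module.rank A (Ω[A⁄k]) = n :=
    Algebra.IsStandardSmoothOfRelativeDimension.rank_kaehlerDifferential n
  have hfr : Module.finrank A (Ω[A⁄k]) = n := Module.finrank_eq_of_rank_eq hrank
  have : Module.Finite A (Ω[A⁄k]) := Module.finite_of_rank_eq_nat hrank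
  let b := Module.finBasisOfFinrankEq A (Ω[A⁄k]) hfr
  let e : k ≃ₐ[k] A ⧸ m := AlgEquiv.ofBijective (Algebra.ofId k (A ⧸ m)) hm
  let ev : A →ₐ[k] k := e.symm.toAlgHom.comp (Ideal.Quotient.mkₐ k m)
  have hev : ∀ a, a - algebraMap k A (ev a) ∈ m := fun a => by
    rw [← Ideal.Quotient.eq_zero_iff_mem, map_sub, sub_eq_zero]
    change Ideal.Quotient.mk m a = algebraMap k (A ⧸ m) (e.symm (Ideal.Quotient.mk m a))
    exact (e.apply_symm_apply _).symm
  have hev0 : ∀ a ∈ m, ev a = 0 := fun a ha => by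
    change e.symm (Ideal.Quotient.mk m a) = 0
    rw [Ideal.Quotient.eq_zero_iff_mem.2 ha, map_zero]
  let d : A →ₗ[k] m.Cotangent :=
    { toFun := fun a => m.toCotangent ⟨a - algebraMap k A (ev a), hev a⟩
      map_add' := fun a a' => by
        rw [← map_add]; congr 1; ext; simp; ring
      map_smul' := fun c a => by
        rw [RingHom.id_apply, ← IsScalarTower.algebraMap_smul A c (m.toCotangent _), ← map_smul]
        congr 1; ext; simp [Algebra.smul_def]; ring }
  have hd : ∀ a, d a = m.toCotangent ⟨a - algebraMap k A (ev a), hev a⟩ := fun a => rfl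
  let D : Derivation k A m.Cotangent := Derivation.mk' d fun a a' => by
    rw [hd, hd, hd, ← map_smul, ← map_smul, ← map_add, Ideal.toCotangent_eq]
    have : (a * a' - algebraMap k A (ev (a * a'))) -
        (a * (a' - algebraMap k A (ev a')) + a' * (a - algebraMap k A (ev a))) =
        -((a - algebraMap k A (ev a)) * (a' - algebraMap k A (ev a'))) := by
      rw [map_mul, map_mul]; ring
    simp only [Submodule.coe_add, Submodule.coe_smul, smul_eq_mul, this]
    rw [pow_two]
    exact neg_mem (Ideal.mul_mem_mul (hev a) (hev a'))
  choose x hx using fun i => m.toCotangent_surjective (D.liftKaehlerDifferential (b i))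
  refine ⟨fun i => x i, fun i => (x i).2, fun a ha => ?_⟩
  have h1 : D.liftKaehlerDifferential (KaehlerDifferential.D k A a) = m.toCotangent ⟨a, ha⟩ := by
    rw [Derivation.liftKaehlerDifferential_comp_D]
    change d a = _
    rw [hd]
    congr 1; ext; simp [hev0 a ha]
  rw [← b.sum_repr (KaehlerDifferential.D k A a), map_sum] at h1
  simp only [map_smul, ← hx] at h1
  simp only [← map_smul, ← map_sum] at h1
  rw [Ideal.toCotangent_eq] at h1
  have h2 : a = (∑ i, b.repr (KaehlerDifferential.D k A a) i * (x i : A)) +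
      -((∑ i, b.repr (KaehlerDifferential.D k A a) i * (x i : A)) - a) := by ring
  rw [h2]
  refine Submodule.add_mem_sup (Ideal.sum_mem _ fun i _ => Ideal.mul_mem_left _ _
    (Ideal.subset_span ⟨i, rfl⟩)) (neg_mem ?_)
  simpa using h1

/-- The local ring of a smooth algebra of relative dimension `n` at a rational point is regular of
dimension `n`. -/
theorem Algebra.IsStandardSmoothOfRelativeDimension.exists_maximalIdeal_eq_span
    [h : Algebra.IsStandardSmoothOfRelativeDimension n k A] (m : Ideal A) [m.IsMaximal]
    (hm : Function.Bijective (algebraMap k (A ⧸ m))) (O : Type*) [CommRing O] [Algebra A O]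
    [IsLocalization.AtPrime O m] [IsLocalRing O] [IsNoetherianRing O] :
    (∃ x : Fin n → O, IsLocalRing.maximalIdeal O = Ideal.span (Set.range x)) ∧
      n ≤ ringKrullDim O := by
  constructor
  · obtain ⟨x, hx, hle⟩ := exists_le_span_sup_sq (n := n) m hm
    have hmO : IsLocalRing.maximalIdeal O = m.map (algebraMap A O) :=
      (IsLocalization.AtPrime.map_eq_maximalIdeal m O).symm
    refine ⟨fun i => algebraMap A O (x i), le_antisymm ?_ ?_⟩
    · refine Submodule.le_of_le_smul_of_le_jacobson_bot (I := IsLocalRing.maximalIdeal O)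
        (IsNoetherian.noetherian _) (IsLocalRing.maximalIdeal_le_jacobson _) ?_
      rw [smul_eq_mul, ← pow_two, hmO]
      refine (Ideal.map_mono hle).trans ?_
      rw [Ideal.map_sup, Ideal.map_span, Ideal.map_pow, ← Set.range_comp]
      rfl
    · rw [Ideal.span_le, hmO]
      rintro _ ⟨i, rfl⟩
      exact Ideal.mem_map_of_mem _ (hx i)
  · rw [IsLocalization.AtPrime.ringKrullDim_eq_height m O]
    exact_mod_cast le_height (k := k) (n := n) m

end Smooth

/-! ### Sums of orders of vanishing over valuation rings of a field -/

namespace ValuationSubring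

variable {K : Type*} [Field K]

open scoped Classical in
/-- The normalized order of `x` at a valuation subring that is a discrete valuation ring; the
value at other valuation subrings is `0` by convention. -/
def vord (V : ValuationSubring K) (x : K) : ℤ :=
  if _ : IsDiscreteValuationRing V then WithZero.log (Ring.ordFrac V x) else 0

theorem vord_mul (V : ValuationSubring K) {x y : K} (hx : x ≠ 0) (hy : y ≠ 0) :
    V.vord (x * y) = V.vord x + V.vord y := by
  unfold vord
  split_ifs with h
  · rw [map_mul, WithZero.log_mul]
    · exact (map_ne_zero _).2 hx
    · exact (map_ne_zero _).2 hy
  · rfl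

theorem vord_of_valuation_eq_one (V : ValuationSubring K) {x : K} (hx : V.valuation x = 1) :
    V.vord x = 0 := by
  unfold vord
  split_ifs with h
  · have hxV : x ∈ V := (V.valuation_le_one_iff x).1 hx.le
    have hu : IsUnit (⟨x, hxV⟩ : V) := (V.valuation_eq_one_iff _).2 hx
    have := Ring.ordFrac_of_isUnit (K := K) hu
    rw [show x = algebraMap V K ⟨x, hxV⟩ from rfl, this, WithZero.log_one]
  · rfl

theorem vord_inv (V : ValuationSubring K) {x : K} (hx : x ≠ 0) : V.vord x⁻¹ = -V.vord x := by
  have h := V.vord_mul hx (inv_ne_zero hx)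
  rw [mul_inv_cancel₀ hx, V.vord_of_valuation_eq_one (map_one _)] at h
  omega

/-- The sum of the orders of `x` at the valuation subrings in `s` is finite and equal to `n`. -/
def HasOrdSum (s : Set (ValuationSubring K)) (x : K) (n : ℤ) : Prop :=
  (s ∩ Function.support (fun V => V.vord x)).Finite ∧ ∑ᶠ V ∈ s, V.vord x = n

theorem HasOrdSum.mul {s : Set (ValuationSubring K)} {x y : K} {m n : ℤ} (hx : x ≠ 0) (hy : y ≠ 0)
    (h : HasOrdSum s x m) (h' : HasOrdSum s y n) : HasOrdSum s (x * y) (m + n) := by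
  have e : (fun V : ValuationSubring K => V.vord (x * y)) = fun V => V.vord x + V.vord y :=
    funext fun V => V.vord_mul hx hy
  refine ⟨?_, ?_⟩
  · refine (h.1.union h'.1).subset ?_
    rintro V ⟨hV, hV'⟩
    simp only [e, Function.mem_support] at hV'
    by_cases h0 : V.vord x = 0
    · exact Or.inr ⟨hV, fun h1 => hV' (by simp only at h1; rw [h0, h1, add_zero])⟩
    · exact Or.inl ⟨hV, h0⟩
  · rw [← h.2, ← h'.2, ← finsum_mem_add_distrib' h.1 h'.1]
    exact finsum_congr fun V => by rw [V.vord_mul hx hy]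

theorem HasOrdSum.inv {s : Set (ValuationSubring K)} {x : K} {n : ℤ} (hx : x ≠ 0)
    (h : HasOrdSum s x n) : HasOrdSum s x⁻¹ (-n) := by
  refine ⟨?_, ?_⟩
  · simpa [Function.support, vord_inv _ hx] using h.1
  · simp only [vord_inv _ hx]
    rw [← h.2, ← finsum_neg_distrib]
    exact finsum_congr fun V => finsum_neg_distrib _

theorem hasOrdSum_of_valuation_eq_one {s : Set (ValuationSubring K)} {x : K}
    (h : ∀ V ∈ s, V.valuation x = 1) : HasOrdSum s x 0 := by
  have h' : ∀ V ∈ s, V.vord x = 0 := fun V hV => V.vord_of_valuation_eq_one (h V hV)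
  refine ⟨?_, finsum_mem_of_eqOn_zero h'⟩
  convert Set.finite_empty
  ext V
  simpa using fun hV => h' V hV

/-- If every nonzero element is a power of `p` times a unit, then `V` is a discrete valuation ring
with uniformizer `p`. -/
theorem vord_eq_one_of_generator (V : ValuationSubring K) {p : K} (hp : V.valuation p < 1)
    (hp0 : p ≠ 0) (h : ∀ x : K, x ≠ 0 → ∃ (n : ℤ) (u : K), V.valuation u = 1 ∧ x = p ^ n * u) :
    V.vord p = 1 := by
  have hpV : p ∈ V := (V.valuation_le_one_iff p).1 hp.le
  have hp1 : 0 < V.valuation p := zero_lt_iff.2 ((map_ne_zero _).2 hp0)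
  have hirr : Irreducible (⟨p, hpV⟩ : V) := by
    refine ⟨fun hu => ?_, ?_⟩
    · rw [valuation_eq_one_iff] at hu
      exact hp.ne hu
    · rintro ⟨a, ha⟩ ⟨b, hb⟩ hab
      have hab : p = a * b := congrArg Subtype.val hab
      have ha0 : a ≠ 0 := by rintro rfl; simp at hab; exact hp0 hab
      have hb0 : b ≠ 0 := by rintro rfl; simp at hab; exact hp0 hab
      obtain ⟨n, u, hu, rfl⟩ := h a ha0
      obtain ⟨m, w, hw, rfl⟩ := h b hb0
      have hv := congrArg V.valuation hab
      simp only [valuation_eq_one_iff]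
      rw [← valuation_le_one_iff] at ha hb
      simp only [map_mul, map_zpow₀, hu, hw, mul_one] at ha hb hv ⊢
      rw [zpow_le_one_iff_right_of_lt_one₀ hp1 hp] at ha hb
      rw [← zpow_add₀ hp1.ne'] at hv
      have hnm : n + m = 1 := by
        by_contra hne
        rcases lt_or_gt_of_ne hne with h2 | h2
        · have := (zpow_lt_zpow_iff_right_of_lt_one₀ hp1 hp).2 h2
          rw [← hv, zpow_one] at this
          exact this.false
        · have := (zpow_lt_zpow_iff_right_of_lt_one₀ hp1 hp).2 h2
          rw [← hv, zpow_one] at this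
          exact this.false
      rcases (show n = 0 ∨ m = 0 by omega) with rfl | rfl
      · exact Or.inl (zpow_zero _)
      · exact Or.inr (zpow_zero _)
  have hdvr : IsDiscreteValuationRing V := by
    apply IsDiscreteValuationRing.ofHasUnitMulPowIrreducibleFactorization
    refine ⟨⟨p, hpV⟩, hirr, ?_⟩
    rintro ⟨x, hx⟩ hx0
    obtain ⟨n, u, hu, hxu⟩ := h x (fun h0 => hx0 (Subtype.ext h0))
    rw [← valuation_le_one_iff, hxu, map_mul, hu, mul_one, map_zpow₀,
      zpow_le_one_iff_right_of_lt_one₀ hp1 hp] at hx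
    lift n to ℕ using hx
    have huV : u ∈ V := (V.valuation_le_one_iff u).1 hu.le
    have huu : IsUnit (⟨u, huV⟩ : V) := (V.valuation_eq_one_iff _).2 hu
    refine ⟨n, huu.unit, Subtype.ext ?_⟩
    simp [hxu]
  unfold vord
  rw [dif_pos hdvr, show p = algebraMap V K ⟨p, hpV⟩ from rfl, Ring.ordFrac_irreducible hirr]
  simp

/-- The valuation subrings of `K`, other than `K` itself, that contain the image of `T`. -/
def nontrivialOver (T K : Type*) [CommRing T] [Field K] [Algebra T K] :
    Set (ValuationSubring K) :=
  {V | (∀ t : T, algebraMap T K t ∈ V) ∧ V ≠ ⊤}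

section PID

variable {T : Type*} [CommRing T] [IsDomain T] [IsPrincipalIdealRing T] [Algebra T K]
  [IsFractionRing T K]

/-- Let `p` be a prime element of a principal ideal domain `T`. Every nonzero element of the
fraction field is a power of `p` times an element that is a unit at each valuation subring
over `T` at which `p` is not a unit. -/
theorem exists_eq_zpow_mul_of_prime {p : T} (hp : Prime p) {x : K} (hx : x ≠ 0) :
    ∃ (n : ℤ) (u : K), x = algebraMap T K p ^ n * u ∧
      ∀ V ∈ nontrivialOver T K, V.valuation (algebraMap T K p) < 1 → V.valuation u = 1 := by
  have hpK : algebraMap T K p ≠ 0 := by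
    simpa using hp.ne_zero
  have key : ∀ t : T, t ≠ 0 → ∃ (n : ℕ) (u : T), t = p ^ n * u ∧
      ∀ V ∈ nontrivialOver T K, V.valuation (algebraMap T K p) < 1 →
        V.valuation (algebraMap T K u) = 1 := by
    intro t ht
    obtain ⟨n, u, hu, rfl⟩ := WfDvdMonoid.max_power_factor ht hp.irreducible
    refine ⟨n, u, rfl, fun V hV hpV => ?_⟩
    have hcop : IsCoprime p u := (hp.irreducible.coprime_iff_not_dvd).2 hu
    obtain ⟨a, b, hab⟩ := hcop
    refine le_antisymm ((V.valuation_le_one_iff _).2 (hV.1 u)) (not_lt.1 fun hlt => ?_)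
    have h1 := congrArg (fun t => V.valuation (algebraMap T K t)) hab
    simp only [map_add, map_mul, map_one] at h1
    have h2 := V.valuation.map_add_lt
      (x := algebraMap T K a * algebraMap T K p) (y := algebraMap T K b * algebraMap T K u)
      (g := 1) ?_ ?_
    · exact h2.ne h1
    · rw [map_mul]
      exact mul_lt_one_of_nonneg_of_lt_one_right ((V.valuation_le_one_iff _).2 (hV.1 a)) zero_le hpV
    · rw [map_mul]
      exact mul_lt_one_of_nonneg_of_lt_one_right ((V.valuation_le_one_iff _).2 (hV.1 b)) zero_le hlt
  obtain ⟨a, b, hb, rfl⟩ := IsFractionRing.div_surjective (A := T) x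
  have hb0 : b ≠ 0 := nonZeroDivisors.ne_zero hb
  have ha0 : a ≠ 0 := by
    rintro rfl
    simp at hx
  obtain ⟨n, u, rfl, hu⟩ := key a ha0
  obtain ⟨m, w, rfl, hw⟩ := key b hb0
  refine ⟨n - m, algebraMap T K u / algebraMap T K w, ?_, fun V hV hpV => ?_⟩
  · rw [zpow_sub₀ hpK]
    simp only [map_mul, map_pow, zpow_natCast]
    rw [mul_div_mul_comm]
  · rw [map_div₀, hu V hV hpV, hw V hV hpV, div_one]

theorem existsUnique_valuation_lt_one_of_prime {p : T} (hp : Prime p) :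
    ∃! V : ValuationSubring K, V ∈ nontrivialOver T K ∧ V.valuation (algebraMap T K p) < 1 := by
  have hpK : algebraMap T K p ≠ 0 := by
    simpa using hp.ne_zero
  refine existsUnique_of_exists_of_unique ?_ ?_
  · let v : IsDedekindDomain.HeightOneSpectrum T :=
      ⟨Ideal.span {p}, (Ideal.span_singleton_prime hp.ne_zero).2 hp, by
        simpa using hp.ne_zero⟩
    have hlt : (v.valuation K) (algebraMap T K p) < 1 :=
      (v.valuation_lt_one_iff_mem p).2 (Ideal.mem_span_singleton_self p)
    have hni : (algebraMap T K p)⁻¹ ∉ (v.valuation K).valuationSubring := by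
      rw [Valuation.mem_valuationSubring_iff, map_inv₀, not_le]
      exact (one_lt_inv₀ (zero_lt_iff.2 ((map_ne_zero _).2 hpK))).2 hlt
    refine ⟨(v.valuation K).valuationSubring, ⟨fun t => v.valuation_le_one t, ?_⟩, ?_⟩
    · intro h
      rw [h] at hni
      exact hni (mem_top _)
    · rw [← not_le]
      intro h
      apply hni
      rw [← valuation_le_one_iff, map_inv₀]
      exact inv_le_one_of_one_le₀ h
  · rintro V W ⟨hV, hpV⟩ ⟨hW, hpW⟩
    ext x
    by_cases hx : x = 0
    · simp [hx]
    obtain ⟨n, u, rfl, hu⟩ := exists_eq_zpow_mul_of_prime hp hx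
    rw [← valuation_le_one_iff, ← valuation_le_one_iff, map_mul, map_mul, hu V hV hpV, hu W hW hpW,
      mul_one, mul_one, map_zpow₀, map_zpow₀,
      zpow_le_one_iff_right_of_lt_one₀ (zero_lt_iff.2 ((map_ne_zero _).2 hpK)) hpV,
      zpow_le_one_iff_right_of_lt_one₀ (zero_lt_iff.2 ((map_ne_zero _).2 hpK)) hpW]

/-- The localization at `p` is the only valuation subring at which `p` is not a unit. -/
theorem hasOrdSum_of_prime {p : T} (hp : Prime p) :
    HasOrdSum (nontrivialOver T K) (algebraMap T K p) 1 := by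
  have hpK : algebraMap T K p ≠ 0 := by
    simpa using hp.ne_zero
  obtain ⟨V, ⟨hV, hpV⟩, huniq⟩ := existsUnique_valuation_lt_one_of_prime (K := K) hp
  have h0 : ∀ W ∈ nontrivialOver T K, W ≠ V → W.vord (algebraMap T K p) = 0 := by
    intro W hW hne
    apply vord_of_valuation_eq_one
    refine le_antisymm ((W.valuation_le_one_iff _).2 (hW.1 p)) (not_lt.1 fun hlt => ?_)
    exact hne (huniq W ⟨hW, hlt⟩)
  have h1 : V.vord (algebraMap T K p) = 1 := by
    refine V.vord_eq_one_of_generator hpV hpK fun x hx => ?_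
    obtain ⟨n, u, rfl, hu⟩ := exists_eq_zpow_mul_of_prime hp hx
    exact ⟨n, u, hu V hV hpV, rfl⟩
  have hsub : nontrivialOver T K ∩ Function.support (fun V => V.vord (algebraMap T K p)) = {V} := by
    ext W
    simp only [Set.mem_inter_iff, Function.mem_support, Set.mem_singleton_iff]
    constructor
    · rintro ⟨hW, hW'⟩
      by_contra hne
      exact hW' (h0 W hW hne)
    · rintro rfl
      exact ⟨hV, by rw [h1]; exact one_ne_zero⟩
  refine ⟨hsub ▸ Set.finite_singleton V, ?_⟩
  rw [← finsum_mem_inter_support, hsub, finsum_mem_singleton, h1]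

/-- In the fraction field of a principal ideal domain `T`, the orders of `a ∈ T` at the valuation
subrings over `T` add up to the length of `T / a`. -/
theorem hasOrdSum_ord {a : T} (ha : a ≠ 0) :
    HasOrdSum (nontrivialOver T K) (algebraMap T K a) ((Ring.ord T a).toNat : ℤ) := by
  induction a using UniqueFactorizationMonoid.induction_on_prime with
  | h₁ => exact absurd rfl ha
  | h₂ x hx =>
    rw [Ring.ord_of_isUnit hx]
    refine hasOrdSum_of_valuation_eq_one fun V hV => ?_
    obtain ⟨y, hxy⟩ := hx.exists_right_inv
    have hxy' := congrArg (fun t => V.valuation (algebraMap T K t)) hxy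
    simp only [map_mul, map_one] at hxy'
    refine le_antisymm ((V.valuation_le_one_iff _).2 (hV.1 x)) (not_lt.1 fun hlt => ?_)
    exact (mul_lt_one_of_nonneg_of_lt_one_left zero_le hlt
      ((V.valuation_le_one_iff _).2 (hV.1 y))).ne hxy'
  | h₃ a p h0 hp ih =>
    have ha0 : a ≠ 0 := h0
    rw [map_mul, Ring.ord_mul T (mem_nonZeroDivisors_of_ne_zero h0),
      Ring.ord_of_irreducible hp.irreducible,
      ENat.toNat_add ENat.one_ne_top (Ring.ord_ne_top (mem_nonZeroDivisors_of_ne_zero h0))]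
    push_cast
    exact HasOrdSum.mul (by simpa using hp.ne_zero) (by simpa using h0) (hasOrdSum_of_prime hp)
      (ih h0)

end PID

end ValuationSubring

/-! ### Lengths over one-dimensional local rings and their normalizations -/

section Length

/-- Lengths over `R` and over an `R`-algebra `T` agree if `R` surjects onto the residue fields
of `T`. -/
theorem Module.length_eq_of_residue_surjective {R T : Type*} [CommRing R] [CommRing T] [Algebra R T]
    (h : ∀ n : Ideal T, n.IsMaximal → Function.Surjective (algebraMap R (T ⧸ n)))
    {M : Type*} [AddCommGroup M] [Module T M] (hM : IsFiniteLength T M) :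
    ∀ [Module R M] [IsScalarTower R T M], Module.length R M = Module.length T M := by
  induction hM with
  | of_subsingleton =>
    intro _ _
    rw [Module.length_eq_zero, Module.length_eq_zero]
  | @of_simple_quotient M _ _ N hs hN ih =>
    intro _ _
    obtain ⟨I, hI, ⟨e⟩⟩ := isSimpleModule_iff_quot_maximal.1 hs
    have h1 : Module.length T (M ⧸ N) = 1 := Module.length_eq_one_iff.2 hs
    have h2 : Module.length R (M ⧸ N) = Module.length T (M ⧸ N) := by
      rw [(e.restrictScalars R).length_eq, e.length_eq,
        Module.length_eq_of_surjective (M := T ⧸ I) (R := T ⧸ I) (S := R) (h I hI),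
        Module.length_eq_of_surjective (M := T ⧸ I) (R := T ⧸ I) (S := T)
          Ideal.Quotient.mk_surjective]
    rw [Module.length_eq_add_of_exact (R := T) N.subtype N.mkQ N.injective_subtype N.mkQ_surjective
      (LinearMap.exact_subtype_mkQ N),
      Module.length_eq_add_of_exact (R := R) (N.subtype.restrictScalars R) (N.mkQ.restrictScalars R)
        N.injective_subtype N.mkQ_surjective (LinearMap.exact_subtype_mkQ N), ih, h2]

/-- If the cokernel of the injection `ι : N → M` has finite length, then compatible injective
endomorphisms of `N` and `M` have cokernels of equal length: both lengths, increased by that of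
`M / N`, give the length of the cokernel of the composite `N → M`. -/
theorem Module.length_quotient_range_eq {R N M : Type*} [CommRing R] [AddCommGroup N] [Module R N]
    [AddCommGroup M] [Module R M] (ι : N →ₗ[R] M) (hι : Function.Injective ι) (φ : N →ₗ[R] N)
    (ψ : M →ₗ[R] M) (hψ : Function.Injective ψ) (hc : ψ ∘ₗ ι = ι ∘ₗ φ)
    (hfin : Module.length R (M ⧸ LinearMap.range ι) ≠ ⊤) :
    Module.length R (N ⧸ LinearMap.range φ) = Module.length R (M ⧸ LinearMap.range ψ) := by
  have hc' : ∀ x, ψ (ι x) = ι (φ x) := fun x => LinearMap.congr_fun hc x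
  set P := LinearMap.range (ι ∘ₗ φ) with hP
  have e1 : Module.length R (M ⧸ P) =
      Module.length R (N ⧸ LinearMap.range φ) + Module.length R (M ⧸ LinearMap.range ι) := by
    refine Module.length_eq_add_of_exact
      (Submodule.mapQ (LinearMap.range φ) P ι ?_)
      (Submodule.mapQ P (LinearMap.range ι) LinearMap.id ?_) ?_ ?_ ?_
    · rintro _ ⟨y, rfl⟩
      exact ⟨y, rfl⟩
    · rintro _ ⟨y, rfl⟩
      exact ⟨φ y, rfl⟩
    · rw [injective_iff_map_eq_zero]
      intro x
      obtain ⟨x, rfl⟩ := Submodule.mkQ_surjective _ x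
      simp only [Submodule.mkQ_apply, Submodule.mapQ_apply, Submodule.Quotient.mk_eq_zero]
      rintro ⟨y, hy⟩
      exact ⟨y, hι hy⟩
    · intro x
      obtain ⟨x, rfl⟩ := Submodule.mkQ_surjective _ x
      exact ⟨Submodule.Quotient.mk x, rfl⟩
    · intro x
      obtain ⟨x, rfl⟩ := Submodule.mkQ_surjective _ x
      simp only [Submodule.mkQ_apply, Submodule.mapQ_apply, LinearMap.id_apply,
        Submodule.Quotient.mk_eq_zero]
      constructor
      · rintro ⟨y, rfl⟩
        exact ⟨Submodule.Quotient.mk y, rfl⟩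
      · rintro ⟨y, hy⟩
        obtain ⟨y, rfl⟩ := Submodule.mkQ_surjective _ y
        simp only [Submodule.mkQ_apply, Submodule.mapQ_apply] at hy
        rw [Submodule.Quotient.eq] at hy
        obtain ⟨w, hw⟩ := hy
        refine ⟨y - φ w, ?_⟩
        have hw : ι (φ w) = ι y - x := hw
        rw [map_sub, hw]
        abel
  have e2 : Module.length R (M ⧸ P) =
      Module.length R (M ⧸ LinearMap.range ι) + Module.length R (M ⧸ LinearMap.range ψ) := by
    refine Module.length_eq_add_of_exact
      (Submodule.mapQ (LinearMap.range ι) P ψ ?_)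
      (Submodule.mapQ P (LinearMap.range ψ) LinearMap.id ?_) ?_ ?_ ?_
    · rintro _ ⟨y, rfl⟩
      exact ⟨y, (hc' y).symm⟩
    · rintro _ ⟨y, rfl⟩
      exact ⟨ι y, hc' y⟩
    · rw [injective_iff_map_eq_zero]
      intro x
      obtain ⟨x, rfl⟩ := Submodule.mkQ_surjective _ x
      simp only [Submodule.mkQ_apply, Submodule.mapQ_apply, Submodule.Quotient.mk_eq_zero]
      rintro ⟨y, hy⟩
      exact ⟨y, hψ ((hc' y).trans hy)⟩
    · intro x
      obtain ⟨x, rfl⟩ := Submodule.mkQ_surjective _ x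
      exact ⟨Submodule.Quotient.mk x, rfl⟩
    · intro x
      obtain ⟨x, rfl⟩ := Submodule.mkQ_surjective _ x
      simp only [Submodule.mkQ_apply, Submodule.mapQ_apply, LinearMap.id_apply,
        Submodule.Quotient.mk_eq_zero]
      constructor
      · rintro ⟨y, rfl⟩
        exact ⟨Submodule.Quotient.mk y, rfl⟩
      · rintro ⟨y, hy⟩
        obtain ⟨y, rfl⟩ := Submodule.mkQ_surjective _ y
        simp only [Submodule.mkQ_apply, Submodule.mapQ_apply] at hy
        rw [Submodule.Quotient.eq] at hy
        obtain ⟨w, hw⟩ := hy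
        refine ⟨y - ι w, ?_⟩
        have hw : ι (φ w) = ψ y - x := hw
        rw [map_sub, hc', hw]
        abel
  rw [e1, add_comm] at e2
  exact (ENat.addLECancellable_of_ne_top hfin).inj.1 e2

/-- If the residue field of the local ring `O` is an algebraically closed field contained in `O`,
then it is also the residue field of each maximal ideal of an integral extension of `O`. -/
theorem surjective_algebraMap_quotient_of_isIntegral (k : Type*) {O T : Type*} [Field k]
    [IsAlgClosed k] [CommRing O] [IsLocalRing O] [Algebra k O] [CommRing T] [Algebra O T]
    [Algebra.IsIntegral O T]
    (hk : Function.Surjective (algebraMap k (IsLocalRing.ResidueField O)))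
    (n : Ideal T) [n.IsMaximal] : Function.Surjective (algebraMap O (T ⧸ n)) := by
  let f : k →+* T ⧸ n := (algebraMap O (T ⧸ n)).comp (algebraMap k O)
  have hcomap : n.comap (algebraMap O T) = IsLocalRing.maximalIdeal O :=
    IsLocalRing.eq_maximalIdeal (Ideal.isMaximal_comap_of_isIntegral_of_isMaximal n)
  let g : IsLocalRing.ResidueField O →+* T ⧸ n :=
    Ideal.quotientMap n (algebraMap O T) hcomap.ge
  have hfg : f = g.comp (algebraMap k (IsLocalRing.ResidueField O)) := rfl
  have hg : g.IsIntegral := by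
    have h1 : (algebraMap O (T ⧸ n)).IsIntegral := algebraMap_isIntegral_iff.2 inferInstance
    have h2 : algebraMap O (T ⧸ n) = g.comp (algebraMap O (IsLocalRing.ResidueField O)) := rfl
    rw [h2] at h1
    exact RingHom.IsIntegral.tower_top _ _ h1
  have hf : f.IsIntegral := by
    rw [hfg]
    exact RingHom.IsIntegral.trans _ _ (RingHom.isIntegral_of_surjective _ hk) hg
  have hb := IsAlgClosed.ringHom_bijective_of_isIntegral f hf
  intro y
  obtain ⟨x, hx⟩ := hb.2 y
  exact ⟨algebraMap k O x, hx⟩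

end Length

section OneDimensional

open ValuationSubring

theorem nontrivialOver_integralClosure (O K : Type*) [CommRing O] [Field K] [Algebra O K] :
    nontrivialOver (integralClosure O K) K = nontrivialOver O K := by
  ext V
  refine and_congr_left fun _ => ⟨fun h t => h (algebraMap O _ t), fun h t => ?_⟩
  have ht : IsIntegral O (t : K) := t.2
  let : Algebra O V := RingHom.toAlgebra ((algebraMap O K).codRestrict V.toSubring h)
  have : IsScalarTower O V K := IsScalarTower.of_algebraMap_eq fun _ => rfl
  have h3 : IsIntegral V (t : K) := ht.tower_top
  obtain ⟨y, hy⟩ := IsIntegrallyClosed.isIntegral_iff.1 h3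
  have : (t : K) ∈ V := hy ▸ y.2
  exact this

variable {O K : Type*} [CommRing O] [IsDomain O] [IsLocalRing O] [IsNoetherianRing O]
  [Field K] [Algebra O K]

theorem isPrincipalIdealRing_integralClosure [Ring.DimensionLEOne O] (L : Type*) [Field L]
    [Algebra O L] [IsFractionRing O L] [Algebra L K] [IsScalarTower O L K] [FiniteDimensional L K]
    [Module.Finite O (integralClosure O K)] : IsPrincipalIdealRing (integralClosure O K) := by
  have hfr : IsFractionRing (integralClosure O K) K :=
    integralClosure.isFractionRing_of_finite_extension L K
  have hn : IsNoetherianRing (integralClosure O K) := IsNoetherianRing.of_finite O _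
  have hic : IsIntegrallyClosed (integralClosure O K) :=
    integralClosure.isIntegrallyClosedOfFiniteExtension L
  have hd : IsDedekindDomain (integralClosure O K) := {}
  have hinj : Function.Injective (algebraMap O K) := by
    rw [IsScalarTower.algebraMap_eq O L K]
    exact (algebraMap L K).injective.comp (IsFractionRing.injective O L)
  have hinj' : Function.Injective (algebraMap O (integralClosure O K)) := fun x y hxy =>
    hinj (congrArg Subtype.val hxy)
  have : Module.IsTorsionFree O (integralClosure O K) :=
    Module.isTorsionFree_iff_algebraMap_injective.2 hinj'
  apply IsPrincipalIdealRing.of_finite_maximals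
  refine (IsDedekindDomain.primesOver_finite (IsLocalRing.maximalIdeal O)
    (integralClosure O K)).subset fun n hn => ?_
  have hn : n.IsMaximal := hn
  exact ⟨hn.isPrime, ⟨(IsLocalRing.eq_maximalIdeal
    (Ideal.isMaximal_comap_of_isIntegral_of_isMaximal n)).symm⟩⟩

/-- Let `O` be a one-dimensional local domain with finite normalization and algebraically closed
residue field, contained in `O`. Then the orders of `a ∈ O` at the valuation subrings over `O`
add up to the length of `O / a`. -/
theorem hasOrdSum_ord_of_isLocalRing (k : Type*) [Field k] [IsAlgClosed k] [Algebra k O]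
    (hk : Function.Surjective (algebraMap k (IsLocalRing.ResidueField O)))
    [Ring.DimensionLEOne O] [IsFractionRing O K] [Module.Finite O (integralClosure O K)]
    {a : O} (ha : a ≠ 0) :
    HasOrdSum (nontrivialOver O K) (algebraMap O K a) ((Ring.ord O a).toNat : ℤ) := by
  set T := integralClosure O K with hT
  have hpid : IsPrincipalIdealRing T := isPrincipalIdealRing_integralClosure K
  have hfr : IsFractionRing T K := integralClosure.isFractionRing_of_finite_extension K K
  have hinj : Function.Injective (algebraMap O T) := fun x y hxy =>
    IsFractionRing.injective O K (congrArg Subtype.val hxy)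
  have hsurj := fun (n : Ideal T) (hn : n.IsMaximal) =>
    surjective_algebraMap_quotient_of_isIntegral k (T := T) hk n
  have haT : algebraMap O T a ≠ 0 := by
    rw [Ne, map_eq_zero_iff _ hinj]; exact ha
  have hlen : ∀ c : O, c ≠ 0 →
      Module.length O (T ⧸ LinearMap.range (LinearMap.lsmul O T c)) =
        Ring.ord T (algebraMap O T c) ∧ Ring.ord T (algebraMap O T c) ≠ ⊤ := by
    intro c hc
    have hcT : algebraMap O T c ∈ nonZeroDivisors T := by
      apply mem_nonZeroDivisors_of_ne_zero
      rw [Ne, map_eq_zero_iff _ hinj]; exact hc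
    have hfl := isFiniteLength_quotient_span_singleton (R := T) hcT
    have e : (T ⧸ LinearMap.range (LinearMap.lsmul O T c)) ≃ₗ[O]
        T ⧸ (Ideal.span {algebraMap O T c}) :=
      (Submodule.quotEquivOfEq _ ((Ideal.span {algebraMap O T c}).restrictScalars O) (by
        ext x
        simp only [LinearMap.mem_range, LinearMap.lsmul_apply, Submodule.restrictScalars_mem,
          Ideal.mem_span_singleton', Algebra.smul_def]
        exact exists_congr fun y => by rw [mul_comm])).trans
        (Submodule.Quotient.restrictScalarsEquiv O _)
    refine ⟨?_, Ring.ord_ne_top hcT⟩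
    rw [e.length_eq]
    exact Module.length_eq_of_residue_surjective hsurj hfl
  have hfin : Module.length O (T ⧸ LinearMap.range (Algebra.linearMap O T)) ≠ ⊤ := by
    obtain ⟨s, hs⟩ := Module.Finite.fg_top (R := O) (M := T)
    classical
    obtain ⟨c, hc⟩ := IsLocalization.exist_integer_multiples_of_finset (nonZeroDivisors O)
      (s.image (Subtype.val : T → K))
    have hc0 : (c : O) ≠ 0 := nonZeroDivisors.ne_zero c.2
    have hle : LinearMap.range (LinearMap.lsmul O T (c : O)) ≤
        LinearMap.range (Algebra.linearMap O T) := by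
      rw [LinearMap.range_eq_map, ← hs, Submodule.map_span, Submodule.span_le]
      rintro _ ⟨x, hx, rfl⟩
      obtain ⟨y, hy⟩ := hc x (Finset.mem_image_of_mem _ hx)
      exact ⟨y, Subtype.ext hy⟩
    have h1 := (hlen c hc0).1 ▸ (hlen c hc0).2
    exact ne_top_of_le_ne_top h1
      (Module.length_le_of_surjective (Submodule.factor hle) (Submodule.factor_surjective hle))
  have hord : Ring.ord O a = Ring.ord T (algebraMap O T a) := by
    rw [← (hlen a ha).1, ← Module.length_quotient_range_eq (Algebra.linearMap O T) hinj
      (LinearMap.toSpanSingleton O O a) (LinearMap.lsmul O T a) ?_ ?_ hfin]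
    · rw [Ring.ord, LinearMap.range_toSpanSingleton]
    · intro x y hxy
      simp only [LinearMap.lsmul_apply, Algebra.smul_def] at hxy
      exact mul_left_cancel₀ haT hxy
    · ext
      simp [Algebra.smul_def]
  have := hasOrdSum_ord (K := K) haT
  rw [hord, ← nontrivialOver_integralClosure O K]
  exact this

/-- Let `A` be a discrete valuation ring with fraction field `L` and algebraically closed residue
field, contained in `A`. The ramification indices of the valuation subrings over `A` of a finite
separable extension `K` of `L` add up to the degree of the extension. -/
theorem hasOrdSum_uniformizer {O : Type*} [CommRing O] [IsDomain O] [IsDiscreteValuationRing O]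
    [Algebra O K] (k : Type*) [Field k] [IsAlgClosed k]
    [Algebra k O] (hk : Function.Surjective (algebraMap k (IsLocalRing.ResidueField O)))
    (L : Type*) [Field L]
    [Algebra O L] [IsFractionRing O L] [Algebra L K] [IsScalarTower O L K] [FiniteDimensional L K]
    [Algebra.IsSeparable L K] {ϖ : O} (hϖ : Irreducible ϖ) :
    HasOrdSum (nontrivialOver O K) (algebraMap O K ϖ) (Module.finrank L K) := by
  set T := integralClosure O K with hT
  have : Module.Finite O T := IsIntegralClosure.finite O L K T
  have hpid : IsPrincipalIdealRing T := isPrincipalIdealRing_integralClosure L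
  have hfr : IsFractionRing T K := integralClosure.isFractionRing_of_finite_extension L K
  have hinjK : Function.Injective (algebraMap O K) := by
    rw [IsScalarTower.algebraMap_eq O L K]
    exact (algebraMap L K).injective.comp (IsFractionRing.injective O L)
  have hinj : Function.Injective (algebraMap O T) := fun x y hxy =>
    hinjK (congrArg Subtype.val hxy)
  have : Module.IsTorsionFree O K := Module.isTorsionFree_iff_algebraMap_injective.2 hinjK
  have hfree : Module.Free O T := IsIntegralClosure.module_free O L K T
  have hsurj := fun (n : Ideal T) (hn : n.IsMaximal) =>
    surjective_algebraMap_quotient_of_isIntegral k (T := T) hk n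
  have hϖT : algebraMap O T ϖ ≠ 0 := by
    rw [Ne, map_eq_zero_iff _ hinj]; exact hϖ.ne_zero
  have hfl := isFiniteLength_quotient_span_singleton (R := T)
    (mem_nonZeroDivisors_of_ne_zero hϖT)
  have hmap : (IsLocalRing.maximalIdeal O).map (algebraMap O T) =
      Ideal.span {algebraMap O T ϖ} := by
    rw [hϖ.maximalIdeal_eq, Ideal.map_span, Set.image_singleton]
  have hord : Ring.ord T (algebraMap O T ϖ) = Module.finrank L K := by
    rw [Ring.ord, ← Module.length_eq_of_residue_surjective hsurj hfl, ← hmap,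
      ← IsIntegralClosure.rank O L K T,
      ← IsLocalRing.finrank_quotient_map,
      Module.length_eq_of_surjective (R := O ⧸ IsLocalRing.maximalIdeal O)
      Ideal.Quotient.mk_surjective]
    let := Ideal.Quotient.field (IsLocalRing.maximalIdeal O)
    exact Module.length_eq_finrank _ _
  have := hasOrdSum_ord (K := K) hϖT
  rw [hord] at this
  rw [← nontrivialOver_integralClosure O K]
  exact this

end OneDimensional

/-! ### The product formula for function fields of curves -/

namespace ValuationSubring

open Polynomial IntermediateField

variable {K : Type*} [Field K]

theorem HasOrdSum.union {s t : Set (ValuationSubring K)} {x : K} {m n : ℤ} (hst : Disjoint s t)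
    (h : HasOrdSum s x m) (h' : HasOrdSum t x n) : HasOrdSum (s ∪ t) x (m + n) := by
  refine ⟨?_, ?_⟩
  · rw [Set.union_inter_distrib_right]
    exact h.1.union h'.1
  · rw [← h.2, ← h'.2, finsum_mem_union' hst h.1 h'.1]

theorem HasOrdSum.superset {s t : Set (ValuationSubring K)} {x : K} {n : ℤ} (hst : s ⊆ t)
    (h0 : ∀ V ∈ t, V ∉ s → V.valuation x = 1) (h : HasOrdSum s x n) : HasOrdSum t x n := by
  have h1 := hasOrdSum_of_valuation_eq_one (s := t \ s) (x := x) fun V hV => h0 V hV.1 hV.2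
  have h2 := h.union Set.disjoint_sdiff_right h1
  rwa [Set.union_sdiff_cancel hst, add_zero] at h2

variable {k : Type*} [Field k] [Algebra k K]

theorem valuation_algebraMap_eq_one {V : ValuationSubring K} (hV : V ∈ nontrivialOver k K) {c : k}
    (hc : c ≠ 0) : V.valuation (algebraMap k K c) = 1 := by
  refine le_antisymm ((V.valuation_le_one_iff _).2 (hV.1 c)) ?_
  have h := (V.valuation_le_one_iff _).2 (hV.1 c⁻¹)
  rw [map_inv₀, map_inv₀] at h
  exact (inv_le_one₀ (zero_lt_iff.2 (by simpa using hc))).1 h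

theorem aeval_mem {V : ValuationSubring K} (hV : V ∈ nontrivialOver k K) {h : K}
    (hh : h ∈ V) (p : k[X]) : aeval h p ∈ V := by
  induction p using Polynomial.induction_on' with
  | add p q hp hq => rw [map_add]; exact V.add_mem _ _ hp hq
  | monomial n c =>
    rw [aeval_monomial]
    exact V.mul_mem _ _ (hV.1 c) (pow_mem (S := V.toSubring) hh n)

theorem valuation_aeval_eq_one {V : ValuationSubring K} (hV : V ∈ nontrivialOver k K) {h : K}
    (hh : V.valuation h < 1) {p : k[X]} (hp : p.coeff 0 ≠ 0) : V.valuation (aeval h p) = 1 := by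
  have hhV : h ∈ V := (V.valuation_le_one_iff h).1 hh.le
  rw [← Polynomial.divX_mul_X_add p, map_add, map_mul, aeval_X, aeval_C]
  have h1 := valuation_algebraMap_eq_one hV hp
  rw [Valuation.map_add_eq_of_lt_right, h1]
  rw [h1, map_mul]
  exact mul_lt_one_of_nonneg_of_lt_one_right
    ((V.valuation_le_one_iff _).2 (aeval_mem hV hhV _)) zero_le hh

/-- A nonconstant function `h` has as many zeros as the degree of the field over `k⟮h⟯`: its zeros
are the valuations over the local ring of the affine line at the origin. -/
theorem hasOrdSum_of_transcendental [IsAlgClosed k] [CharZero k] {h : K} (hh : Transcendental k h)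
    [FiniteDimensional k⟮h⟯ K] :
    HasOrdSum {V | V ∈ nontrivialOver k K ∧ V.valuation h < 1} h (Module.finrank k⟮h⟯ K) := by
  -- The local ring at the origin of the affine line, embedded in `k⟮h⟯` by `X ↦ h`.
  let P : Ideal k[X] := Ideal.span {X}
  have hP : P.IsPrime := (Ideal.span_singleton_prime X_ne_zero).2 prime_X
  have hPmax : P.IsMaximal := PrincipalIdealRing.isMaximal_of_irreducible prime_X.irreducible
  let O := Localization.AtPrime P
  have hX : ∀ p : k[X], p ∈ P.primeCompl ↔ p.coeff 0 ≠ 0 := fun p => by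
    rw [Ne, ← X_dvd_iff, Ideal.mem_primeCompl_iff, Ideal.mem_span_singleton]
  have hPbot : P ≠ ⊥ := by
    rw [Ne, Ideal.span_singleton_eq_bot]
    exact X_ne_zero
  have hdvr : IsDiscreteValuationRing O :=
    IsLocalization.AtPrime.isDiscreteValuationRing_of_dedekind_domain k[X]
      hPbot O
  have hirr : Irreducible (algebraMap k[X] O X) := by
    rw [IsDiscreteValuationRing.irreducible_iff_uniformizer,
      ← Localization.AtPrime.map_eq_maximalIdeal,
      Ideal.map_span, Set.image_singleton]
  have hk : Function.Surjective (algebraMap k (IsLocalRing.ResidueField O)) := by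
    have h1 := (IsLocalization.AtPrime.equivQuotMaximalIdeal P O).surjective
    intro y
    obtain ⟨x, rfl⟩ := h1 y
    obtain ⟨p, rfl⟩ := Ideal.Quotient.mk_surjective x
    refine ⟨p.coeff 0, ?_⟩
    rw [IsLocalization.AtPrime.equivQuotMaximalIdeal_apply_mk]
    have h2 : algebraMap k (IsLocalRing.ResidueField O) (p.coeff 0) =
      Ideal.Quotient.mk (IsLocalRing.maximalIdeal O) (algebraMap k[X] O (C (p.coeff 0))) := rfl
    rw [h2]
    refine Ideal.Quotient.eq.2 ?_
    rw [← map_sub, ← Localization.AtPrime.map_eq_maximalIdeal]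
    apply Ideal.mem_map_of_mem
    rw [Ideal.mem_span_singleton, X_dvd_iff]
    simp
  let g : k⟮h⟯ := AdjoinSimple.gen k h
  have hg : Transcendental k g := by
    rw [← transcendental_algebraMap_iff (algebraMap k⟮h⟯ K).injective]
    exact hh
  have hunit : ∀ p : P.primeCompl, IsUnit ((aeval g : k[X] →ₐ[k] k⟮h⟯).toRingHom p) := by
    intro p
    rw [isUnit_iff_ne_zero]
    intro h0
    exact (hX p).1 p.2 (by rw [(transcendental_iff.1 hg) p h0, coeff_zero])
  let : Algebra O k⟮h⟯ := (IsLocalization.lift hunit).toAlgebra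
  have halg : ∀ p : k[X], algebraMap O k⟮h⟯ (algebraMap k[X] O p) = aeval g p := fun p =>
    IsLocalization.lift_eq hunit p
  let : Algebra O K := ((algebraMap k⟮h⟯ K).comp (algebraMap O k⟮h⟯)).toAlgebra
  have : IsScalarTower O k⟮h⟯ K := IsScalarTower.of_algebraMap_eq fun _ => rfl
  have halgK : ∀ p : k[X], algebraMap O K (algebraMap k[X] O p) = aeval h p := fun p => by
    rw [IsScalarTower.algebraMap_apply O k⟮h⟯ K, halg, ← aeval_algebraMap_apply]
    rfl
  have hinj : Function.Injective (algebraMap O k⟮h⟯) := by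
    apply (IsLocalization.lift_injective_iff hunit).2
    intro x y
    rw [(IsLocalization.injective O P.primeCompl_le_nonZeroDivisors).eq_iff]
    exact ((transcendental_iff_injective.1 hg).eq_iff (a := x) (b := y)).symm
  have hfaith : FaithfulSMul O k⟮h⟯ := (faithfulSMul_iff_algebraMap_injective _ _).2 hinj
  have hfr : IsFractionRing O k⟮h⟯ := by
    apply IsFractionRing.of_field
    rintro ⟨z, hz⟩
    obtain ⟨r, s, rfl⟩ := (mem_adjoin_simple_iff k z).1 hz
    refine ⟨algebraMap k[X] O r, algebraMap k[X] O s, Subtype.ext ?_⟩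
    rw [halg, halg]
    change aeval h r / aeval h s = algebraMap k⟮h⟯ K (aeval g r / aeval g s)
    rw [map_div₀, ← aeval_algebraMap_apply, ← aeval_algebraMap_apply]
    rfl
  have : CharZero k⟮h⟯ := charZero_of_injective_algebraMap (algebraMap k k⟮h⟯).injective
  have hmain := hasOrdSum_uniformizer (K := K) k hk k⟮h⟯ hirr
  rw [halgK, aeval_X] at hmain
  convert hmain using 1
  ext V
  constructor
  · rintro ⟨hV, hVh⟩
    refine ⟨fun t => ?_, hV.2⟩
    obtain ⟨a, b, rfl⟩ := IsLocalization.exists_mk'_eq P.primeCompl t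
    have hb := valuation_aeval_eq_one hV hVh ((hX b).1 b.2)
    have hb0 : aeval h (b : k[X]) ≠ 0 := by
      intro h0
      rw [h0, map_zero] at hb
      exact zero_ne_one hb
    have h1 : algebraMap O K (IsLocalization.mk' O a b) = aeval h a / aeval h (b : k[X]) := by
      rw [eq_div_iff hb0, ← halgK, ← halgK, ← map_mul, IsLocalization.mk'_spec]
    rw [h1, ← valuation_le_one_iff, map_div₀, hb, div_one, valuation_le_one_iff]
    exact aeval_mem hV ((V.valuation_le_one_iff h).1 hVh.le) a
  · rintro ⟨hV, hVtop⟩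
    refine ⟨⟨fun c => ?_, hVtop⟩, ?_⟩
    · have := hV (algebraMap k[X] O (C c))
      rwa [halgK, aeval_C] at this
    have hhV : h ∈ V := by
      have := hV (algebraMap k[X] O X)
      rwa [halgK, aeval_X] at this
    refine lt_of_le_of_ne ((V.valuation_le_one_iff h).2 hhV) fun h1 => hVtop ?_
    -- If `h` were a unit of `V`, then `V` would contain `k⟮h⟯`, over which `K` is integral.
    have hO : ∀ t : O, t ≠ 0 → V.valuation (algebraMap O K t) = 1 := by
      intro t ht
      obtain ⟨n, u, rfl⟩ := IsDiscreteValuationRing.eq_unit_mul_pow_irreducible ht hirr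
      rw [map_mul, map_mul, map_pow, map_pow, halgK, aeval_X, h1, one_pow, mul_one]
      refine le_antisymm ((V.valuation_le_one_iff _).2 (hV _)) ?_
      have h2 : V.valuation (algebraMap O K ((u⁻¹ : Oˣ) : O)) ≤ 1 :=
        (V.valuation_le_one_iff _).2 (hV _)
      have h3 : V.valuation (algebraMap O K (u : O)) *
          V.valuation (algebraMap O K ((u⁻¹ : Oˣ) : O)) = 1 := by
        rw [← map_mul, ← map_mul, Units.mul_inv, map_one, map_one]
      exact h3 ▸ mul_le_of_le_one_right' h2
    have hL : ∀ y : k⟮h⟯, (y : K) ∈ V := by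
      intro y
      obtain ⟨a, b, hb, rfl⟩ := IsFractionRing.div_surjective (A := O) y
      have hb0 : b ≠ 0 := nonZeroDivisors.ne_zero hb
      have e : ((algebraMap O k⟮h⟯ a / algebraMap O k⟮h⟯ b : k⟮h⟯) : K) =
        algebraMap O K a / algebraMap O K b := map_div₀ (algebraMap k⟮h⟯ K) _ _
      rw [e, ← valuation_le_one_iff, map_div₀, hO b hb0, div_one, valuation_le_one_iff]
      exact hV a
    refine top_le_iff.1 fun y _ => ?_
    let : Algebra k⟮h⟯ V :=
      RingHom.toAlgebra ((algebraMap k⟮h⟯ K).codRestrict V.toSubring hL)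
    have : IsScalarTower k⟮h⟯ V K := IsScalarTower.of_algebraMap_eq fun _ => rfl
    have hy : IsIntegral V y := (Algebra.IsIntegral.isIntegral (R := k⟮h⟯) y).tower_top
    obtain ⟨z, hz⟩ := IsIntegrallyClosed.isIntegral_iff.1 hy
    exact hz ▸ z.2

/-- The product formula: a nonzero function on a curve over an algebraically closed field has as
many zeros as poles. -/
theorem hasOrdSum_zero [IsAlgClosed k] [CharZero k]
    (hfin : ∀ h : K, Transcendental k h → FiniteDimensional k⟮h⟯ K) {h : K} (h0 : h ≠ 0) :
    HasOrdSum (nontrivialOver k K) h 0 := by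
  by_cases hh : Transcendental k h
  · have hi : Transcendental k h⁻¹ := by
      rw [Transcendental, IsAlgebraic.inv_iff]
      exact hh
    have := hfin h hh
    have := hfin h⁻¹ hi
    have e : k⟮h⁻¹⟯ = k⟮h⟯ := by
      apply le_antisymm
      · rw [adjoin_simple_le_iff]
        exact inv_mem (mem_adjoin_simple_self k h)
      · rw [adjoin_simple_le_iff]
        have := inv_mem (mem_adjoin_simple_self k h⁻¹)
        rwa [inv_inv] at this
    have h1 := hasOrdSum_of_transcendental hh
    have h2 := (hasOrdSum_of_transcendental hi).inv (inv_ne_zero h0)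
    rw [inv_inv, e] at h2
    have h3 := h1.union ?_ h2
    · rw [add_neg_cancel] at h3
      refine h3.superset ?_ ?_
      · exact Set.union_subset (fun V hV => hV.1) fun V hV => hV.1
      · intro V hV hV'
        simp only [Set.mem_union, Set.mem_ofPred_eq, not_or, not_and, not_lt] at hV'
        refine le_antisymm ?_ (hV'.1 hV)
        have := hV'.2 hV
        rw [map_inv₀] at this
        exact (one_le_inv₀ (zero_lt_iff.2 ((_root_.map_ne_zero _).2 h0))).1 this
    · rw [Set.disjoint_left]
      rintro V ⟨_, hV⟩ ⟨_, hV'⟩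
      rw [map_inv₀, inv_lt_one₀ (zero_lt_iff.2 ((_root_.map_ne_zero _).2 h0))] at hV'
      exact hV'.not_gt hV
  · rw [Transcendental, not_not] at hh
    obtain ⟨c, rfl⟩ : h ∈ Set.range (algebraMap k K) := by
      obtain ⟨c, hc⟩ := (IsAlgClosed.algebraMap_bijective_of_isIntegral (k := k)
        (K := integralClosure k K)).2 ⟨h, hh.isIntegral⟩
      exact ⟨c, congrArg Subtype.val hc⟩
    refine hasOrdSum_of_valuation_eq_one fun V hV => valuation_algebraMap_eq_one hV ?_
    rintro rfl
    simp at h0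

end ValuationSubring

/-! ### Normalization and transcendence degree of local rings of curves -/

section EssFinite

universe u

open IntermediateField

/-- If `O` is a localization of `A`, then a fraction field of `O` is one of `A`. -/
theorem isFractionRing_of_isLocalization_isFractionRing {A O K : Type*} [CommRing A] [CommRing O]
    [Field K] [Algebra A O] [Algebra A K] [Algebra O K] [IsScalarTower A O K] {M : Submonoid A}
    (hM : M ≤ nonZeroDivisors A) [IsLocalization M O] [IsFractionRing O K] :
    IsFractionRing A K := by
  have hinj : Function.Injective (algebraMap A K) := by
    rw [IsScalarTower.algebraMap_eq A O K]
    exact (IsFractionRing.injective O K).comp (IsLocalization.injective O hM)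
  have : FaithfulSMul A K := (faithfulSMul_iff_algebraMap_injective _ _).2 hinj
  have key : ∀ a : O, ∃ x m : A, m ≠ 0 ∧
      algebraMap O K a = algebraMap A K x / algebraMap A K m := by
    intro a
    obtain ⟨x, m, rfl⟩ := IsLocalization.exists_mk'_eq M a
    have hm : algebraMap A K m ≠ 0 := by
      rw [IsScalarTower.algebraMap_apply A O K]
      exact ((IsLocalization.map_units O m).map (algebraMap O K)).ne_zero
    refine ⟨x, m, fun h => hm (by rw [h, map_zero]), ?_⟩
    rw [eq_div_iff hm, IsScalarTower.algebraMap_apply A O K, IsScalarTower.algebraMap_apply A O K,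
      ← map_mul, IsLocalization.mk'_spec]
  apply IsFractionRing.of_field
  intro z
  obtain ⟨a, b, -, rfl⟩ := IsFractionRing.div_surjective (A := O) z
  obtain ⟨x, m, -, hx⟩ := key a
  obtain ⟨y, n, -, hy⟩ := key b
  refine ⟨x * n, m * y, ?_⟩
  rw [hx, hy, map_mul, map_mul, div_div_div_eq]

variable (k : Type u) [Field k]

/-- By Noether normalization, the normalization is that of a polynomial ring in a finite
separable extension of its fraction field. -/
theorem finite_integralClosure_of_finiteType [CharZero k] {A K : Type*} [CommRing A] [IsDomain A]
    [Algebra k A] [Algebra.FiniteType k A] [Field K] [Algebra A K] [IsFractionRing A K] :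
    Module.Finite A (integralClosure A K) := by
  obtain ⟨s, g, hinj, hfin⟩ := exists_finite_inj_algHom_of_fg k A
  let R := MvPolynomial (Fin s) k
  let : Algebra R A := g.toRingHom.toAlgebra
  have hRA : Module.Finite R A := hfin
  let : Algebra R K := ((algebraMap A K).comp g.toRingHom).toAlgebra
  have : IsScalarTower R A K := IsScalarTower.of_algebraMap_eq fun _ => rfl
  have hRK : Function.Injective (algebraMap R K) := (IsFractionRing.injective A K).comp hinj
  let L := FractionRing R
  let : Algebra L K := (IsFractionRing.lift hRK).toAlgebra
  have : IsScalarTower R L K := IsScalarTower.of_algebraMap_eq fun x =>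
    (IsFractionRing.lift_algebraMap hRK x).symm
  have hfaith : FaithfulSMul R A := (faithfulSMul_iff_algebraMap_injective _ _).2 hinj
  have hLK : FiniteDimensional L K := by
    have : Algebra.EssFiniteType A K := .of_isLocalization K (nonZeroDivisors A)
    have : Algebra.EssFiniteType R K := .comp R A K
    have : Algebra.EssFiniteType L K := .of_comp R L K
    have : Algebra.IsAlgebraic A K := IsLocalization.isAlgebraic K (nonZeroDivisors A)
    have : Algebra.IsAlgebraic R K := .trans R A K
    have : Algebra.IsAlgebraic L K := .extendScalars (R := R) (IsFractionRing.injective R L)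
    exact Algebra.finite_of_essFiniteType_of_isAlgebraic
  have : CharZero L := charZero_of_injective_algebraMap (algebraMap k L).injective
  have h1 : Module.Finite R (integralClosure R K) :=
    IsIntegralClosure.finite R L K (integralClosure R K)
  let f : integralClosure R K →ₗ[R] (integralClosure A K) :=
    { toFun := fun x => ⟨x, x.2.tower_top⟩
      map_add' := fun _ _ => rfl
      map_smul' := fun _ _ => rfl }
  have hf : Function.Surjective f := by
    rintro ⟨x, hx⟩
    have : Algebra.IsIntegral R A := inferInstance
    exact ⟨⟨x, isIntegral_trans x hx⟩, rfl⟩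
  have h2 : Module.Finite R (integralClosure A K) := Module.Finite.of_surjective f hf
  exact Module.Finite.of_restrictScalars_finite R A _

/-- The normalization of a domain essentially of finite type over a field of characteristic zero
is finite. -/
theorem finite_integralClosure_of_essFiniteType [CharZero k] {O K : Type*} [CommRing O] [IsDomain O]
    [Algebra k O] [Algebra.EssFiniteType k O] [Field K] [Algebra O K] [IsFractionRing O K] :
    Module.Finite O (integralClosure O K) := by
  let A := Algebra.EssFiniteType.subalgebra k O
  let M := Algebra.EssFiniteType.submonoid k O
  have hMn : M ≤ nonZeroDivisors A := by
    intro x hx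
    apply mem_nonZeroDivisors_of_ne_zero
    rintro rfl
    have : IsUnit (algebraMap A O 0) := hx
    simp at this
  have : IsFractionRing A K := isFractionRing_of_isLocalization_isFractionRing (O := O) hMn
  have h1 : Module.Finite A (integralClosure A K) := finite_integralClosure_of_finiteType k
  obtain ⟨s, hs⟩ := Module.Finite.fg_top (R := A) (M := integralClosure A K)
  classical
  let j : integralClosure A K → integralClosure O K := fun x => ⟨x, x.2.tower_top⟩
  refine ⟨⟨s.image j, top_le_iff.1 ?_⟩⟩
  have hj : ∀ x, j x ∈ Submodule.span O (s.image j : Set (integralClosure O K)) := by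
    intro x
    have hx : x ∈ Submodule.span A (s : Set (integralClosure A K)) := hs ▸ Submodule.mem_top
    induction hx using Submodule.span_induction with
    | mem x hx => exact Submodule.subset_span (Finset.mem_coe.2 (Finset.mem_image_of_mem j hx))
    | zero => exact Submodule.zero_mem _
    | add x y _ _ hx hy => exact Submodule.add_mem _ hx hy
    | smul a x _ hx =>
      have e : j (a • x) = algebraMap A O a • j x := Subtype.ext (by
        change a • (x : K) = algebraMap A O a • (x : K)
        rw [algebraMap_smul])
      rw [e]
      exact Submodule.smul_mem _ _ hx
  intro y _
  obtain ⟨m, hm⟩ := IsIntegral.exists_multiple_integral_of_isLocalization M (y : K) y.2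
  have hu : IsUnit (algebraMap A O m) := m.2
  obtain ⟨u, hu⟩ := hu
  have e : y = ((u⁻¹ : Oˣ) : O) • j ⟨m • (y : K), hm⟩ := by
    apply Subtype.ext
    change (y : K) = ((u⁻¹ : Oˣ) : O) • ((m : A) • (y : K))
    rw [← algebraMap_smul O (m : A) (y : K), ← hu, smul_smul, Units.inv_mul, one_smul]
  rw [e]
  exact Submodule.smul_mem _ _ (hj _)

/-- The transcendence degree of the fraction field of an `n`-dimensional local ring of a variety at
a rational point is at most `n`. -/
theorem trdeg_le_of_ringKrullDim_le {O : Type*} [CommRing O] [IsDomain O] [IsLocalRing O]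
    {K : Type*} [Algebra k O] [Algebra.EssFiniteType k O] [Field K] [Algebra O K]
    [IsFractionRing O K] [Algebra k K] [IsScalarTower k O K]
    (hk : Function.Surjective (algebraMap k (IsLocalRing.ResidueField O))) {n : ℕ}
    (hdim : ringKrullDim O ≤ n) : Algebra.trdeg k K ≤ n := by
  let A := Algebra.EssFiniteType.subalgebra k O
  let M := Algebra.EssFiniteType.submonoid k O
  let q : Ideal A := (IsLocalRing.maximalIdeal O).comap (algebraMap A O)
  have hqM : M = q.primeCompl := by
    ext x
    exact (IsLocalRing.notMem_maximalIdeal (x := algebraMap A O x)).symm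
  have hloc : IsLocalization.AtPrime O q := by
    have : IsLocalization M O := inferInstance
    rwa [hqM] at this
  have hq : q.IsMaximal := by
    let f : A →+* IsLocalRing.ResidueField O :=
      (IsLocalRing.residue O).comp (algebraMap A O)
    have hf : Function.Surjective f := by
      intro y
      obtain ⟨c, rfl⟩ := hk y
      exact ⟨algebraMap k A c, rfl⟩
    have : RingHom.ker f = q := by
      rw [← RingHom.comap_ker, IsLocalRing.ker_residue]
    rw [← this]
    exact RingHom.ker_isMaximal_of_surjective f hf
  have hht : q.height ≤ n := by
    have := IsLocalization.AtPrime.ringKrullDim_eq_height q O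
    rw [this] at hdim
    exact_mod_cast hdim
  obtain ⟨s, g, hinj, hfin⟩ := exists_finite_inj_algHom_of_fg k A
  let R := MvPolynomial (Fin s) k
  let : Algebra R A := g.toRingHom.toAlgebra
  have hRA : Module.Finite R A := hfin
  have : Algebra.IsIntegral R A := inferInstance
  have hfaith : FaithfulSMul R A := (faithfulSMul_iff_algebraMap_injective _ _).2 hinj
  have hnoeth : IsNoetherianRing A := Algebra.FiniteType.isNoetherianRing k A
  let p : Ideal R := q.comap (algebraMap R A)
  have hp : p.IsMaximal := Ideal.isMaximal_comap_of_isIntegral_of_isMaximal q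
  have hlo : q.LiesOver p := ⟨rfl⟩
  have h1 := Ideal.height_eq_height_add_of_liesOver_of_hasGoingDown p q
  have h2 := MvPolynomial.height_eq_card_of_isMaximal p
  have hs : s ≤ n := by
    rw [h2, Nat.card_eq_fintype_card, Fintype.card_fin] at h1
    have : (s : ℕ∞) ≤ n := (h1 ▸ le_self_add : (s : ℕ∞) ≤ q.height).trans hht
    exact_mod_cast this
  have hMn : M ≤ nonZeroDivisors A := by
    intro x hx
    apply mem_nonZeroDivisors_of_ne_zero
    rintro rfl
    have : IsUnit (algebraMap A O 0) := hx
    simp at this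
  have : IsFractionRing A K := isFractionRing_of_isLocalization_isFractionRing (O := O) hMn
  let : Algebra R K := ((algebraMap A K).comp g.toRingHom).toAlgebra
  have : IsScalarTower R A K := IsScalarTower.of_algebraMap_eq fun _ => rfl
  have : IsScalarTower k R K := IsScalarTower.of_algebraMap_eq fun c => by
    change algebraMap k K c = algebraMap A K (g (algebraMap k R c))
    rw [g.commutes, ← IsScalarTower.algebraMap_apply]
  have hRK : FaithfulSMul R K := (faithfulSMul_iff_algebraMap_injective _ _).2
    ((IsFractionRing.injective A K).comp hinj)
  have halg : Algebra.IsAlgebraic R K := by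
    have : Algebra.IsAlgebraic A K := IsLocalization.isAlgebraic K (nonZeroDivisors A)
    exact Algebra.IsAlgebraic.trans R A K
  have h3 := lift_trdeg_add_eq k R K
  have h4 : Algebra.trdeg R K = 0 := by rw [trdeg_eq_zero_iff]; exact halg
  rw [h4, MvPolynomial.trdeg_of_isDomain] at h3
  simp only [Cardinal.mk_fin, Cardinal.lift_natCast, Cardinal.lift_zero, add_zero] at h3
  rw [← Cardinal.lift_le.{u}, ← h3]
  simpa using hs

theorem finiteDimensional_of_transcendental {K : Type*} [Field K] [Algebra k K]
    [Algebra.EssFiniteType k K] (htr : Algebra.trdeg k K ≤ 1) {h : K} (hh : Transcendental k h) :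
    FiniteDimensional k⟮h⟯ K := by
  have h1 : AlgebraicIndependent k (fun _ : Unit => h) := by
    rw [algebraicIndependent_unique_type_iff]
    exact hh
  have h2 := h1.isTranscendenceBasis_of_lift_trdeg_le_of_finite (by simpa using htr)
  have h3 := h2.isAlgebraic_field
  rw [Set.range_const] at h3
  have h4 : Algebra.EssFiniteType k⟮h⟯ K := Algebra.EssFiniteType.of_comp k _ _
  exact Algebra.finite_of_essFiniteType_of_isAlgebraic

end EssFinite

/-! ### Centers of valuation rings -/

namespace AlgebraicGeometry.Scheme

open IsLocalRing

universe u

variable {X Y : Scheme.{u}}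

/-- Evaluation at `z` of the functions that are regular at a specialization `x` of `z`. -/
def evalAt {z x : X} (h : z ⤳ x) : X.presheaf.stalk x ⟶ X.residueField z :=
  X.presheaf.stalkSpecializes h ≫ X.residue z

/-- The inclusion of a valuation ring into a residue field. -/
def valuationInclusion {z : X} (V : ValuationSubring (X.residueField z)) :
    CommRingCat.of V ⟶ X.residueField z :=
  CommRingCat.ofHom (algebraMap V (X.residueField z))

/-- The ring homomorphism `g` to a residue field takes values in `V`, and is local as a map
to `V`. -/
def DominatedBy {z : X} {R : CommRingCat.{u}} (g : R ⟶ X.residueField z)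
    (V : ValuationSubring (X.residueField z)) : Prop :=
  ∃ φ : R ⟶ CommRingCat.of V, φ ≫ valuationInclusion V = g ∧ IsLocalHom φ.hom

/-- The point `x` is a center of the valuation ring `V` of the residue field of `z`. -/
def IsCenter {z : X} (V : ValuationSubring (X.residueField z)) (x : X) : Prop :=
  ∃ h : z ⤳ x, DominatedBy (evalAt h) V

theorem fromSpecResidueField_eq_evalAt {z x : X} (h : z ⤳ x) :
    X.fromSpecResidueField z = Spec.map (evalAt h) ≫ X.fromSpecStalk x := by
  rw [fromSpecResidueField, evalAt, Spec.map_comp, Category.assoc,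
    SpecMap_stalkSpecializes_fromSpecStalk]

/-- The commutative square to which the valuative criterion for `f` is applied. -/
theorem valuativeSquare (f : X ⟶ Y) {z : X} {s : Y} (h : f z ⤳ s)
    (V : ValuationSubring (X.residueField z)) {φ : Y.presheaf.stalk s ⟶ CommRingCat.of V}
    (hφ : φ ≫ valuationInclusion V = Y.presheaf.stalkSpecializes h ≫ f.stalkMap z ≫ X.residue z) :
    X.fromSpecResidueField z ≫ f =
      Spec.map (valuationInclusion V) ≫ Spec.map φ ≫ Y.fromSpecStalk s := by
  rw [← Spec.map_comp_assoc, hφ, Spec.map_comp_assoc, Spec.map_comp_assoc,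
    SpecMap_stalkSpecializes_fromSpecStalk, SpecMap_stalkMap_fromSpecStalk,
    Scheme.fromSpecResidueField, Category.assoc]

theorem SpecMap_fromSpecStalk_closedPoint {R : CommRingCat.{u}} [IsLocalRing R] {x : X}
    (φ : X.presheaf.stalk x ⟶ R) (hφ : IsLocalHom φ.hom) :
    (Spec.map φ ≫ X.fromSpecStalk x) (closedPoint R) = x := by
  have h1 : Spec.map φ (closedPoint R) = closedPoint (X.presheaf.stalk x) := Spec_closedPoint
  refine (Hom.comp_apply (Spec.map φ) (X.fromSpecStalk x) (closedPoint R)).trans ?_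
  rw [h1, fromSpecStalk_closedPoint]

variable (f : X ⟶ Y)

/-- The existence part of the valuative criterion of properness, in terms of local rings. -/
theorem exists_isCenter [IsProper f] {z : X} {s : Y} (h : f z ⤳ s)
    (V : ValuationSubring (X.residueField z))
    (hV : DominatedBy (Y.presheaf.stalkSpecializes h ≫ f.stalkMap z ≫ X.residue z) V) :
    ∃ x, f x = s ∧ IsCenter V x := by
  obtain ⟨φ, hφ, hlocal⟩ := hV
  have H : ValuativeCriterion f := by
    have h1 := ‹IsProper f›
    rw [IsProper.eq_valuativeCriterion] at h1
    exact h1.1.1.1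
  obtain ⟨l, hl₁, hl₂⟩ :=
    (H.existence { R := V, K := X.residueField z, i₁ := X.fromSpecResidueField z
                   commSq := ⟨valuativeSquare f h V hφ⟩, .. }).exists_lift
  change Spec.map (valuationInclusion V) ≫ l = X.fromSpecResidueField z at hl₁
  change l ≫ f = Spec.map φ ≫ Y.fromSpecStalk s at hl₂
  change Spec (.of V) ⟶ X at l
  have hz : z ⤳ l (closedPoint V) := by
    have h1 := Scheme.fromSpecResidueField_apply z (closedPoint (X.residueField z))
    rw [← hl₁] at h1
    have h2 : z = l (Spec.map (valuationInclusion V) (closedPoint (X.residueField z))) :=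
      h1.symm.trans (Hom.comp_apply _ _ _)
    have h3 := (specializes_closedPoint (R := V)
      (Spec.map (valuationInclusion V) (closedPoint (X.residueField z)))).map l.continuous
    exact (specializes_of_eq h2).trans h3
  refine ⟨l (closedPoint V), ?_, hz, stalkClosedPointTo l, ?_, inferInstance⟩
  · have h1 : (l ≫ f) (closedPoint V) = s := by
      rw [hl₂]
      exact SpecMap_fromSpecStalk_closedPoint (R := .of V) φ hlocal
    rw [← h1]
    exact (Hom.comp_apply l f _).symm
  · apply Spec.map_injective
    rw [← cancel_mono (X.fromSpecStalk _), ← fromSpecResidueField_eq_evalAt, Spec.map_comp,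
      Category.assoc, Spec_stalkClosedPointTo_fromSpecStalk, hl₁]

theorem comp_valuationInclusion_injective {z : X} (V : ValuationSubring (X.residueField z))
    {R : CommRingCat.{u}} {φ ψ : R ⟶ .of V}
    (h : φ ≫ valuationInclusion V = ψ ≫ valuationInclusion V) : φ = ψ := by
  ext a
  have := congrArg (fun g => g.hom a) h
  exact this

theorem SpecMap_fromSpecStalk_comp_eq {z : X} {s : Y} (h : f z ⤳ s)
    {V : ValuationSubring (X.residueField z)} {ψ : Y.presheaf.stalk s ⟶ CommRingCat.of V}
    (hψ : ψ ≫ valuationInclusion V = Y.presheaf.stalkSpecializes h ≫ f.stalkMap z ≫ X.residue z)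
    {x : X} (hx : f x = s) (hzx : z ⤳ x) {φ : X.presheaf.stalk x ⟶ CommRingCat.of V}
    (hφ : φ ≫ valuationInclusion V = evalAt hzx) :
    (Spec.map φ ≫ X.fromSpecStalk x) ≫ f = Spec.map ψ ≫ Y.fromSpecStalk s := by
  subst hx
  rw [Category.assoc, ← SpecMap_stalkMap_fromSpecStalk, ← Spec.map_comp_assoc]
  congr 2
  apply comp_valuationInclusion_injective V
  rw [Category.assoc, hφ, hψ, evalAt, ← Category.assoc, ← Category.assoc,
    Scheme.Hom.stalkSpecializes_stalkMap]

/-- The uniqueness part of the valuative criterion, in terms of local rings. -/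
theorem IsCenter.unique [IsSeparated f] {z : X} {s : Y} (h : f z ⤳ s)
    {V : ValuationSubring (X.residueField z)}
    (hV : DominatedBy (Y.presheaf.stalkSpecializes h ≫ f.stalkMap z ≫ X.residue z) V)
    {x x' : X} (hx : IsCenter V x) (hx' : IsCenter V x') (hfx : f x = s) (hfx' : f x' = s) :
    x = x' := by
  obtain ⟨ψ, hψ, -⟩ := hV
  obtain ⟨hzx, φ, hφ, hloc⟩ := hx
  obtain ⟨hzx', φ', hφ', hloc'⟩ := hx'
  have hsub := (IsSeparated.valuativeCriterion f)
    { R := V, K := X.residueField z, i₁ := X.fromSpecResidueField z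
      commSq := ⟨valuativeSquare f h V hψ⟩, .. }
  have hl : ∀ (y : X) (hzy : z ⤳ y) (θ : X.presheaf.stalk y ⟶ .of V)
      (_ : θ ≫ valuationInclusion V = evalAt hzy),
      Spec.map (valuationInclusion V) ≫ Spec.map θ ≫ X.fromSpecStalk y =
        X.fromSpecResidueField z := by
    intro y hzy θ hθ
    rw [← Spec.map_comp_assoc, hθ]
    exact (fromSpecResidueField_eq_evalAt hzy).symm
  have e : Spec.map φ ≫ X.fromSpecStalk x = Spec.map φ' ≫ X.fromSpecStalk x' :=
    congrArg CommSq.LiftStruct.l (hsub.elim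
      ⟨_, hl x hzx φ hφ, SpecMap_fromSpecStalk_comp_eq f h hψ hfx hzx hφ⟩
      ⟨_, hl x' hzx' φ' hφ', SpecMap_fromSpecStalk_comp_eq f h hψ hfx' hzx' hφ'⟩)
  rw [← SpecMap_fromSpecStalk_closedPoint (R := .of V) φ hloc, e]
  exact SpecMap_fromSpecStalk_closedPoint (R := .of V) φ' hloc'

end AlgebraicGeometry.Scheme

/-! ### Primes of the local rings of a scheme -/

/-- A closed subset of a Noetherian sober space has finitely many maximal points. -/
theorem TopologicalSpace.NoetherianSpace.finite_setOf_maximal {T : Type*} [TopologicalSpace T]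
    [TopologicalSpace.NoetherianSpace T] [QuasiSober T] [T0Space T] {Z : Set T} (hZ : IsClosed Z) :
    {y | y ∈ Z ∧ ∀ y' ∈ Z, y' ⤳ y → y' = y}.Finite := by
  obtain ⟨S, hS, hS', hS'', h⟩ := NoetherianSpace.exists_finite_set_isClosed_irreducible hZ
  have hsub : ∀ y, y ∈ Z ∧ (∀ y' ∈ Z, y' ⤳ y → y' = y) → ∃ t ∈ S, IsGenericPoint y t := by
    intro y hy
    have h1 := hy.1
    rw [h] at h1
    obtain ⟨t, ht, hyt⟩ := h1
    obtain ⟨g, hg⟩ := QuasiSober.sober (hS'' t ht) (hS' t ht)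
    have hgZ : g ∈ Z := by
      rw [h]
      exact ⟨t, ht, hg.mem⟩
    exact ⟨t, ht, hy.2 g hgZ (hg.specializes hyt) ▸ hg⟩
  choose! c hc hc' using hsub
  refine Set.Finite.of_injOn (f := c) (fun y hy => hc y hy) ?_ hS
  intro y hy y' hy' hyy'
  exact (hc' y hy).eq (hyy' ▸ hc' y' hy')

namespace AlgebraicGeometry.Scheme

open IsLocalRing

universe u

variable {X : Scheme.{u}}

/-- The local ring at a generalization `z` of `x` consists of fractions of functions at `x`: both
are localizations of the ring of an affine neighbourhood of `x`. -/
theorem exists_mul_stalkSpecializes_eq {z x : X} (h : z ⤳ x) (a : X.presheaf.stalk z) :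
    ∃ b c : X.presheaf.stalk x, IsUnit ((X.presheaf.stalkSpecializes h).hom c) ∧
      a * (X.presheaf.stalkSpecializes h).hom c = (X.presheaf.stalkSpecializes h).hom b := by
  obtain ⟨U, hU, hxU, -⟩ := exists_isAffineOpen_mem_and_subset (show x ∈ (⊤ : X.Opens) from trivial)
  have hzU : z ∈ U := h.mem_open U.2 hxU
  have key : ∀ c, (X.presheaf.stalkSpecializes h).hom ((X.presheaf.germ U x hxU).hom c) =
      (X.presheaf.germ U z hzU).hom c := fun c => by
    rw [← TopCat.Presheaf.germ_stalkSpecializes X.presheaf hxU h]; rfl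
  let _ := TopCat.Presheaf.algebra_section_stalk X.presheaf (⟨z, hzU⟩ : U)
  have := hU.isLocalization_stalk ⟨z, hzU⟩
  obtain ⟨⟨b, c⟩, hbc⟩ := IsLocalization.surj (hU.primeIdealOf ⟨z, hzU⟩).asIdeal.primeCompl a
  refine ⟨(X.presheaf.germ U x hxU).hom b, (X.presheaf.germ U x hxU).hom c, ?_, ?_⟩
  · rw [key]
    exact IsLocalization.map_units (X.presheaf.stalk z) c
  · rw [key, key]
    exact hbc

/-- The prime ideal of the local ring at `x` formed by the functions that vanish at a
generalization `z` of `x`. -/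
def primeAt {z x : X} (h : z ⤳ x) : Ideal (X.presheaf.stalk x) :=
  (maximalIdeal (X.presheaf.stalk z)).comap (X.presheaf.stalkSpecializes h).hom

instance {z x : X} (h : z ⤳ x) : (primeAt h).IsPrime := by
  unfold primeAt; infer_instance

theorem mem_primeAt {z x : X} {h : z ⤳ x} {a : X.presheaf.stalk x} :
    a ∈ primeAt h ↔ ¬ IsUnit ((X.presheaf.stalkSpecializes h).hom a) := Iff.rfl

theorem ker_evalAt {z x : X} (h : z ⤳ x) : RingHom.ker (evalAt h).hom = primeAt h := by
  ext a
  rw [RingHom.mem_ker, primeAt, Ideal.mem_comap, ← IsLocalRing.residue_eq_zero_iff]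
  rfl

theorem evalAt_eq_zero_iff {z x : X} (h : z ⤳ x) {a : X.presheaf.stalk x} :
    (evalAt h).hom a = 0 ↔ a ∈ primeAt h := by
  rw [← ker_evalAt, RingHom.mem_ker]

theorem exists_evalAt_div_eq {z x : X} (h : z ⤳ x) (a : X.residueField z) :
    ∃ b c : X.presheaf.stalk x, c ∉ primeAt h ∧ a = (evalAt h).hom b / (evalAt h).hom c := by
  obtain ⟨a, rfl⟩ := IsLocalRing.residue_surjective a
  obtain ⟨b, c, hc, hbc⟩ := exists_mul_stalkSpecializes_eq h a
  have hc' : c ∉ primeAt h := fun h' => mem_primeAt.1 h' hc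
  refine ⟨b, c, hc', (eq_div_iff (mt (evalAt_eq_zero_iff h).1 hc')).2 ?_⟩
  exact (map_mul (IsLocalRing.residue (X.presheaf.stalk z)) _ _).symm.trans
    (congrArg (IsLocalRing.residue (X.presheaf.stalk z)) hbc)

theorem algebraMap_stalkSpecializes [IsIntegral X] {z x : X} (h : z ⤳ x) (a : X.presheaf.stalk x) :
    algebraMap _ X.functionField ((X.presheaf.stalkSpecializes h).hom a) =
      algebraMap _ X.functionField a := by
  have h1 := X.presheaf.stalkSpecializes_comp ((genericPoint_spec X).specializes
    (Set.mem_univ z)) h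
  exact congrArg (fun g => g.hom a) h1

theorem stalkSpecializes_injective [IsIntegral X] {z x : X} (h : z ⤳ x) :
    Function.Injective (X.presheaf.stalkSpecializes h).hom := by
  intro a b hab
  apply IsFractionRing.injective (X.presheaf.stalk x) X.functionField
  rw [← algebraMap_stalkSpecializes h, ← algebraMap_stalkSpecializes h, hab]

theorem isLocalization_stalkSpecializes [IsIntegral X] {z x : X} (h : z ⤳ x) :
    let _ := (X.presheaf.stalkSpecializes h).hom.toAlgebra
    IsLocalization.AtPrime (X.presheaf.stalk z) (primeAt h) := by
  let _ := (X.presheaf.stalkSpecializes h).hom.toAlgebra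
  refine ⟨?_, ?_, ?_⟩
  · intro y
    exact not_not.1 (mt mem_primeAt.2 y.2)
  · intro a
    obtain ⟨b, c, hc, hbc⟩ := exists_mul_stalkSpecializes_eq h a
    exact ⟨(b, ⟨c, fun h' => mem_primeAt.1 h' hc⟩), hbc⟩
  · intro a b hab
    exact ⟨1, by rw [stalkSpecializes_injective h hab]⟩

theorem height_primeAt [IsIntegral X] {z x : X} (h : z ⤳ x) :
    ((primeAt h).height : ℕ∞) = Order.coheight z := by
  let _ := (X.presheaf.stalkSpecializes h).hom.toAlgebra
  have := isLocalization_stalkSpecializes h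
  have h1 := IsLocalization.AtPrime.ringKrullDim_eq_height (primeAt h) (X.presheaf.stalk z)
  rw [ringKrullDim_stalk_eq_coheight] at h1
  exact_mod_cast h1.symm

theorem fromSpecStalk_primeAt {z x : X} (h : z ⤳ x) :
    X.fromSpecStalk x ⟨primeAt h, inferInstance⟩ = z := by
  have h1 := SpecMap_stalkSpecializes_fromSpecStalk h
  have h2 := congrArg (fun g : Spec (X.presheaf.stalk z) ⟶ X => g (closedPoint _)) h1
  exact h2.trans fromSpecStalk_closedPoint

theorem exists_primeAt_eq {x : X} (p : Ideal (X.presheaf.stalk x)) [hp : p.IsPrime] :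
    ∃ (z : X) (h : z ⤳ x), primeAt h = p := by
  have h : X.fromSpecStalk x ⟨p, hp⟩ ⤳ x :=
    (range_fromSpecStalk (x := x)).subset (Set.mem_range_self _)
  refine ⟨_, h, ?_⟩
  have h1 := (X.fromSpecStalk x).isEmbedding.injective (fromSpecStalk_primeAt h)
  exact congrArg PrimeSpectrum.asIdeal h1

theorem eq_of_primeAt_eq {z w x : X} (h : z ⤳ x) (h' : w ⤳ x) (hzw : primeAt h = primeAt h') :
    z = w := by
  rw [← fromSpecStalk_primeAt h, ← fromSpecStalk_primeAt h']
  exact congrArg (X.fromSpecStalk x) (PrimeSpectrum.ext hzw)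

theorem specializes_of_primeAt_le {z w x : X} (h : z ⤳ x) (h' : w ⤳ x)
    (hzw : primeAt h ≤ primeAt h') : z ⤳ w := by
  rw [← fromSpecStalk_primeAt h, ← fromSpecStalk_primeAt h']
  refine Specializes.map ?_ (X.fromSpecStalk x).continuous
  exact (PrimeSpectrum.le_iff_specializes _ _).1 hzw

/-! ### Orders of vanishing on an integral scheme -/

variable [IsIntegral X] [IsLocallyNoetherian X]

theorem ord_one (z : X) : ord (1 : X.functionField) z = 0 := by
  have h := ord_mul (x := z) (one_ne_zero (α := X.functionField)) one_ne_zero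
  rw [mul_one] at h
  omega

theorem ord_inv (z : X) {f : X.functionField} (hf : f ≠ 0) : ord f⁻¹ z = -ord f z := by
  have h := ord_mul (x := z) hf (inv_ne_zero hf)
  rw [mul_inv_cancel₀ hf, ord_one] at h
  omega

theorem ord_algebraMap_of_isUnit {z : X} {a : X.presheaf.stalk z} (ha : IsUnit a) :
    ord (algebraMap _ X.functionField a) z = 0 := by
  by_cases hz : Order.coheight z = 1
  · have := krullDimLE_of_coheight_le (X := X) hz.le
    rw [ord_eq_iff hz (ha.map _).ne_zero]
    exact Ring.ordFrac_of_isUnit ha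
  · exact ord_eq_zero_of_coheight_neq_one hz _

theorem isDiscreteValuationRing_stalk {z : X} (hz : Order.coheight z = 1)
    {a : X.presheaf.stalk z} (ha : maximalIdeal (X.presheaf.stalk z) = Ideal.span {a}) :
    IsDiscreteValuationRing (X.presheaf.stalk z) ∧ Irreducible a := by
  have h1 : a ≠ 0 := by
    rintro rfl
    have h2 : ringKrullDim (X.presheaf.stalk z) = 0 :=
      ringKrullDim_eq_zero_of_isField
        (IsLocalRing.isField_iff_maximalIdeal_eq.2 (by simpa using ha))
    rw [ringKrullDim_stalk_eq_coheight, hz] at h2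
    exact absurd h2 (by norm_num)
  have h2 : Prime a := by
    rw [← Ideal.span_singleton_prime h1, ← ha]
    infer_instance
  have := isPrincipalIdealRing_of_maximalIdeal_eq_span ha
  refine ⟨⟨fun h3 => h1 ?_⟩, h2.irreducible⟩
  rw [ha] at h3
  simpa using h3

theorem ord_algebraMap_of_maximalIdeal_eq {z : X} (hz : Order.coheight z = 1)
    {a : X.presheaf.stalk z} (ha : maximalIdeal (X.presheaf.stalk z) = Ideal.span {a}) :
    ord (algebraMap _ X.functionField a) z = 1 := by
  obtain ⟨h1, h2⟩ := isDiscreteValuationRing_stalk hz ha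
  have := krullDimLE_of_coheight_le (X := X) hz.le
  rw [ord_eq_iff hz ((map_ne_zero_iff _ (IsFractionRing.injective _ _)).2 h2.ne_zero)]
  exact Ring.ordFrac_irreducible h2

/-- At a point of codimension one whose local ring is a discrete valuation ring, the rational
functions of order zero are the units of the local ring. -/
theorem exists_isUnit_of_ord_eq_zero {z : X} (hz : Order.coheight z = 1)
    {ϖ : X.presheaf.stalk z} (hϖ : maximalIdeal (X.presheaf.stalk z) = Ideal.span {ϖ})
    {f : X.functionField} (hf : f ≠ 0) (h : ord f z = 0) :
    ∃ a : X.presheaf.stalk z, IsUnit a ∧ algebraMap _ _ a = f := by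
  obtain ⟨h1, h2⟩ := isDiscreteValuationRing_stalk hz hϖ
  obtain ⟨a, b, hb, rfl⟩ := IsFractionRing.div_surjective (A := X.presheaf.stalk z) f
  have hb' := nonZeroDivisors.ne_zero hb
  have ha' : a ≠ 0 := by
    rintro rfl
    simp at hf
  have h0 : ∀ a : X.presheaf.stalk z, a ≠ 0 → algebraMap _ X.functionField a ≠ 0 := fun a ha =>
    (map_ne_zero_iff _ (IsFractionRing.injective _ _)).2 ha
  obtain ⟨m, u, hu⟩ := IsDiscreteValuationRing.associated_pow_irreducible ha' h2
  obtain ⟨k, v, hv⟩ := IsDiscreteValuationRing.associated_pow_irreducible hb' h2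
  have key : ∀ (a : X.presheaf.stalk z) (u : (X.presheaf.stalk z)ˣ) (m : ℕ), a * u = ϖ ^ m →
      a ≠ 0 → ord (algebraMap _ X.functionField a) z = m := by
    intro a u m h ha
    have h3 : ord (algebraMap _ X.functionField (ϖ ^ m)) z = m := by
      induction m generalizing a u with
      | zero => rw [pow_zero, map_one, ord_one]; rfl
      | succ m ih =>
        rw [pow_succ, map_mul, ord_mul (h0 _ (pow_ne_zero _ h2.ne_zero)) (h0 _ h2.ne_zero),
          ord_algebraMap_of_maximalIdeal_eq hz hϖ,
          ih (ϖ ^ m) 1 (by simp) (pow_ne_zero _ h2.ne_zero)]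
        push_cast; rfl
    rw [← h, map_mul, ord_mul (h0 _ ha) (h0 _ u.ne_zero), ord_algebraMap_of_isUnit u.isUnit] at h3
    omega
  rw [div_eq_mul_inv, ord_mul (h0 _ ha') (inv_ne_zero (h0 _ hb')), ord_inv _ (h0 _ hb'),
    key a u m hu ha', key b v k hv hb'] at h
  have hmk : m = k := by omega
  subst hmk
  refine ⟨v * (↑u⁻¹ : X.presheaf.stalk z), v.isUnit.mul u⁻¹.isUnit, ?_⟩
  rw [eq_div_iff (h0 _ hb'), ← map_mul]
  congr 1
  calc v * (↑u⁻¹ : X.presheaf.stalk z) * b = (b * v) * (↑u⁻¹ : X.presheaf.stalk z) := by ring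
    _ = a := by rw [hv, ← hu, mul_assoc, Units.mul_inv, mul_one]

theorem ord_algebraMap_of_notMem {z x : X} (h : z ⤳ x) {a : X.presheaf.stalk x}
    (ha : a ∉ primeAt h) : ord (algebraMap _ X.functionField a) z = 0 := by
  rw [← algebraMap_stalkSpecializes h]
  exact ord_algebraMap_of_isUnit (not_not.1 (mt mem_primeAt.2 ha))

theorem ord_algebraMap_of_primeAt_eq {z x : X} (hz : Order.coheight z = 1) (h : z ⤳ x)
    {a : X.presheaf.stalk x} (ha : primeAt h = Ideal.span {a}) :
    ord (algebraMap _ X.functionField a) z = 1 := by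
  rw [← algebraMap_stalkSpecializes h]
  apply ord_algebraMap_of_maximalIdeal_eq hz
  let _ := (X.presheaf.stalkSpecializes h).hom.toAlgebra
  have := isLocalization_stalkSpecializes h
  rw [← IsLocalization.AtPrime.map_eq_maximalIdeal (primeAt h) (X.presheaf.stalk z), ha,
    Ideal.map_span, Set.image_singleton]
  rfl

theorem coheight_lt_of_specializes {X : Scheme.{u}} {z x : X} (h : z ⤳ x) (hne : z ≠ x)
    (hx : Order.coheight x < ⊤) : Order.coheight z < Order.coheight x :=
  Order.coheight_strictAnti (lt_of_le_not_ge (α := X) h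
    fun h' => hne (Specializes.antisymm h h').eq)
    ((Order.coheight_anti (show x ≤ z from h)).trans_lt hx)

theorem eq_genericPoint_of_coheight_eq_zero {X : Scheme.{u}} [IsIntegral X] {z : X}
    (hz : Order.coheight z = 0) : z = genericPoint X := by
  have h1 : genericPoint X ⤳ z := (genericPoint_spec X).specializes (Set.mem_univ z)
  have h2 : z ⤳ genericPoint X := Order.coheight_eq_zero.1 hz h1
  exact (h2.antisymm h1).eq

/-- A proper closed subset has finitely many points of codimension one, as they are maximal
points of it. -/
theorem finite_setOf_coheight_eq_one {X : Scheme.{u}} [IsIntegral X] [IsNoetherian X]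
    {Z : Set X} (hZ : IsClosed Z) (hgen : genericPoint X ∉ Z) :
    {z ∈ Z | Order.coheight z = 1}.Finite := by
  refine (TopologicalSpace.NoetherianSpace.finite_setOf_maximal hZ).subset ?_
  rintro z ⟨hz, hz1⟩
  refine ⟨hz, fun y hy h => by_contra fun hne => hgen ?_⟩
  have h1 := coheight_lt_of_specializes h hne (hz1 ▸ ENat.one_lt_top)
  rw [hz1, Order.lt_one_iff] at h1
  exact eq_genericPoint_of_coheight_eq_zero h1 ▸ hy

theorem finite_setOf_ord_ne_zero {X : Scheme.{u}} [IsIntegral X] [IsNoetherian X]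
    (f : X.functionField) : {z | ord f z ≠ 0}.Finite := by
  by_cases hf : f = 0
  · simp [hf, ord_zero]
  obtain ⟨U, -, f', hU, rfl, hf'⟩ := exists_isUnit_germ_eq X f hf
  have hgen : genericPoint X ∈ U :=
    (genericPoint_spec X).mem_open_set_iff U.2 |>.2 (by simpa using Set.nonempty_coe_sort.1 hU)
  refine (finite_setOf_coheight_eq_one U.2.isClosed_compl (fun h => h hgen)).subset ?_
  intro z hz
  refine ⟨fun hzU => hz (ord_of_isUnit hf' hzU), by_contra fun h => hz ?_⟩
  exact ord_eq_zero_of_coheight_neq_one h _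

end AlgebraicGeometry.Scheme

/-! ### Local rings of smooth complex schemes -/

namespace AlgebraicGeometry.Scheme

open IsLocalRing

variable {X : Scheme.{0}} (G : X ⟶ Spec (.of ℂ))

/-- The constant functions in the local ring at a point of a scheme over `ℂ`. -/
def constants (x : X) : ℂ →+* X.presheaf.stalk x :=
  ((ΓSpecIso (.of ℂ)).inv ≫ G.appTop ≫ X.presheaf.germ ⊤ x (TopologicalSpace.Opens.mem_top x)).hom

theorem stalkSpecializes_comp_constants {z x : X} (h : z ⤳ x) :
    (X.presheaf.stalkSpecializes h).hom.comp (constants G x) = constants G z := by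
  unfold constants
  rw [← CommRingCat.hom_comp, Category.assoc, Category.assoc,
    TopCat.Presheaf.germ_stalkSpecializes]

theorem constants_eq_germ_comp (x : X) {V : X.Opens} (hx : x ∈ V) {U : (Spec (.of ℂ)).Opens}
    (hU : U = ⊤) (e : V ≤ G ⁻¹ᵁ U) :
    constants G x = (X.presheaf.germ V x hx).hom.comp ((G.appLE U V e).hom.comp
      ((ΓSpecIso (.of ℂ)).inv ≫ (Spec (.of ℂ)).presheaf.map (eqToHom (by rw [hU])).op).hom) := by
  subst hU
  rw [constants, ← CommRingCat.hom_comp, ← CommRingCat.hom_comp]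
  congr 1
  simp only [Scheme.Hom.appLE, eqToHom_refl, op_id, CategoryTheory.Functor.map_id, Category.comp_id,
    Category.assoc]
  rw [X.presheaf.germ_res]
  rfl

theorem stalkMap_comp_constants {Y : Scheme.{0}} (f : X ⟶ Y) (H : Y ⟶ Spec (.of ℂ)) (x : X) :
    (f.stalkMap x).hom.comp (constants H (f x)) = constants (f ≫ H) x := by
  rw [constants, constants, ← CommRingCat.hom_comp, Category.assoc, Category.assoc,
    Scheme.Hom.germ_stalkMap, Scheme.Hom.comp_appTop, Category.assoc]
  rfl

/-- Every point has an affine neighbourhood that is standard smooth over `ℂ`, with a structure map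
that is compatible with the constants in the local ring. -/
theorem exists_affine_chart (x : X) (n : ℕ) [SmoothOfRelativeDimension n G] :
    ∃ (V : X.Opens) (_ : IsAffineOpen V) (hx : x ∈ V) (φ : ℂ →+* Γ(X, V)),
      (X.presheaf.germ V x hx).hom.comp φ = constants G x ∧
      φ.IsStandardSmoothOfRelativeDimension n := by
  obtain ⟨U, hU, V, hV, hx, e, h⟩ :=
    SmoothOfRelativeDimension.exists_isStandardSmoothOfRelativeDimension (n := n) (f := G) x
  have hU' : U = ⊤ := by
    ext y
    simp only [TopologicalSpace.Opens.coe_top, Set.mem_univ, iff_true]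
    have : y = G x := Subsingleton.elim (α := PrimeSpectrum ℂ) _ _
    rw [this]
    exact e hx
  refine ⟨V, hV, hx, _, (constants_eq_germ_comp G x hx hU' e).symm, ?_⟩
  subst hU'
  have h1 := h.comp (RingHom.IsStandardSmoothOfRelativeDimension.equiv
    ((ΓSpecIso (.of ℂ)).symm.commRingCatIsoToRingEquiv))
  simp only [Nat.add_zero, eqToHom_refl, op_id, CategoryTheory.Functor.map_id,
    Category.comp_id] at h1 ⊢
  exact h1

theorem essFiniteType_constants (n : ℕ) [SmoothOfRelativeDimension n G] (x : X) :
    (constants G x).EssFiniteType := by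
  obtain ⟨V, hV, hx, φ, hφ, h⟩ := exists_affine_chart G x n
  rw [← hφ]
  algebraize [φ]
  let _ := TopCat.Presheaf.algebra_section_stalk X.presheaf (⟨x, hx⟩ : V)
  have := hV.isLocalization_stalk ⟨x, hx⟩
  refine RingHom.EssFiniteType.comp (RingHom.FiniteType.essFiniteType ?_) ?_
  · have := Algebra.IsStandardSmoothOfRelativeDimension.isStandardSmooth (R := ℂ) (S := Γ(X, V)) n
    exact (inferInstance : Algebra.FiniteType ℂ Γ(X, V))
  · exact RingHom.essFiniteType_algebraMap.2 (Algebra.EssFiniteType.of_isLocalization _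
      (hV.primeIdealOf ⟨x, hx⟩).asIdeal.primeCompl)

theorem exists_isClosed_specializes [CompactSpace X] (x : X) : ∃ y : X, x ⤳ y ∧ IsClosed {y} := by
  obtain ⟨y, hy, hy'⟩ := (isClosed_closure (s := {x})).exists_closed_singleton (by simp)
  exact ⟨y, specializes_iff_mem_closure.2 hy, hy'⟩

variable [IsLocallyNoetherian X]

/-- The local ring at a closed point of a smooth scheme of relative dimension `n` over `ℂ` is
regular of dimension `n`, and its residue field is `ℂ`. -/
theorem smooth_stalk (n : ℕ) [SmoothOfRelativeDimension n G] {x : X} (hx : IsClosed {x}) :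
    (∃ a : Fin n → X.presheaf.stalk x, maximalIdeal _ = Ideal.span (Set.range a)) ∧
      n ≤ ringKrullDim (X.presheaf.stalk x) ∧
      Function.Surjective ((IsLocalRing.residue (X.presheaf.stalk x)).comp (constants G x)) := by
  obtain ⟨V, hV, hxV, φ, hφ, h⟩ := exists_affine_chart G x n
  rw [← hφ]
  algebraize [φ]
  let _ := TopCat.Presheaf.algebra_section_stalk X.presheaf (⟨x, hxV⟩ : V)
  have := hV.isLocalization_stalk ⟨x, hxV⟩
  have := Algebra.IsStandardSmoothOfRelativeDimension.isStandardSmooth (R := ℂ) (S := Γ(X, V)) n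
  have : Algebra.FiniteType ℂ Γ(X, V) := inferInstance
  set m := (hV.primeIdealOf ⟨x, hxV⟩).asIdeal with hm
  have hmax : m.IsMaximal := hV.primeIdealOf_isMaximal_of_isClosed ⟨x, hxV⟩ hx
  let _ := Ideal.Quotient.field m
  have : Module.Finite ℂ (Γ(X, V) ⧸ m) := finite_of_finite_type_of_isJacobsonRing _ _
  have hbij : Function.Bijective (algebraMap ℂ (Γ(X, V) ⧸ m)) :=
    IsAlgClosed.algebraMap_bijective_of_isIntegral
  obtain ⟨h1, h2⟩ := Algebra.IsStandardSmoothOfRelativeDimension.exists_maximalIdeal_eq_span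
    (k := ℂ) (n := n) m hbij (X.presheaf.stalk x)
  refine ⟨h1, h2, fun r => ?_⟩
  obtain ⟨r', hr'⟩ :=
    (IsLocalization.AtPrime.equivQuotMaximalIdeal m (X.presheaf.stalk x)).surjective r
  obtain ⟨a, rfl⟩ := hbij.2 r'
  exact ⟨a, hr'⟩

theorem ringKrullDim_stalk_le (n : ℕ) [SmoothOfRelativeDimension n G] {x : X}
    (hx : IsClosed {x}) : ringKrullDim (X.presheaf.stalk x) ≤ n := by
  obtain ⟨⟨a, ha⟩, -, -⟩ := smooth_stalk G n hx
  rw [← IsLocalRing.maximalIdeal_height_eq_ringKrullDim]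
  have h1 := Ideal.height_le_spanFinrank (maximalIdeal (X.presheaf.stalk x)) Ideal.IsPrime.ne_top'
  have h2 : (maximalIdeal (X.presheaf.stalk x)).spanFinrank ≤ n := by
    rw [ha]
    refine (Submodule.spanFinrank_span_le_ncard_of_finite (Set.finite_range a)).trans ?_
    rw [← Set.image_univ]
    exact (Set.ncard_image_le Set.finite_univ).trans (by simp)
  exact_mod_cast h1.trans (by exact_mod_cast h2)

theorem coheight_le [CompactSpace X] (n : ℕ) [SmoothOfRelativeDimension n G] (x : X) :
    Order.coheight x ≤ n := by
  obtain ⟨y, hxy, hy⟩ := exists_isClosed_specializes x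
  have h1 := ringKrullDim_stalk_le G n hy
  rw [ringKrullDim_stalk_eq_coheight] at h1
  exact (Order.coheight_anti (show y ≤ x from hxy)).trans (by exact_mod_cast h1)

theorem isClosed_of_coheight_eq [CompactSpace X] (n : ℕ) [SmoothOfRelativeDimension n G] {x : X}
    (hx : Order.coheight x = n) : IsClosed {x} := by
  obtain ⟨y, hxy, hy⟩ := exists_isClosed_specializes x
  by_cases h : x = y
  · rwa [h]
  · have h1 := coheight_le G n y
    have h2 := coheight_lt_of_specializes hxy h (h1.trans_lt (ENat.natCast_lt_top n))
    exact absurd (h2.trans_le h1) (by simp [hx])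

theorem coheight_eq_of_isClosed (n : ℕ) [SmoothOfRelativeDimension n G] {x : X}
    (hx : IsClosed {x}) : Order.coheight x = n := by
  have h1 := ringKrullDim_stalk_le G n hx
  have h2 := (smooth_stalk G n hx).2.1
  rw [ringKrullDim_stalk_eq_coheight] at h1 h2
  exact le_antisymm (by exact_mod_cast h1) (by exact_mod_cast h2)

theorem uniqueFactorizationMonoid_stalk [IsIntegral X] [SmoothOfRelativeDimension 2 G] {x : X}
    (hx : IsClosed {x}) : UniqueFactorizationMonoid (X.presheaf.stalk x) := by
  obtain ⟨⟨a, ha⟩, h, -⟩ := smooth_stalk G 2 hx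
  refine uniqueFactorizationMonoid_of_maximalIdeal_eq_span (x := a 0) (y := a 1) ?_ h
  rw [ha]
  congr 1
  ext; simp [Fin.exists_fin_two, eq_comm]

theorem exists_maximalIdeal_stalk_eq_span [SmoothOfRelativeDimension 1 G] {x : X}
    (hx : IsClosed {x}) : ∃ a, maximalIdeal (X.presheaf.stalk x) = Ideal.span {a} := by
  obtain ⟨⟨a, ha⟩, h, -⟩ := smooth_stalk G 1 hx
  refine ⟨a 0, ?_⟩
  rw [ha]
  congr 1
  ext; simp [eq_comm]

end AlgebraicGeometry.Scheme

/-! ### The local intersection of a divisor with a curve -/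

namespace SemistableSurface

open IsLocalRing AlgebraicGeometry.Scheme

variable {F : SemistableSurface}

theorem PrimeDivisor.ext {Z W : F.PrimeDivisor} (h : Z.pt = W.pt) : Z = W := Subtype.ext h

theorem PrimeDivisor.coheight_pt (Z : F.PrimeDivisor) : Order.coheight Z.pt = 1 := Z.2

theorem PrimeDivisor.idealAt_eq {Z : F.PrimeDivisor} {x : F.X} (h : Z.pt ⤳ x) :
    Z.idealAt x = primeAt h := dif_pos h

theorem PrimeDivisor.idealAt_eq_top {Z : F.PrimeDivisor} {x : F.X} (h : ¬ Z.pt ⤳ x) :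
    Z.idealAt x = ⊤ := dif_neg h

theorem multiplicity_comm (Z W : F.PrimeDivisor) (x : F.X) :
    multiplicity Z W x = multiplicity W Z x := by
  rw [multiplicity, multiplicity, sup_comm]

theorem multiplicity_eq_zero_left {Z W : F.PrimeDivisor} {x : F.X} (h : ¬ Z.pt ⤳ x) :
    multiplicity Z W x = 0 := by
  rw [multiplicity, PrimeDivisor.idealAt_eq_top h, top_sup_eq,
    (Module.length_eq_zero_iff).2 (Ideal.Quotient.subsingleton_iff.2 rfl)]
  rfl

theorem multiplicity_eq_zero_right {Z W : F.PrimeDivisor} {x : F.X} (h : ¬ W.pt ⤳ x) :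
    multiplicity Z W x = 0 := by
  rw [multiplicity_comm, multiplicity_eq_zero_left h]

theorem isClosed_of_specializes {Z : F.PrimeDivisor} {x : F.X} (h : Z.pt ⤳ x) (hx : Z.pt ≠ x) :
    IsClosed {x} := by
  have h1 := coheight_le (F.π ≫ F.structureMap) 2 x
  have h2 := coheight_lt_of_specializes h hx (h1.trans_lt (ENat.natCast_lt_top 2))
  rw [Z.coheight_pt] at h2
  exact isClosed_of_coheight_eq (F.π ≫ F.structureMap) 2
    (le_antisymm h1 (by simpa [one_add_one_eq_two] using Order.add_one_le_of_lt h2))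

theorem PrimeDivisor.not_isClosed (Z : F.PrimeDivisor) : ¬ IsClosed {Z.pt} := by
  intro h
  have := coheight_eq_of_isClosed (F.π ≫ F.structureMap) 2 h
  rw [Z.coheight_pt] at this
  exact absurd this (by norm_num)

theorem PrimeDivisor.eq_of_specializes {Z W : F.PrimeDivisor} (h : Z.pt ⤳ W.pt) : Z = W := by
  by_contra hne
  exact W.not_isClosed (isClosed_of_specializes h (fun h' => hne (PrimeDivisor.ext h')))

/-- On a smooth surface, the ideal of a prime divisor at a closed point is principal. -/
theorem PrimeDivisor.exists_primeAt_eq_span {Z : F.PrimeDivisor} {x : F.X} (hx : IsClosed {x})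
    (h : Z.pt ⤳ x) : ∃ p : F.X.presheaf.stalk x, Prime p ∧ primeAt h = Ideal.span {p} := by
  have := uniqueFactorizationMonoid_stalk (F.π ≫ F.structureMap) hx
  have hh : (primeAt h).height = 1 := by rw [height_primeAt, Z.coheight_pt]
  have hne : primeAt h ≠ ⊥ := by
    intro h0
    rw [h0, Ideal.height_bot] at hh
    exact absurd hh (by norm_num)
  obtain ⟨p, hp, hpp⟩ := Ideal.IsPrime.exists_mem_prime_of_ne_bot inferInstance hne
  exact ⟨p, hpp, Ideal.eq_span_singleton_of_height_eq_one hh hp hpp⟩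

/-- A prime element of the local ring at `x` defines a prime divisor through `x`. -/
theorem PrimeDivisor.exists_primeAt_eq_span_of_prime {x : F.X} {p : F.X.presheaf.stalk x}
    (hp : Prime p) : ∃ (W : F.PrimeDivisor) (h : W.pt ⤳ x), primeAt h = Ideal.span {p} := by
  have hpr : (Ideal.span {p}).IsPrime := (Ideal.span_singleton_prime hp.ne_zero).2 hp
  obtain ⟨w, h, hw⟩ := exists_primeAt_eq (Ideal.span {p})
  have hh : (Ideal.span {p}).height = 1 := by
    refine le_antisymm
      (Ideal.height_le_one_of_isPrincipal_of_mem_minimalPrimes (Ideal.span {p}) _ ?_) ?_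
    · rw [Ideal.minimalPrimes_eq_subsingleton_self]; rfl
    · rw [Order.one_le_iff_ne_zero, Ne, Ideal.height_eq_zero_iff_eq_bot]
      simpa using hp.ne_zero
  rw [← hw, height_primeAt] at hh
  exact ⟨⟨w, hh⟩, h, hw⟩

theorem primeAt_refl {x : F.X} (h : x ⤳ x) : primeAt h = maximalIdeal (F.X.presheaf.stalk x) := by
  have h1 : F.X.presheaf.stalkSpecializes h = 𝟙 _ := TopCat.Presheaf.stalkSpecializes_refl ..
  rw [primeAt, h1]
  rfl

theorem dimensionLEOne_quotient_primeAt {Z : F.PrimeDivisor} {x : F.X} (h : Z.pt ⤳ x) :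
    Ring.DimensionLEOne (F.X.presheaf.stalk x ⧸ primeAt h) := by
  refine ⟨fun {q} hq hpr => ?_⟩
  set q' := q.comap (Ideal.Quotient.mk (primeAt h)) with hq'
  have hle : primeAt h ≤ q' := by
    intro a ha
    rw [hq', Ideal.mem_comap, Ideal.Quotient.eq_zero_iff_mem.2 ha]
    exact zero_mem _
  have hmap : q'.map (Ideal.Quotient.mk (primeAt h)) = q :=
    Ideal.map_comap_of_surjective _ Ideal.Quotient.mk_surjective q
  obtain ⟨w, hwx, hw⟩ := exists_primeAt_eq q'
  have hZw : Z.pt ⤳ w := specializes_of_primeAt_le h hwx (hw ▸ hle)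
  have hne : Z.pt ≠ w := by
    rintro rfl
    apply hq
    rw [← hmap, ← hw, Ideal.map_quotient_self]
  have hwx' : x = w := by
    have := hwx.mem_closed (isClosed_of_specializes hZw hne) rfl
    exact this
  subst hwx'
  rw [primeAt_refl] at hw
  have hmax : q'.IsMaximal := hw ▸ inferInstance
  rw [← hmap]
  exact (Ideal.map_eq_top_or_isMaximal_of_surjective _ Ideal.Quotient.mk_surjective
    hmax).resolve_left (hmap ▸ hpr.ne_top)

/-- The contribution of the point `x` to the intersection number of the curve `Z` with the divisor
of the rational function `f`. -/
def localDegree (f : F.X.functionField) (Z : F.PrimeDivisor) (x : F.X) : ℤ :=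
  ∑ᶠ W : F.PrimeDivisor, ord f W.pt * multiplicity W Z x

theorem finite_setOf_ord_pt_ne_zero (f : F.X.functionField) :
    {W : F.PrimeDivisor | ord f W.pt ≠ 0}.Finite :=
  (finite_setOf_ord_ne_zero f).preimage (f := PrimeDivisor.pt)
    (fun _ _ _ _ h => PrimeDivisor.ext h)

theorem finite_support_ord_mul (f : F.X.functionField) (c : F.PrimeDivisor → ℤ) :
    (Function.support fun W : F.PrimeDivisor => ord f W.pt * c W).Finite :=
  (finite_setOf_ord_pt_ne_zero f).subset fun _ hW => left_ne_zero_of_mul hW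

theorem localDegree_mul {f g : F.X.functionField} (hf : f ≠ 0) (hg : g ≠ 0) (Z : F.PrimeDivisor)
    (x : F.X) : localDegree (f * g) Z x = localDegree f Z x + localDegree g Z x := by
  unfold localDegree
  rw [← finsum_add_distrib]
  · exact finsum_congr fun W => by rw [ord_mul hf hg, add_mul]
  · exact finite_support_ord_mul f _
  · exact finite_support_ord_mul g _

theorem _root_.Ring.ord_quotient_mk {R : Type*} [CommRing R] (I : Ideal R) (p : R) :
    Ring.ord (R ⧸ I) (Ideal.Quotient.mk I p) = Module.length R (R ⧸ (Ideal.span {p} ⊔ I)) := by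
  rw [Ring.ord, ← Module.length_eq_of_surjective (S := R) (R := R ⧸ I)
    Ideal.Quotient.mk_surjective, sup_comm, ← Set.image_singleton, ← Ideal.map_span]
  exact (DoubleQuot.quotQuotEquivQuotSupₐ R I (Ideal.span {p})).toLinearEquiv.length_eq

/-- Near `x` the divisor of a prime element `p` is a single prime divisor, with multiplicity one. -/
theorem localDegree_prime {Z : F.PrimeDivisor} {x : F.X} (h : Z.pt ⤳ x)
    {p : F.X.presheaf.stalk x} (hp : Prime p) :
    localDegree (algebraMap _ _ p) Z x =
      ((Ring.ord (F.X.presheaf.stalk x ⧸ primeAt h) (Ideal.Quotient.mk _ p)).toNat : ℤ) := by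
  obtain ⟨W, hWx, hW⟩ := PrimeDivisor.exists_primeAt_eq_span_of_prime hp
  unfold localDegree
  rw [finsum_eq_single _ W, ord_algebraMap_of_primeAt_eq W.coheight_pt hWx hW, one_mul,
    multiplicity, PrimeDivisor.idealAt_eq h, PrimeDivisor.idealAt_eq hWx, hW, Ring.ord_quotient_mk]
  intro W' hW'
  by_cases hx : W'.pt ⤳ x
  · rw [ord_algebraMap_of_notMem hx, zero_mul]
    intro hmem
    refine hW' (PrimeDivisor.eq_of_specializes (specializes_of_primeAt_le hWx hx ?_)).symm
    rw [hW, Ideal.span_singleton_le_iff_mem]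
    exact hmem
  · rw [multiplicity_eq_zero_left hx, Nat.cast_zero, mul_zero]

theorem localDegree_isUnit {Z : F.PrimeDivisor} {x : F.X}
    {u : F.X.presheaf.stalk x} (hu : IsUnit u) :
    localDegree (algebraMap _ _ u) Z x = 0 := by
  unfold localDegree
  rw [← finsum_zero (α := F.PrimeDivisor)]
  refine finsum_congr fun W => ?_
  by_cases hx : W.pt ⤳ x
  · rw [ord_algebraMap_of_notMem hx, zero_mul]
    exact fun h' => mem_primeAt.1 h' (hu.map _)
  · rw [multiplicity_eq_zero_left hx, Nat.cast_zero, mul_zero]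

/-- The local contribution for a regular function `a`: both sides are additive in `a`, and local
rings of smooth surfaces are factorial, so that it suffices to treat prime elements. -/
theorem localDegree_algebraMap {Z : F.PrimeDivisor} {x : F.X} (hx : IsClosed {x}) (h : Z.pt ⤳ x)
    {a : F.X.presheaf.stalk x} (ha : a ∉ primeAt h) :
    localDegree (algebraMap _ _ a) Z x =
      ((Ring.ord (F.X.presheaf.stalk x ⧸ primeAt h) (Ideal.Quotient.mk _ a)).toNat : ℤ) := by
  have := uniqueFactorizationMonoid_stalk (F.π ≫ F.structureMap) hx
  have := dimensionLEOne_quotient_primeAt h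
  induction a using UniqueFactorizationMonoid.induction_on_prime with
  | h₁ => exact absurd (zero_mem _) ha
  | h₂ u hu =>
    rw [localDegree_isUnit hu, Ring.ord_of_isUnit (hu.map _)]
    rfl
  | h₃ a p ha0 hp ih =>
    have hp' : p ∉ primeAt h := fun h' => ha (Ideal.mul_mem_right _ _ h')
    have ha' : a ∉ primeAt h := fun h' => ha (Ideal.mul_mem_left _ _ h')
    have hK : ∀ a : F.X.presheaf.stalk x, a ≠ 0 → algebraMap _ F.X.functionField a ≠ 0 :=
      fun a ha => (map_ne_zero_iff _ (IsFractionRing.injective _ _)).2 ha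
    have hn : ∀ a : F.X.presheaf.stalk x, a ∉ primeAt h →
        Ideal.Quotient.mk (primeAt h) a ∈ nonZeroDivisors _ := fun a ha =>
      mem_nonZeroDivisors_of_ne_zero (mt Ideal.Quotient.eq_zero_iff_mem.1 ha)
    rw [map_mul, localDegree_mul (hK _ hp.ne_zero) (hK _ ha0), ih ha', localDegree_prime h hp,
      map_mul, Ring.ord_mul _ (hn a ha'), ENat.toNat_add (Ring.ord_ne_top (hn p hp'))
      (Ring.ord_ne_top (hn a ha'))]
    push_cast
    rfl

end SemistableSurface

/-! ### Local contributions in terms of valuations -/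

namespace ValuationSubring

/-- A nontrivial valuation ring of an algebraic extension of the fraction field of a
one-dimensional local domain `O` dominates `O` as soon as it contains `O`. -/
theorem isUnit_of_mem_nontrivialOver {O K : Type*} [CommRing O] [IsDomain O] [IsLocalRing O]
    [Ring.DimensionLEOne O] [Field K] [Algebra O K] [Algebra.IsAlgebraic O K]
    {V : ValuationSubring K} (hV : V ∈ nontrivialOver O K) {a : O}
    (ha : V.valuation (algebraMap O K a) = 1) : IsUnit a := by
  let φ : O →+* V := (algebraMap O K).codRestrict V.toSubring hV.1
  have hφ : ∀ b, IsUnit (φ b) ↔ V.valuation (algebraMap O K b) = 1 := fun b =>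
    ValuationSubring.valuation_eq_one_iff V (φ b)
  set q := (IsLocalRing.maximalIdeal V).comap φ with hq
  have hqm : ∀ b, b ∈ q ↔ ¬ IsUnit (φ b) := fun b => Iff.rfl
  by_cases hq0 : q = ⊥
  · exfalso
    refine hV.2 (_root_.eq_top_iff.2 fun x _ => ?_)
    obtain ⟨y, hy, hyx⟩ := (Algebra.IsAlgebraic.isAlgebraic (R := O) x).exists_integral_multiple
    have hu : V.valuation (algebraMap O K y) = 1 := by
      rw [← hφ]
      by_contra h
      rw [← hqm, hq0] at h
      exact hy h
    have hmem : y • x ∈ V := by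
      have hyV := (nontrivialOver_integralClosure O K ▸ hV).1 ⟨y • x, hyx⟩
      exact hyV
    rw [← V.valuation_le_one_iff, Algebra.smul_def, map_mul, hu, one_mul,
      V.valuation_le_one_iff] at hmem
    exact hmem
  · have hmax : q.IsMaximal := Ring.DimensionLEOne.maximalOfPrime hq0 inferInstance
    by_contra h
    have h1 : a ∈ q := by
      rw [IsLocalRing.eq_maximalIdeal hmax]
      exact h
    exact (hqm a).1 h1 ((hφ a).2 ha)

end ValuationSubring

namespace AlgebraicGeometry.Scheme

universe u

theorem dominatedBy_iff {X : Scheme.{u}} {z : X} {R : CommRingCat.{u}} [IsLocalRing R]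
    (g : R ⟶ X.residueField z) (V : ValuationSubring (X.residueField z)) :
    DominatedBy g V ↔ (∀ a, g.hom a ∈ V) ∧ ∀ a, V.valuation (g.hom a) = 1 → IsUnit a := by
  constructor
  · rintro ⟨φ, hφ, hloc⟩
    have key : ∀ a, g.hom a = ((φ.hom a : V) : X.residueField z) := fun a => by rw [← hφ]; rfl
    refine ⟨fun a => key a ▸ (φ.hom a : V).2, fun a ha => ?_⟩
    rw [key, ← ValuationSubring.valuation_eq_one_iff] at ha
    exact hloc.map_nonunit _ ha
  · rintro ⟨h1, h2⟩
    let φ : R →+* V :=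
      { toFun := fun a => ⟨g.hom a, h1 a⟩
        map_one' := Subtype.ext (map_one g.hom)
        map_zero' := Subtype.ext (map_zero g.hom)
        map_add' := fun a b => Subtype.ext (map_add g.hom a b)
        map_mul' := fun a b => Subtype.ext (map_mul g.hom a b) }
    refine ⟨CommRingCat.ofHom φ, rfl, ⟨fun a ha => h2 a ?_⟩⟩
    exact (ValuationSubring.valuation_eq_one_iff V _).1 ha

end AlgebraicGeometry.Scheme

namespace SemistableSurface

open IsLocalRing AlgebraicGeometry.Scheme ValuationSubring

variable {F : SemistableSurface}

section LocalRing

variable {z x : F.X} (h : z ⤳ x)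

/-- Evaluation at `z` on the functions at `x` modulo those that vanish at `z`. -/
def evalQuotient : F.X.presheaf.stalk x ⧸ primeAt h →+* F.X.residueField z :=
  Ideal.Quotient.lift (primeAt h) (evalAt h).hom fun _ ha => (evalAt_eq_zero_iff h).2 ha

theorem evalQuotient_mk (a : F.X.presheaf.stalk x) :
    evalQuotient h (Ideal.Quotient.mk _ a) = (evalAt h).hom a := rfl

theorem evalQuotient_injective : Function.Injective (evalQuotient h) := by
  rw [injective_iff_map_eq_zero]
  intro a ha
  obtain ⟨a, rfl⟩ := Ideal.Quotient.mk_surjective a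
  rw [evalQuotient_mk, evalAt_eq_zero_iff] at ha
  exact Ideal.Quotient.eq_zero_iff_mem.2 ha

theorem isFractionRing_evalQuotient :
    let _ := (evalQuotient h).toAlgebra
    IsFractionRing (F.X.presheaf.stalk x ⧸ primeAt h) (F.X.residueField z) := by
  intro _
  have : FaithfulSMul (F.X.presheaf.stalk x ⧸ primeAt h) (F.X.residueField z) :=
    (faithfulSMul_iff_algebraMap_injective _ _).2 (evalQuotient_injective h)
  refine IsFractionRing.of_field _ _ fun a => ?_
  obtain ⟨b, c, -, hbc⟩ := exists_evalAt_div_eq h a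
  exact ⟨Ideal.Quotient.mk _ b, Ideal.Quotient.mk _ c, hbc⟩

/-- The constants in the local ring at `x` modulo the functions that vanish at `z`. -/
def constantsQuotient : ℂ →+* F.X.presheaf.stalk x ⧸ primeAt h :=
  (Ideal.Quotient.mk _).comp (constants (F.π ≫ F.structureMap) x)

theorem essFiniteType_constantsQuotient : (constantsQuotient h).EssFiniteType :=
  (essFiniteType_constants (F.π ≫ F.structureMap) 2 x).comp
    (RingHom.FiniteType.of_surjective _ Ideal.Quotient.mk_surjective).essFiniteType

theorem constantsQuotient_residue_surjective (hx : IsClosed {x})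
    [IsLocalRing (F.X.presheaf.stalk x ⧸ primeAt h)] :
    Function.Surjective ((IsLocalRing.residue _).comp (constantsQuotient h)) := by
  intro r
  obtain ⟨r, rfl⟩ := IsLocalRing.residue_surjective r
  obtain ⟨r, rfl⟩ := Ideal.Quotient.mk_surjective r
  obtain ⟨c, hc⟩ := (smooth_stalk (F.π ≫ F.structureMap) 2 hx).2.2
    (IsLocalRing.residue (F.X.presheaf.stalk x) r)
  refine ⟨c, ?_⟩
  have h1 : constants (F.π ≫ F.structureMap) x c - r ∈ maximalIdeal (F.X.presheaf.stalk x) := by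
    rw [← IsLocalRing.residue_eq_zero_iff, map_sub, sub_eq_zero]
    exact hc
  rw [← sub_eq_zero, RingHom.comp_apply, ← map_sub, IsLocalRing.residue_eq_zero_iff,
    constantsQuotient, RingHom.comp_apply, ← map_sub]
  intro hu
  refine h1 ?_
  exact (isLocalHom_of_le_jacobson_bot _ (by
    rw [IsLocalRing.jacobson_eq_maximalIdeal ⊥ bot_ne_top]
    exact IsLocalRing.le_maximalIdeal Ideal.IsPrime.ne_top')).map_nonunit _ hu

instance isLocalRing_quotient_primeAt : IsLocalRing (F.X.presheaf.stalk x ⧸ primeAt h) :=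
  IsLocalRing.of_surjective' _ Ideal.Quotient.mk_surjective

/-- The valuations of the function field of a curve that are centered at the point `x` are those
over the local ring of the curve at `x`. -/
theorem isCenter_iff_mem_nontrivialOver [Ring.DimensionLEOne (F.X.presheaf.stalk x ⧸ primeAt h)]
    (V : ValuationSubring (F.X.residueField z)) :
    let _ := (evalQuotient h).toAlgebra
    IsCenter V x ∧ V ≠ ⊤ ↔
      V ∈ nontrivialOver (F.X.presheaf.stalk x ⧸ primeAt h) (F.X.residueField z) := by
  intro _
  have := isFractionRing_evalQuotient h
  constructor
  · rintro ⟨⟨h', hV⟩, hne⟩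
    refine ⟨fun a => ?_, hne⟩
    obtain ⟨a, rfl⟩ := Ideal.Quotient.mk_surjective a
    exact ((dominatedBy_iff _ V).1 hV).1 a
  · intro hV
    refine ⟨⟨h, (dominatedBy_iff _ V).2 ⟨fun a => hV.1 (Ideal.Quotient.mk _ a), fun a ha => ?_⟩⟩,
      hV.2⟩
    have : Algebra.IsAlgebraic (F.X.presheaf.stalk x ⧸ primeAt h) (F.X.residueField z) :=
      IsLocalization.isAlgebraic _ (nonZeroDivisors (F.X.presheaf.stalk x ⧸ primeAt h))
    have h1 := isUnit_of_mem_nontrivialOver hV (a := Ideal.Quotient.mk _ a) ha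
    exact (isLocalHom_of_le_jacobson_bot _ (by
      rw [IsLocalRing.jacobson_eq_maximalIdeal ⊥ bot_ne_top]
      exact IsLocalRing.le_maximalIdeal Ideal.IsPrime.ne_top')).map_nonunit _ h1

end LocalRing

theorem hasOrdSum_localDegree_algebraMap {Z : F.PrimeDivisor} {x : F.X} (hx : IsClosed {x})
    (h : Z.pt ⤳ x) {a : F.X.presheaf.stalk x} (ha : a ∉ primeAt h) :
    HasOrdSum {V | IsCenter V x ∧ V ≠ ⊤} ((evalAt h).hom a)
      (localDegree (algebraMap _ _ a) Z x) := by
  have := dimensionLEOne_quotient_primeAt h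
  let _ := (evalQuotient h).toAlgebra
  have := isFractionRing_evalQuotient h
  let _ := (constantsQuotient h).toAlgebra
  have : Algebra.EssFiniteType ℂ (F.X.presheaf.stalk x ⧸ primeAt h) :=
    essFiniteType_constantsQuotient h
  have := finite_integralClosure_of_essFiniteType ℂ (O := F.X.presheaf.stalk x ⧸ primeAt h)
    (K := F.X.residueField Z.pt)
  have h1 := hasOrdSum_ord_of_isLocalRing (O := F.X.presheaf.stalk x ⧸ primeAt h)
    (K := F.X.residueField Z.pt) ℂ (constantsQuotient_residue_surjective h hx)
    (a := Ideal.Quotient.mk _ a) (mt Ideal.Quotient.eq_zero_iff_mem.1 ha)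
  rw [← localDegree_algebraMap hx h ha] at h1
  have h2 : {V : ValuationSubring (F.X.residueField Z.pt) | IsCenter V x ∧ V ≠ ⊤} =
      nontrivialOver (F.X.presheaf.stalk x ⧸ primeAt h) (F.X.residueField Z.pt) :=
    Set.ext fun V => isCenter_iff_mem_nontrivialOver h V
  rw [h2]
  exact h1

/-- If `f` is a unit at the generic point of the curve `Z`, then the local intersection number at
`x` of `Z` with the divisor of `f` is the sum of the orders of `f` at the valuations of the
function field of `Z` centered at `x`. -/
theorem hasOrdSum_localDegree {Z : F.PrimeDivisor} (x : F.X)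
    {u : F.X.presheaf.stalk Z.pt} (hu : IsUnit u) :
    HasOrdSum {V | IsCenter V x ∧ V ≠ ⊤} ((F.X.residue Z.pt).hom u)
      (localDegree (algebraMap _ _ u) Z x) := by
  by_cases hx : Z.pt ⤳ x ∧ Z.pt ≠ x
  · obtain ⟨h, hne⟩ := hx
    have hcl := isClosed_of_specializes h hne
    obtain ⟨b, c, hc, hbc⟩ := exists_mul_stalkSpecializes_eq h u
    have hb : IsUnit ((F.X.presheaf.stalkSpecializes h).hom b) := hbc ▸ hu.mul hc
    have hb' : b ∉ primeAt h := fun h' => mem_primeAt.1 h' hb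
    have hc' : c ∉ primeAt h := fun h' => mem_primeAt.1 h' hc
    have h1 := hasOrdSum_localDegree_algebraMap hcl h hb'
    have h2 := hasOrdSum_localDegree_algebraMap hcl h hc'
    have hK : ∀ a : F.X.presheaf.stalk Z.pt, IsUnit a → algebraMap _ F.X.functionField a ≠ 0 :=
      fun a ha => (ha.map _).ne_zero
    have e1 : localDegree (algebraMap _ _ b) Z x =
        localDegree (algebraMap _ _ u) Z x + localDegree (algebraMap _ _ c) Z x := by
      rw [← algebraMap_stalkSpecializes h b, ← algebraMap_stalkSpecializes h c,
        ← localDegree_mul (hK _ hu) (hK _ hc), ← map_mul, hbc]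
    have hc0 : (evalAt h).hom c ≠ 0 := mt (evalAt_eq_zero_iff h).1 hc'
    have hb0 : (evalAt h).hom b ≠ 0 := mt (evalAt_eq_zero_iff h).1 hb'
    have e2 : (F.X.residue Z.pt).hom u = (evalAt h).hom b * ((evalAt h).hom c)⁻¹ := by
      refine (eq_mul_inv_iff_mul_eq₀ hc0).2 ?_
      exact (map_mul (F.X.residue Z.pt).hom _ _).symm.trans (congrArg (F.X.residue Z.pt).hom hbc)
    have h3 := h1.mul hb0 (inv_ne_zero hc0) (h2.inv hc0)
    rw [← e2, e1, add_neg_cancel_right] at h3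
    exact h3
  · -- Here `x` is the generic point of `Z` or does not lie on `Z`, and both sides vanish.
    have h1 : {V : ValuationSubring (F.X.residueField Z.pt) | IsCenter V x ∧ V ≠ ⊤} = ∅ := by
      refine Set.eq_empty_iff_forall_notMem.2 ?_
      rintro V ⟨⟨h, hV⟩, hne⟩
      have hx' : Z.pt = x := not_not.1 fun h' => hx ⟨h, h'⟩
      subst hx'
      refine hne (_root_.eq_top_iff.2 fun a _ => ?_)
      obtain ⟨b, c, hc, rfl⟩ := exists_evalAt_div_eq h a
      have hc1 : IsUnit c := by
        by_contra hc1
        rw [primeAt_refl] at hc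
        exact hc hc1
      rw [dominatedBy_iff] at hV
      obtain ⟨c, rfl⟩ := hc1
      have h2 : (evalAt h).hom b / (evalAt h).hom c =
          (evalAt h).hom (b * (↑c⁻¹ : F.X.presheaf.stalk Z.pt)) := by
        rw [div_eq_iff (c.isUnit.map (evalAt h).hom).ne_zero, ← map_mul, mul_assoc,
          Units.inv_mul, mul_one]
      rw [h2]
      exact hV.1 _
    have h2 : localDegree (algebraMap _ _ u) Z x = 0 := by
      unfold localDegree
      rw [← finsum_zero (α := F.PrimeDivisor)]
      refine finsum_congr fun W => ?_
      by_cases h : Z.pt ⤳ x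
      · have hx' : Z.pt = x := not_not.1 fun h' => hx ⟨h, h'⟩
        by_cases hW : W = Z
        · rw [hW, ord_algebraMap_of_isUnit hu, zero_mul]
        · rw [multiplicity_eq_zero_left, Nat.cast_zero, mul_zero]
          rw [← hx']
          exact fun h' => hW (PrimeDivisor.eq_of_specializes h')
      · rw [multiplicity_eq_zero_right h, Nat.cast_zero, mul_zero]
    rw [h1, h2]
    exact ⟨by simp, by simp⟩

end SemistableSurface

/-! ### Intersection numbers with principal divisors -/

/-- Sums of orders over a set of valuations that is partitioned by a relation `P`. -/
theorem ValuationSubring.HasOrdSum.finsum_eq {K ι : Type*} [Field K] {t : Set (ValuationSubring K)}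
    {a : K} {n : ℤ} (H : HasOrdSum t a n) (P : ValuationSubring K → ι → Prop)
    (hP : ∀ V, V ∈ t ↔ ∃ i, P V i) (huniq : ∀ V i j, P V i → P V j → i = j) {m : ι → ℤ}
    (hm : ∀ i, HasOrdSum {V | P V i} a (m i)) : ∑ᶠ i, m i = n := by
  classical
  set A := H.1.toFinset with hA
  have hmA : ∀ V, V ∈ A ↔ V ∈ t ∧ V.vord a ≠ 0 := fun V => by simp [hA]
  have h1 : ∀ i, m i = ∑ V ∈ A, if P V i then V.vord a else 0 := by
    intro i
    rw [← (hm i).2, ← Finset.sum_filter]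
    refine finsum_mem_eq_sum_of_inter_support_eq _ (Set.ext fun V => ?_)
    simp only [Set.mem_inter_iff, Set.mem_ofPred_eq, Function.mem_support, Finset.coe_filter, hmA]
    exact ⟨fun h => ⟨⟨⟨(hP V).2 ⟨i, h.1⟩, h.2⟩, h.1⟩, h.2⟩, fun h => ⟨h.1.2, h.2⟩⟩
  simp only [h1]
  rw [finsum_sum_comm]
  · rw [← H.2, finsum_mem_eq_sum _ H.1]
    refine Finset.sum_congr rfl fun V hV => ?_
    obtain ⟨i, hi⟩ := (hP V).1 ((hmA V).1 hV).1
    rw [finsum_eq_single _ i, if_pos hi]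
    intro j hj
    rw [if_neg fun h => hj (huniq V j i h hi)]
  · intro V _
    refine Set.Subsingleton.finite fun i hi j hj => huniq V i j ?_ ?_
    · by_contra h
      simp [h] at hi
    · by_contra h
      simp [h] at hj

namespace SemistableSurface

open IsLocalRing AlgebraicGeometry.Scheme ValuationSubring

variable {F : SemistableSurface}

theorem finite_setOf_specializes {Z W : F.PrimeDivisor} (hZW : Z ≠ W) :
    {x : F.X | Z.pt ⤳ x ∧ W.pt ⤳ x}.Finite := by
  have hT : IsClosed {x : F.X | Z.pt ⤳ x ∧ W.pt ⤳ x} := by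
    have : {x : F.X | Z.pt ⤳ x ∧ W.pt ⤳ x} = closure {Z.pt} ∩ closure {W.pt} := by
      ext; simp [specializes_iff_mem_closure]
    rw [this]
    exact isClosed_closure.inter isClosed_closure
  refine (TopologicalSpace.NoetherianSpace.finite_setOf_maximal hT).subset ?_
  rintro y hy
  refine ⟨hy, fun y' hy' h => ?_⟩
  have hne : Z.pt ≠ y' := by
    rintro rfl
    exact hZW (PrimeDivisor.eq_of_specializes hy'.2).symm
  exact (h.mem_closed (isClosed_of_specializes hy'.1 hne) rfl).symm

theorem finite_support_multiplicity {Z W : F.PrimeDivisor} (hZW : Z ≠ W) :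
    (Function.support (multiplicity Z W)).Finite :=
  (finite_setOf_specializes hZW).subset fun _ hx =>
    ⟨not_not.1 fun h => hx (multiplicity_eq_zero_left h),
      not_not.1 fun h => hx (multiplicity_eq_zero_right h)⟩

theorem properIntersection_comm (s : F.S) (Z W : F.PrimeDivisor) :
    properIntersection s Z W = properIntersection s W Z :=
  finsum_congr fun x => by rw [multiplicity_comm]

/-- Summing the local contributions: the intersection number over `s` of the curve `Z` with
the divisor of `u` is the sum of the orders of `u` at the valuations centered over `s`. -/
theorem finsum_ord_mul_properIntersection (s : F.S) (Z : F.PrimeDivisor)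
    {u : F.X.presheaf.stalk Z.pt} (hu : IsUnit u)
    {t : Set (ValuationSubring (F.X.residueField Z.pt))}
    (ht : ∀ V, V ∈ t ↔ V ≠ ⊤ ∧ ∃ x, F.π x = s ∧ IsCenter V x)
    (hπ : ∀ (V : ValuationSubring (F.X.residueField Z.pt)) (x y), F.π x = s → F.π y = s →
      IsCenter V x → IsCenter V y → x = y)
    {n : ℤ} (H : HasOrdSum t ((F.X.residue Z.pt).hom u) n) :
    ∑ᶠ W : F.PrimeDivisor, (ord (algebraMap _ F.X.functionField u) W.pt : ℚ) *
      properIntersection s W Z = n := by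
  have h1 := H.finsum_eq (ι := {x : F.X // F.π x = s}) (fun V x => IsCenter V x.1 ∧ V ≠ ⊤)
    (fun V => by
      rw [ht]
      exact ⟨fun ⟨h, x, hx, h'⟩ => ⟨⟨x, hx⟩, h', h⟩, fun ⟨x, h', h⟩ => ⟨h, x.1, x.2, h'⟩⟩)
    (fun V x y hx hy => Subtype.ext (hπ V x y x.2 y.2 hx.1 hy.1))
    (fun x => hasOrdSum_localDegree x.1 hu)
  have hB := finite_setOf_ord_pt_ne_zero (algebraMap _ F.X.functionField u)
  set f := algebraMap _ F.X.functionField u with hf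
  have hZ : ord f Z.pt = 0 := ord_algebraMap_of_isUnit hu
  have h2 : ∀ x, localDegree f Z x = ∑ W ∈ hB.toFinset, ord f W.pt * multiplicity W Z x := by
    intro x
    refine finsum_eq_sum_of_support_subset _ fun W hW => ?_
    simpa using left_ne_zero_of_mul hW
  simp only [h2] at h1
  have hsupp : ∀ W : F.PrimeDivisor, ord f W.pt ≠ 0 →
      (Function.support fun x : {x : F.X // F.π x = s} => multiplicity W Z x).Finite := by
    intro W hW
    have hne : W ≠ Z := by
      rintro rfl
      exact hW hZ
    exact (finite_support_multiplicity hne).preimage Subtype.val_injective.injOn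
  rw [finsum_sum_comm] at h1
  · rw [← h1, finsum_eq_sum_of_support_subset (s := hB.toFinset)]
    · push_cast
      refine Finset.sum_congr rfl fun W hW => ?_
      have hW' : ord f W.pt ≠ 0 := by simpa using hW
      have h3 := (Int.castAddHom ℚ).map_finsum
        (f := fun x : {x : F.X // F.π x = s} => ((multiplicity W Z x : ℕ) : ℤ))
        ((hsupp W hW').subset fun x hx => by simpa using hx)
      simp only [Int.coe_castAddHom, Int.cast_natCast] at h3
      rw [← mul_finsum, Int.cast_mul, h3]
      rfl
    · intro W hW
      have := left_ne_zero_of_mul hW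
      simpa using this
  · intro W hW
    refine (hsupp W (by simpa using hW)).subset fun x hx => ?_
    have := right_ne_zero_of_mul hx
    simpa using this

end SemistableSurface

/-! ### A local parameter of the base curve -/

namespace SemistableSurface

open IsLocalRing AlgebraicGeometry.Scheme ValuationSubring

variable {F : SemistableSurface}

instance isLocallyNoetherian_S : IsLocallyNoetherian F.S :=
  LocallyOfFiniteType.isLocallyNoetherian F.structureMap

instance compactSpace_S : CompactSpace F.S :=
  (quasiCompact_iff_compactSpace (f := F.structureMap)).1 inferInstance

theorem specializes_closedPoint_iff {s : F.S} (hs : IsClosed {s}) {y : F.S} :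
    y ⤳ s ↔ y = s ∨ y = genericPoint F.S := by
  constructor
  · intro h
    by_cases hne : y = s
    · exact Or.inl hne
    · have h1 := coheight_eq_of_isClosed F.structureMap 1 hs
      have h2 := coheight_lt_of_specializes h hne (h1 ▸ ENat.natCast_lt_top 1)
      rw [h1, Nat.cast_one, Order.lt_one_iff] at h2
      exact Or.inr (eq_genericPoint_of_coheight_eq_zero h2)
  · rintro (rfl | rfl)
    · exact specializes_rfl
    · exact (genericPoint_spec F.S).specializes (Set.mem_univ s)

theorem isClosed_or_eq_genericPoint (y : F.S) : IsClosed {y} ∨ y = genericPoint F.S := by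
  obtain ⟨s, hys, hs⟩ := exists_isClosed_specializes y
  rcases (specializes_closedPoint_iff hs).1 hys with rfl | h
  · exact Or.inl hs
  · exact Or.inr h

theorem coheight_genericPoint : Order.coheight (genericPoint F.S) = 0 :=
  Order.coheight_eq_zero.2 fun y _ => (genericPoint_spec F.S).specializes (Set.mem_univ y)

theorem ne_genericPoint {s : F.S} (hs : IsClosed {s}) : s ≠ genericPoint F.S := by
  rintro rfl
  have h1 := coheight_eq_of_isClosed F.structureMap 1 hs
  rw [coheight_genericPoint] at h1
  exact absurd h1 (by norm_num)

/-- The local ring at a prime divisor is a discrete valuation ring, as a localization of the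
factorial local ring at a closed point. -/
theorem PrimeDivisor.exists_maximalIdeal_eq_span (Z : F.PrimeDivisor) :
    ∃ ϖ, maximalIdeal (F.X.presheaf.stalk Z.pt) = Ideal.span {ϖ} := by
  obtain ⟨x, h, hx⟩ := exists_isClosed_specializes Z.pt
  obtain ⟨p, -, hp⟩ := Z.exists_primeAt_eq_span hx h
  let _ := (F.X.presheaf.stalkSpecializes h).hom.toAlgebra
  have := isLocalization_stalkSpecializes h
  refine ⟨(F.X.presheaf.stalkSpecializes h).hom p, ?_⟩
  rw [← IsLocalization.AtPrime.map_eq_maximalIdeal (primeAt h) (F.X.presheaf.stalk Z.pt), hp,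
    Ideal.map_span, Set.image_singleton]
  rfl

/-- The pullback of functions at `s` to a point of `X` whose image specializes to `s`. -/
def pullbackAt {s : F.S} {z : F.X} (h : F.π z ⤳ s) : F.S.presheaf.stalk s ⟶ F.X.presheaf.stalk z :=
  F.S.presheaf.stalkSpecializes h ≫ F.π.stalkMap z

theorem pullbackAt_comp_stalkSpecializes {s : F.S} {z x : F.X} (h : z ⤳ x) (hx : F.π x ⤳ s)
    (hz : F.π z ⤳ s) : pullbackAt hx ≫ F.X.presheaf.stalkSpecializes h = pullbackAt hz := by
  have h1 := Scheme.Hom.stalkSpecializes_stalkMap F.π z x h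
  rw [pullbackAt, Category.assoc, ← h1, pullbackAt, ← Category.assoc,
    TopCat.Presheaf.stalkSpecializes_comp]

theorem stalkMap_injective (z : F.X) : Function.Injective (F.π.stalkMap z).hom := by
  let _ := (F.π.stalkMap z).hom.toAlgebra
  have h2 : Module.Flat (F.S.presheaf.stalk (F.π z)) (F.X.presheaf.stalk z) :=
    Flat.stalkMap F.π z
  have h3 : IsLocalHom (algebraMap (F.S.presheaf.stalk (F.π z)) (F.X.presheaf.stalk z)) :=
    inferInstanceAs (IsLocalHom (F.π.stalkMap z).hom)
  have := Module.FaithfullyFlat.of_flat_of_isLocalHom (A := F.S.presheaf.stalk (F.π z))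
    (B := F.X.presheaf.stalk z)
  exact FaithfulSMul.algebraMap_injective (F.S.presheaf.stalk (F.π z)) (F.X.presheaf.stalk z)

theorem pullbackAt_injective {s : F.S} {z : F.X} (h : F.π z ⤳ s) :
    Function.Injective (pullbackAt h).hom :=
  (stalkMap_injective z).comp (stalkSpecializes_injective h)

theorem pullbackAt_comp_constants {s : F.S} {z : F.X} (h : F.π z ⤳ s) :
    (pullbackAt h).hom.comp (constants F.structureMap s) =
      constants (F.π ≫ F.structureMap) z := by
  rw [pullbackAt, CommRingCat.hom_comp, RingHom.comp_assoc, stalkSpecializes_comp_constants,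
    stalkMap_comp_constants]

/-- A flat morphism is dominant. -/
theorem map_genericPoint : F.π (genericPoint F.X) = genericPoint F.S := by
  refine (isClosed_or_eq_genericPoint _).resolve_left fun hs => ?_
  obtain ⟨t, ht⟩ := exists_maximalIdeal_stalk_eq_span F.structureMap hs
  have htm : t ∈ maximalIdeal (F.S.presheaf.stalk (F.π (genericPoint F.X))) :=
    ht ▸ Ideal.mem_span_singleton_self t
  have h1 : ¬ IsUnit ((F.π.stalkMap (genericPoint F.X)).hom t) := fun h =>
    htm (isUnit_of_map_unit (F.π.stalkMap (genericPoint F.X)).hom t h)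
  have h2 : (F.π.stalkMap (genericPoint F.X)).hom t = 0 := by
    by_contra h
    exact h1 (IsUnit.mk0 (G₀ := F.X.functionField) _ h)
  have h3 : t = 0 := stalkMap_injective _ (h2.trans (map_zero _).symm)
  have h4 : ringKrullDim (F.S.presheaf.stalk (F.π (genericPoint F.X))) = 0 :=
    ringKrullDim_eq_zero_of_isField (IsLocalRing.isField_iff_maximalIdeal_eq.2 (by
      rw [ht, h3]; simp))
  rw [ringKrullDim_stalk_eq_coheight, coheight_eq_of_isClosed F.structureMap 1 hs] at h4
  exact absurd h4 (by norm_num)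

/-- The rational function on `X` given by a function at the point `s` of the base curve. -/
def pullbackFunction {s : F.S} (t : F.S.presheaf.stalk s) : F.X.functionField :=
  (pullbackAt (z := genericPoint F.X) (map_genericPoint (F := F) ▸
    (genericPoint_spec F.S).specializes (Set.mem_univ s))).hom t

theorem algebraMap_pullbackAt {s : F.S} {z : F.X} (h : F.π z ⤳ s) (t : F.S.presheaf.stalk s) :
    algebraMap _ F.X.functionField ((pullbackAt h).hom t) = pullbackFunction t := by
  have h1 := pullbackAt_comp_stalkSpecializes (F := F)
    ((genericPoint_spec F.X).specializes (Set.mem_univ z)) h (map_genericPoint (F := F) ▸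
      (genericPoint_spec F.S).specializes (Set.mem_univ s))
  exact congrArg (fun g => g.hom t) h1

theorem primeAt_eq_bot {s y : F.S} (h : y ⤳ s) (hy : y = genericPoint F.S) : primeAt h = ⊥ := by
  rw [← Ideal.height_eq_zero_iff_eq_bot, height_primeAt, hy, coheight_genericPoint]

theorem isUnit_pullbackAt {s : F.S} {z : F.X} (h : F.π z ⤳ s) (hz : F.π z = genericPoint F.S)
    {a : F.S.presheaf.stalk s} (ha : a ≠ 0) : IsUnit ((pullbackAt h).hom a) := by
  rw [pullbackAt, CommRingCat.hom_comp, RingHom.comp_apply]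
  refine RingHom.isUnit_map _ (not_not.1 fun hu => ha ?_)
  have h2 : a ∈ primeAt h := mem_primeAt.2 hu
  rwa [primeAt_eq_bot h hz] at h2

section Parameter

variable {s : F.S} (hs : IsClosed {s}) {t : F.S.presheaf.stalk s}
  (ht : maximalIdeal (F.S.presheaf.stalk s) = Ideal.span {t})

include hs ht

theorem isDiscreteValuationRing_stalk_S :
    IsDiscreteValuationRing (F.S.presheaf.stalk s) ∧ Irreducible t :=
  isDiscreteValuationRing_stalk (coheight_eq_of_isClosed F.structureMap 1 hs) ht

omit hs in
theorem map_maximalIdeal_eq_span {x : F.X} (h : F.π x = s) :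
    (maximalIdeal (F.S.presheaf.stalk (F.π x))).map (F.π.stalkMap x).hom =
      Ideal.span {(pullbackAt (specializes_of_eq h)).hom t} := by
  subst h
  have h1 : pullbackAt (specializes_of_eq (rfl : F.π x = F.π x)) = F.π.stalkMap x := by
    rw [pullbackAt, TopCat.Presheaf.stalkSpecializes_refl, Category.id_comp]
  rw [ht, Ideal.map_span, Set.image_singleton, h1]

/-- As the fibres are reduced, a local parameter of the base curve is a local parameter along each
component of the fibre. -/
theorem maximalIdeal_stalk_eq_span_pullbackAt (W : F.PrimeDivisor) (h : F.π W.pt = s) :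
    maximalIdeal (F.X.presheaf.stalk W.pt) =
      Ideal.span {(pullbackAt (specializes_of_eq h)).hom t} := by
  set b := (pullbackAt (specializes_of_eq h)).hom t with hb
  have hb0 : b ≠ 0 := by
    rw [hb, Ne, map_eq_zero_iff _ (pullbackAt_injective _)]
    exact (isDiscreteValuationRing_stalk_S hs ht).2.ne_zero
  have hI := map_maximalIdeal_eq_span ht h
  have hred : (Ideal.span {b}).IsRadical := by
    rw [← hI]
    exact (Ideal.isRadical_iff_quotient_reduced _).2 (F.reduced_fibers W.pt)
  have hle : Ideal.span {b} ≤ maximalIdeal (F.X.presheaf.stalk W.pt) := by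
    rw [← hI]
    exact ((IsLocalRing.local_hom_TFAE (F.π.stalkMap W.pt).hom).out 0 2).1
      (inferInstance : IsLocalHom (F.π.stalkMap W.pt).hom)
  obtain ⟨ϖ, hϖ⟩ := W.exists_maximalIdeal_eq_span
  obtain ⟨h1, h2⟩ := isDiscreteValuationRing_stalk W.coheight_pt hϖ
  obtain ⟨n, hn⟩ := IsDiscreteValuationRing.associated_pow_irreducible hb0 h2
  refine le_antisymm ?_ hle
  rw [hϖ, Ideal.span_singleton_le_iff_mem]
  exact hred ⟨n, Ideal.mem_span_singleton.2 hn.dvd⟩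

theorem ord_pullbackFunction_of_map_eq (W : F.PrimeDivisor) (h : F.π W.pt = s) :
    ord (pullbackFunction t) W.pt = 1 := by
  rw [← algebraMap_pullbackAt (specializes_of_eq h)]
  exact ord_algebraMap_of_maximalIdeal_eq W.coheight_pt
    (maximalIdeal_stalk_eq_span_pullbackAt hs ht W h)

theorem ord_pullbackFunction_of_isHorizontal (W : F.PrimeDivisor) (h : W.IsHorizontal) :
    ord (pullbackFunction t) W.pt = 0 := by
  have h1 : F.π W.pt ⤳ s := (specializes_closedPoint_iff hs).2 (Or.inr h)
  rw [← algebraMap_pullbackAt h1]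
  exact ord_algebraMap_of_isUnit (isUnit_pullbackAt h1 h
    (isDiscreteValuationRing_stalk_S hs ht).2.ne_zero)

end Parameter

theorem properIntersection_eq_zero {s : F.S} (hs : IsClosed {s}) {Z W : F.PrimeDivisor}
    (hZ : F.π Z.pt ≠ s) (hZ' : ¬ Z.IsHorizontal) : properIntersection s Z W = 0 := by
  unfold properIntersection
  rw [← finsum_zero (α := {x : F.X // F.π x = s})]
  refine finsum_congr fun x => ?_
  rw [multiplicity_eq_zero_left, Nat.cast_zero]
  intro h
  have h1 : F.π Z.pt ⤳ s := x.2 ▸ h.map F.π.continuous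
  exact ((specializes_closedPoint_iff hs).1 h1).elim hZ hZ'

end SemistableSurface

/-! ### Degrees of principal divisors on curves -/

/-- A field extension `K / L` of finitely generated fields over `k` is finite if `K` is finite over
the field generated by one element that comes from `L`. -/
theorem finiteDimensional_of_adjoin_algebraMap {k L K : Type*} [Field k] [Field L] [Field K]
    [Algebra k L] [Algebra k K] [Algebra L K] [IsScalarTower k L K] (t : L)
    (h : FiniteDimensional (IntermediateField.adjoin k {algebraMap L K t}) K) :
    FiniteDimensional L K := by
  let R := (IsScalarTower.toAlgHom k L K).fieldRange
  have hle : IntermediateField.adjoin k {algebraMap L K t} ≤ R := by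
    rw [IntermediateField.adjoin_le_iff, Set.singleton_subset_iff]
    exact ⟨t, rfl⟩
  let _ := (IntermediateField.inclusion hle).toRingHom.toAlgebra
  have : IsScalarTower (IntermediateField.adjoin k {algebraMap L K t}) R K :=
    IsScalarTower.of_algebraMap_eq fun _ => rfl
  have : FiniteDimensional R K := Module.Finite.of_restrictScalars_finite
    (IntermediateField.adjoin k {algebraMap L K t}) R K
  let e : L ≃ₐ[k] R := AlgEquiv.ofInjectiveField _
  exact Module.Finite.of_equiv_equiv e.symm.toRingEquiv (RingEquiv.refl K)
    (RingHom.ext fun r => by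
      obtain ⟨l, rfl⟩ := e.surjective r
      change algebraMap L K (e.symm (e l)) = _
      rw [e.symm_apply_apply]
      rfl)

namespace AlgebraicGeometry.Scheme

universe u

theorem IsCenter.dominatedBy {X Y : Scheme.{u}} (f : X ⟶ Y) {z x : X}
    {V : ValuationSubring (X.residueField z)} (hV : IsCenter V x) :
    ∃ h : f z ⤳ f x,
      DominatedBy (Y.presheaf.stalkSpecializes h ≫ f.stalkMap z ≫ X.residue z) V := by
  obtain ⟨h, φ, hφ, hloc⟩ := hV
  refine ⟨h.map f.continuous, f.stalkMap x ≫ φ, ?_, ?_⟩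
  · rw [Category.assoc, hφ, evalAt, ← Category.assoc, ← Category.assoc,
      ← Scheme.Hom.stalkSpecializes_stalkMap f z x h]
  · rw [CommRingCat.hom_comp]
    exact RingHom.isLocalHom_comp _ _

end AlgebraicGeometry.Scheme

namespace SemistableSurface

open IsLocalRing AlgebraicGeometry.Scheme ValuationSubring

variable {F : SemistableSurface}

/-- The constants in the residue field of a point of `X`. -/
def constantsResidue (z : F.X) : ℂ →+* F.X.residueField z :=
  (F.X.residue z).hom.comp (constants (F.π ≫ F.structureMap) z)

theorem evalAt_constants {z x : F.X} (h : z ⤳ x) (c : ℂ) :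
    (evalAt h).hom (constants (F.π ≫ F.structureMap) x c) = constantsResidue z c := by
  rw [constantsResidue, ← stalkSpecializes_comp_constants _ h]
  rfl

theorem essFiniteType_constantsResidue (z : F.X) : (constantsResidue z).EssFiniteType :=
  (essFiniteType_constants (F.π ≫ F.structureMap) 2 z).comp
    (RingHom.FiniteType.of_surjective _ IsLocalRing.residue_surjective).essFiniteType

/-- The function field of a prime divisor on a surface has transcendence degree at most one. -/
theorem trdeg_residueField_le (Z : F.PrimeDivisor) :
    let _ := (constantsResidue Z.pt).toAlgebra
    Algebra.trdeg ℂ (F.X.residueField Z.pt) ≤ 1 := by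
  intro _
  obtain ⟨x, h, hx⟩ := exists_isClosed_specializes Z.pt
  have := dimensionLEOne_quotient_primeAt h
  let _ := (evalQuotient h).toAlgebra
  have := isFractionRing_evalQuotient h
  let _ := (constantsQuotient h).toAlgebra
  have : Algebra.EssFiniteType ℂ (F.X.presheaf.stalk x ⧸ primeAt h) :=
    essFiniteType_constantsQuotient h
  have : IsScalarTower ℂ (F.X.presheaf.stalk x ⧸ primeAt h) (F.X.residueField Z.pt) :=
    IsScalarTower.of_algebraMap_eq fun c => (evalAt_constants h c).symm
  have h1 := trdeg_le_of_ringKrullDim_le (n := 1) ℂ (O := F.X.presheaf.stalk x ⧸ primeAt h)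
    (K := F.X.residueField Z.pt) (constantsQuotient_residue_surjective h hx)
    (Ring.krullDimLE_iff.1 inferInstance)
  simpa using h1

theorem finiteDimensional_adjoin (Z : F.PrimeDivisor) {h : F.X.residueField Z.pt} :
    let _ := (constantsResidue Z.pt).toAlgebra
    Transcendental ℂ h →
      FiniteDimensional (IntermediateField.adjoin ℂ {h}) (F.X.residueField Z.pt) := by
  intro _ hh
  have : Algebra.EssFiniteType ℂ (F.X.residueField Z.pt) := essFiniteType_constantsResidue Z.pt
  exact finiteDimensional_of_transcendental ℂ (trdeg_residueField_le Z) hh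

/-- A valuation of the function field of a curve has at most one center over a given point. -/
theorem eq_of_isCenter {z : F.X} {V : ValuationSubring (F.X.residueField z)} {x y : F.X}
    (hxy : F.π x = F.π y) (hx : IsCenter V x) (hy : IsCenter V y) : x = y := by
  obtain ⟨h, hV⟩ := hx.dominatedBy F.π
  exact IsCenter.unique F.π h hV hx hy rfl hxy.symm

section Vertical

variable {s : F.S} (hs : IsClosed {s})

include hs

/-- Since the residue field of `s` is `ℂ`, the nontrivial valuations of the function field of `C`
that are trivial on the constants dominate the local ring at `s`, so that they have a center over
`s` by properness. -/
theorem mem_nontrivialOver_constants_iff {C : F.PrimeDivisor} (hC : F.π C.pt = s)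
    (V : ValuationSubring (F.X.residueField C.pt)) :
    let _ := (constantsResidue C.pt).toAlgebra
    V ∈ nontrivialOver ℂ (F.X.residueField C.pt) ↔ V ≠ ⊤ ∧ ∃ x, F.π x = s ∧ IsCenter V x := by
  intro _
  constructor
  · rintro ⟨hV, hne⟩
    refine ⟨hne, exists_isCenter F.π (specializes_of_eq hC) V ((dominatedBy_iff _ V).2 ?_)⟩
    obtain ⟨t, ht⟩ := exists_maximalIdeal_stalk_eq_span F.structureMap hs
    set g := F.S.presheaf.stalkSpecializes (specializes_of_eq hC) ≫ F.π.stalkMap C.pt ≫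
      F.X.residue C.pt with hg
    have hg' : ∀ a, g.hom a = (F.X.residue C.pt).hom ((pullbackAt (specializes_of_eq hC)).hom a) :=
      fun a => rfl
    have h0 : ∀ a, ¬ IsUnit a → g.hom a = 0 := by
      intro a ha
      have ha : a ∈ maximalIdeal (F.S.presheaf.stalk s) := ha
      rw [ht, Ideal.mem_span_singleton] at ha
      obtain ⟨b, rfl⟩ := ha
      rw [hg', map_mul]
      refine (IsLocalRing.residue_eq_zero_iff (R := F.X.presheaf.stalk C.pt) _).2 ?_
      rw [maximalIdeal_stalk_eq_span_pullbackAt hs ht C hC]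
      exact Ideal.mul_mem_right _ _ (Ideal.mem_span_singleton_self _)
    refine ⟨fun a => ?_, fun a ha => ?_⟩
    · obtain ⟨c, hc⟩ := (smooth_stalk F.structureMap 1 hs).2.2
        (IsLocalRing.residue (F.S.presheaf.stalk s) a)
      have h1 : ¬ IsUnit (constants F.structureMap s c - a) := by
        rw [← _root_.mem_nonunits_iff, ← IsLocalRing.mem_maximalIdeal,
          ← IsLocalRing.residue_eq_zero_iff,
          map_sub, sub_eq_zero]
        exact hc
      have h2 := h0 _ h1
      rw [map_sub, sub_eq_zero] at h2
      rw [← h2, hg']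
      have h3 := hV c
      have h4 := congrArg (fun φ => φ c) (pullbackAt_comp_constants (specializes_of_eq hC))
      simp only [RingHom.comp_apply] at h4
      rw [h4]
      exact h3
    · by_contra hu
      rw [h0 a hu, map_zero] at ha
      exact zero_ne_one ha
  · rintro ⟨hne, x, -, h, hV⟩
    refine ⟨fun c => ?_, hne⟩
    have h1 := ((dominatedBy_iff _ V).1 hV).1 (constants (F.π ≫ F.structureMap) x c)
    rw [evalAt_constants] at h1
    exact h1

/-- A component of a fibre is a complete curve, so that a principal divisor has degree zero
on it. -/
theorem finsum_ord_mul_properIntersection_eq_zero {C : F.PrimeDivisor} (hC : F.π C.pt = s)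
    {u : F.X.presheaf.stalk C.pt} (hu : IsUnit u) :
    ∑ᶠ W : F.PrimeDivisor, (ord (algebraMap _ F.X.functionField u) W.pt : ℚ) *
      properIntersection s W C = 0 := by
  let _ := (constantsResidue C.pt).toAlgebra
  have h1 := finsum_ord_mul_properIntersection s C hu (n := 0)
    (t := nontrivialOver ℂ (F.X.residueField C.pt)) (mem_nontrivialOver_constants_iff hs hC)
    (fun V x y hx hy => eq_of_isCenter (hx.trans hy.symm))
    (hasOrdSum_zero (fun h hh => finiteDimensional_adjoin C hh)
      (IsUnit.map (F.X.residue C.pt).hom hu).ne_zero)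
  simpa using h1

end Vertical

section Horizontal

variable {s : F.S} (Z : F.PrimeDivisor) (h : F.π Z.pt ⤳ s)

/-- The restriction to the curve `Z` of functions at the point `s` of the base curve. -/
def restrictAt : F.S.presheaf.stalk s →+* F.X.residueField Z.pt :=
  (F.X.residue Z.pt).hom.comp (pullbackAt h).hom

theorem restrictAt_constants (c : ℂ) :
    restrictAt Z h (constants F.structureMap s c) = constantsResidue Z.pt c := by
  rw [constantsResidue, ← pullbackAt_comp_constants h]
  rfl

variable {Z} (hZ : Z.IsHorizontal)

include hZ

theorem restrictAt_injective : Function.Injective (restrictAt Z h) := by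
  rw [injective_iff_map_eq_zero]
  intro a ha
  by_contra h0
  exact ((isUnit_pullbackAt h hZ h0).map (F.X.residue Z.pt).hom).ne_zero ha

theorem transcendental_restrictAt {t : F.S.presheaf.stalk s} (ht : Irreducible t) :
    let _ := (constantsResidue Z.pt).toAlgebra
    Transcendental ℂ (restrictAt Z h t) := by
  intro _ halg
  have h1 : IsIntegral ℂ (restrictAt Z h t) := halg.isIntegral
  obtain ⟨c, hc⟩ := minpoly.mem_range_of_degree_eq_one ℂ _
    (IsAlgClosed.degree_eq_one_of_irreducible ℂ (minpoly.irreducible h1))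
  have h2 : constantsResidue Z.pt c = restrictAt Z h t := hc
  rw [← restrictAt_constants Z h c] at h2
  have h3 := restrictAt_injective h hZ h2
  by_cases hc0 : c = 0
  · rw [hc0, map_zero] at h3
    exact ht.ne_zero h3.symm
  · exact ht.not_isUnit (h3 ▸ (IsUnit.mk0 c hc0).map _)

theorem isFractionRing_evalAt : let _ := (evalAt h).hom.toAlgebra
    IsFractionRing (F.S.presheaf.stalk s) (F.S.residueField (F.π Z.pt)) := by
  intro _
  have : FaithfulSMul (F.S.presheaf.stalk s) (F.S.residueField (F.π Z.pt)) := by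
    rw [faithfulSMul_iff_algebraMap_injective]
    refine (RingHom.injective_iff_ker_eq_bot _).2 ?_
    exact (ker_evalAt h).trans (primeAt_eq_bot h hZ)
  refine IsFractionRing.of_field _ _ fun a => ?_
  obtain ⟨b, c, -, hbc⟩ := exists_evalAt_div_eq h a
  exact ⟨b, c, hbc⟩

theorem finiteDimensional_residueFieldMap (hs : IsClosed {s}) :
    let _ := (F.π.residueFieldMap Z.pt).hom.toAlgebra
    FiniteDimensional (F.S.residueField (F.π Z.pt)) (F.X.residueField Z.pt) := by
  intro _
  have h : F.π Z.pt ⤳ s := (specializes_closedPoint_iff hs).2 (Or.inr hZ)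
  obtain ⟨t, ht⟩ := exists_maximalIdeal_stalk_eq_span F.structureMap hs
  let _ := (constantsResidue Z.pt).toAlgebra
  let _ := ((F.S.residue (F.π Z.pt)).hom.comp (constants F.structureMap (F.π Z.pt))).toAlgebra
  have hres := residue_residueFieldMap F.π Z.pt
  have : IsScalarTower ℂ (F.S.residueField (F.π Z.pt)) (F.X.residueField Z.pt) := by
    refine IsScalarTower.of_algebraMap_eq' ?_
    change constantsResidue Z.pt = (F.π.residueFieldMap Z.pt).hom.comp
      ((F.S.residue (F.π Z.pt)).hom.comp (constants F.structureMap (F.π Z.pt)))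
    rw [← RingHom.comp_assoc, ← CommRingCat.hom_comp, hres, CommRingCat.hom_comp,
      RingHom.comp_assoc, stalkMap_comp_constants]
    rfl
  refine finiteDimensional_of_adjoin_algebraMap (k := ℂ) ((evalAt h).hom t) ?_
  have h1 : algebraMap (F.S.residueField (F.π Z.pt)) (F.X.residueField Z.pt) ((evalAt h).hom t) =
      restrictAt Z h t :=
    congrArg (fun g => g.hom ((F.S.presheaf.stalkSpecializes h).hom t)) hres
  rw [h1]
  exact finiteDimensional_adjoin Z
    (transcendental_restrictAt h hZ (isDiscreteValuationRing_stalk_S hs ht).2)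

/-- A horizontal curve meets the fibre with total multiplicity its degree over the base. -/
theorem finsum_ord_mul_properIntersection_eq_residueDegree (hs : IsClosed {s})
    {t : F.S.presheaf.stalk s} (ht : maximalIdeal (F.S.presheaf.stalk s) = Ideal.span {t}) :
    ∑ᶠ W : F.PrimeDivisor, (ord (pullbackFunction (F := F) t) W.pt : ℚ) *
      properIntersection s W Z = F.π.residueDegree Z.pt := by
  have h : F.π Z.pt ⤳ s := (specializes_closedPoint_iff hs).2 (Or.inr hZ)
  obtain ⟨_, hirr⟩ := isDiscreteValuationRing_stalk_S hs ht
  let _ := (F.π.residueFieldMap Z.pt).hom.toAlgebra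
  have hfin := finiteDimensional_residueFieldMap hZ hs
  let _ := (evalAt h).hom.toAlgebra
  have := isFractionRing_evalAt h hZ
  let _ := (restrictAt Z h).toAlgebra
  have hres := residue_residueFieldMap F.π Z.pt
  have : IsScalarTower (F.S.presheaf.stalk s) (F.S.residueField (F.π Z.pt))
      (F.X.residueField Z.pt) := IsScalarTower.of_algebraMap_eq fun a =>
    (congrArg (fun g => g.hom ((F.S.presheaf.stalkSpecializes h).hom a)) hres).symm
  let _ := (constants F.structureMap s).toAlgebra
  have : CharZero (F.S.residueField (F.π Z.pt)) :=
    charZero_of_injective_ringHom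
      ((F.S.residue (F.π Z.pt)).hom.comp (constants F.structureMap (F.π Z.pt))).injective
  have h1 := hasOrdSum_uniformizer (O := F.S.presheaf.stalk s) (K := F.X.residueField Z.pt) ℂ
    (smooth_stalk F.structureMap 1 hs).2.2 (F.S.residueField (F.π Z.pt)) hirr
  rw [← algebraMap_pullbackAt h]
  refine finsum_ord_mul_properIntersection s Z (isUnit_pullbackAt h hZ hirr.ne_zero)
    (t := nontrivialOver (F.S.presheaf.stalk s) (F.X.residueField Z.pt)) ?_
    (fun V x y hx hy => eq_of_isCenter (hx.trans hy.symm)) h1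
  have : Algebra.IsAlgebraic (F.S.presheaf.stalk s) (F.X.residueField Z.pt) := by
    have : Algebra.IsAlgebraic (F.S.presheaf.stalk s) (F.S.residueField (F.π Z.pt)) :=
      IsLocalization.isAlgebraic _ (nonZeroDivisors (F.S.presheaf.stalk s))
    exact Algebra.IsAlgebraic.trans _ (F.S.residueField (F.π Z.pt)) _
  intro V
  constructor
  · intro hV
    exact ⟨hV.2, exists_isCenter F.π h V ((dominatedBy_iff _ V).2 ⟨fun a => hV.1 a,
      fun a ha => isUnit_of_mem_nontrivialOver hV ha⟩)⟩
  · rintro ⟨hne, x, rfl, hV⟩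
    obtain ⟨h', hV'⟩ := hV.dominatedBy F.π
    exact ⟨fun a => ((dominatedBy_iff _ V).1 hV').1 a, hne⟩

end Horizontal

end SemistableSurface

/-! ### Components of a fibre through a point -/

namespace SemistableSurface

open IsLocalRing AlgebraicGeometry.Scheme

variable {F : SemistableSurface}

section FiberIdeal

variable {s : F.S} (hs : IsClosed {s}) {t : F.S.presheaf.stalk s}
  (ht : maximalIdeal (F.S.presheaf.stalk s) = Ideal.span {t}) {w x : F.X} (hx : F.π x = s)

include hs ht

theorem pullbackAt_parameter_ne_zero {z : F.X} (h : F.π z ⤳ s) : (pullbackAt h).hom t ≠ 0 := by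
  rw [Ne, map_eq_zero_iff _ (pullbackAt_injective _)]
  exact (isDiscreteValuationRing_stalk_S hs ht).2.ne_zero

/-- The components of the fibre through `x` correspond to the minimal primes over a local
parameter of the base curve in the local ring at `x`. -/
theorem primeAt_mem_minimalPrimes_iff (h : w ⤳ x) :
    primeAt h ∈ (Ideal.span {(pullbackAt (specializes_of_eq hx)).hom t}).minimalPrimes ↔
      Order.coheight w = 1 ∧ F.π w = s := by
  set b := (pullbackAt (specializes_of_eq hx)).hom t with hb
  have hb0 : b ≠ 0 := pullbackAt_parameter_ne_zero hs ht _
  have hw : F.π w ⤳ s := hx ▸ h.map F.π.continuous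
  have hbw : (F.X.presheaf.stalkSpecializes h).hom b = (pullbackAt hw).hom t :=
    congrArg (fun g => g.hom t) (pullbackAt_comp_stalkSpecializes h (specializes_of_eq hx) hw)
  have hmem : b ∈ primeAt h ↔ ¬ IsUnit ((pullbackAt hw).hom t) := by rw [mem_primeAt, hbw]
  constructor
  · intro hmin
    have h1 : b ∈ primeAt h := hmin.1.2 (Ideal.mem_span_singleton_self b)
    constructor
    · rw [← height_primeAt h]
      refine le_antisymm (Ideal.height_le_one_of_isPrincipal_of_mem_minimalPrimes _ _ hmin) ?_
      rw [Order.one_le_iff_ne_zero, Ne, Ideal.height_eq_zero_iff_eq_bot]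
      intro h0
      rw [h0] at h1
      exact hb0 h1
    · refine ((specializes_closedPoint_iff hs).1 hw).resolve_right fun hgen => ?_
      exact hmem.1 h1 (isUnit_pullbackAt hw hgen (isDiscreteValuationRing_stalk_S hs ht).2.ne_zero)
  · rintro ⟨h1, h2⟩
    have hbm : b ∈ primeAt h := by
      rw [hmem]
      have h3 := maximalIdeal_stalk_eq_span_pullbackAt hs ht ⟨w, h1⟩ h2
      intro hu
      have h4 : (pullbackAt hw).hom t ∈ maximalIdeal (F.X.presheaf.stalk w) := by
        exact h3.ge (Ideal.mem_span_singleton_self _)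
      exact h4 hu
    refine ⟨⟨inferInstance, (Ideal.span_singleton_le_iff_mem _).2 hbm⟩, fun q hq hle => ?_⟩
    by_contra hne
    have : q.IsPrime := hq.1
    have h3 := Ideal.height_strict_mono_of_isPrime (lt_of_le_not_ge hle hne)
    rw [height_primeAt, h1, Order.lt_one_iff, Ideal.height_eq_zero_iff_eq_bot] at h3
    have h4 : b ∈ q := hq.2 (Ideal.mem_span_singleton_self b)
    rw [h3] at h4
    exact hb0 h4

theorem exists_eq_primeAt_of_mem_minimalPrimes {p : Ideal (F.X.presheaf.stalk x)}
    (hp : p ∈ (Ideal.span {(pullbackAt (specializes_of_eq hx)).hom t}).minimalPrimes) :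
    ∃ (C : F.PrimeDivisor) (h : C.pt ⤳ x), F.π C.pt = s ∧ primeAt h = p := by
  have : p.IsPrime := hp.1.1
  obtain ⟨w, h, rfl⟩ := exists_primeAt_eq p
  obtain ⟨h1, h2⟩ := (primeAt_mem_minimalPrimes_iff hs ht hx h).1 hp
  exact ⟨⟨w, h1⟩, h, h2, rfl⟩

omit hs in
theorem parameter_mem_maximalIdeal :
    (pullbackAt (specializes_of_eq hx)).hom t ∈ maximalIdeal (F.X.presheaf.stalk x) := by
  have h1 := ((IsLocalRing.local_hom_TFAE (F.π.stalkMap x).hom).out 0 2).1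
    (inferInstance : IsLocalHom (F.π.stalkMap x).hom)
  rw [map_maximalIdeal_eq_span ht hx, Ideal.span_singleton_le_iff_mem] at h1
  exact h1

end FiberIdeal

/-- Every point of a fibre lies on one of its components. -/
theorem exists_specializes_of_map_eq {s : F.S} (hs : IsClosed {s}) {x : F.X} (hx : F.π x = s) :
    ∃ C : F.PrimeDivisor, F.π C.pt = s ∧ C.pt ⤳ x := by
  obtain ⟨t, ht⟩ := exists_maximalIdeal_stalk_eq_span F.structureMap hs
  obtain ⟨p, hp, -⟩ := Ideal.exists_minimalPrimes_le
    ((Ideal.span_singleton_le_iff_mem _).2 (parameter_mem_maximalIdeal ht hx))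
  obtain ⟨C, h, hC, -⟩ := exists_eq_primeAt_of_mem_minimalPrimes hs ht hx hp
  exact ⟨C, hC, h⟩

/-- Two components of a fibre meet transversally, at ordinary double points, through which there
is no further component. -/
theorem multiplicity_eq_one {s : F.S} (hs : IsClosed {s}) {C C' : F.PrimeDivisor} (hne : C ≠ C')
    (hC : F.π C.pt = s) (hC' : F.π C'.pt = s) {x : F.X} (hx : C.pt ⤳ x) (hx' : C'.pt ⤳ x) :
    multiplicity C C' x = 1 ∧ F.π x = s ∧ IsOrdinaryDoublePoint (fiberLocalRing F.π x) ∧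
      ∀ B : F.PrimeDivisor, F.π B.pt = s → B.pt ⤳ x → B = C ∨ B = C' := by
  have hxs : F.π x = s := by
    have h1 : s ⤳ F.π x := hC ▸ hx.map F.π.continuous
    exact h1.mem_closed hs rfl
  obtain ⟨t, ht⟩ := exists_maximalIdeal_stalk_eq_span F.structureMap hs
  have hcl : IsClosed {x} := isClosed_of_specializes hx fun h =>
    hne (PrimeDivisor.eq_of_specializes (h ▸ hx')).symm
  have hI := map_maximalIdeal_eq_span ht hxs
  set b := (pullbackAt (specializes_of_eq hxs)).hom t with hb
  set I := (maximalIdeal (F.S.presheaf.stalk (F.π x))).map (F.π.stalkMap x).hom with hIdef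
  have hred : IsReduced (F.X.presheaf.stalk x ⧸ I) := F.reduced_fibers x
  have hbm := parameter_mem_maximalIdeal ht hxs
  have hntop : I ≠ ⊤ := by
    rw [hI]
    intro h1
    exact hbm (Ideal.span_singleton_eq_top.1 h1)
  have : Nontrivial (F.X.presheaf.stalk x ⧸ I) := Ideal.Quotient.nontrivial_iff.2 hntop
  have : IsLocalRing (F.X.presheaf.stalk x ⧸ I) :=
    IsLocalRing.of_surjective' _ Ideal.Quotient.mk_surjective
  have key : ∀ {B : F.PrimeDivisor} (h : B.pt ⤳ x), F.π B.pt = s →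
      ∃ p ∈ minimalPrimes (F.X.presheaf.stalk x ⧸ I),
        p.comap (Ideal.Quotient.mk I) = primeAt h := by
    intro B h hB
    have h1 := (primeAt_mem_minimalPrimes_iff hs ht hxs h).2 ⟨B.coheight_pt, hB⟩
    rw [← hb, ← hI, Ideal.minimalPrimes_eq_comap] at h1
    exact h1
  obtain ⟨p, hp, hpC⟩ := key hx hC
  obtain ⟨q, hq, hqC⟩ := key hx' hC'
  have hpq : p ≠ q := by
    rintro rfl
    exact hne (PrimeDivisor.ext (eq_of_primeAt_eq hx hx' (hpC.symm.trans hqC)))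
  -- The local ring of the fibre is not a domain, having two minimal primes, hence not regular.
  have hodp : IsOrdinaryDoublePoint (fiberLocalRing F.π x) := by
    refine (F.nodal_fibers x (by rw [hxs]; exact hs)).resolve_left fun hreg => ?_
    have h1 : IsDomain (F.X.presheaf.stalk x ⧸ I) := by
      refine IsRegularLocalRing.isDomain_of_ringKrullDim_le_one (R := fiberLocalRing F.π x) ?_
      have h2 := (ringKrullDim_quotient_succ_le_of_nonZeroDivisor (mem_nonZeroDivisors_of_ne_zero
        (pullbackAt_parameter_ne_zero hs ht (specializes_of_eq hxs)))).trans
        (ringKrullDim_stalk_le (F.π ≫ F.structureMap) 2 hcl)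
      rw [← hb, ← hI] at h2
      change ringKrullDim (F.X.presheaf.stalk x ⧸ I) ≤ 1
      generalize ringKrullDim (F.X.presheaf.stalk x ⧸ I) = d at h2 ⊢
      induction d using WithBot.recBotCoe with
      | bot => exact bot_le
      | coe d =>
        have h3 : d + 1 ≤ 1 + 1 := by
          rw [one_add_one_eq_two]
          exact WithBot.coe_le_coe.1 h2
        exact_mod_cast (ENat.add_le_add_iff_right ENat.one_ne_top).1 h3
    rw [IsDomain.minimalPrimes_eq_singleton_bot] at hp hq
    exact hpq (hp.trans hq.symm)
  obtain ⟨h1, h2⟩ := IsOrdinaryDoublePoint.sup_eq_maximalIdeal hodp hp hq hpq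
  refine ⟨?_, hxs, hodp, fun B hB hBx => ?_⟩
  · have h3 : primeAt hx ⊔ primeAt hx' = maximalIdeal (F.X.presheaf.stalk x) := by
      have hker : RingHom.ker (Ideal.Quotient.mk I) ≤ primeAt hx ⊔ primeAt hx' := by
        rw [← hpC]
        exact (Ideal.comap_mono bot_le).trans le_sup_left
      have h4 := Ideal.comap_map_of_surjective' (Ideal.Quotient.mk I)
        Ideal.Quotient.mk_surjective (primeAt hx ⊔ primeAt hx')
      rw [sup_eq_left.2 hker, ← hpC, ← hqC, Ideal.map_sup_comap_of_surjective _
        Ideal.Quotient.mk_surjective, h1, hpC, hqC] at h4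
      rw [← h4]
      exact IsLocalRing.eq_maximalIdeal
        (Ideal.comap_isMaximal_of_surjective _ Ideal.Quotient.mk_surjective)
    rw [multiplicity, PrimeDivisor.idealAt_eq hx, PrimeDivisor.idealAt_eq hx', h3,
      Module.length_eq_one_iff.2]
    · rfl
    · exact isSimpleModule_iff_isCoatom.2 (maximalIdeal.isMaximal _).out
  · obtain ⟨r, hr, hrB⟩ := key hBx hB
    rcases h2 r hr with rfl | rfl
    · exact Or.inl (PrimeDivisor.ext (eq_of_primeAt_eq hBx hx (hrB.symm.trans hpC)))
    · exact Or.inr (PrimeDivisor.ext (eq_of_primeAt_eq hBx hx' (hrB.symm.trans hqC)))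

end SemistableSurface

/-! ### The intersection matrix of a fibre -/

theorem finsum_subtype_eq_finsum {α M : Type*} [AddCommMonoid M] {p : α → Prop} {f : α → M}
    (h : ∀ a, ¬ p a → f a = 0) : ∑ᶠ a : {a // p a}, f a = ∑ᶠ a, f a := by
  classical
  rw [finsum_subtype_eq_finsum_cond]
  refine finsum_congr fun a => ?_
  by_cases ha : p a
  · exact finsum_eq_if.trans (if_pos ha)
  · rw [h a ha]
    exact finsum_zero

namespace SemistableSurface

open IsLocalRing AlgebraicGeometry.Scheme

variable {F : SemistableSurface}

theorem Component.ext_pt {s : F.S} {C C' : Component s} (h : C.1 = C'.1) : C = C' := Subtype.ext h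

/-- A prime divisor contained in the fibre over `s`, as a component of this fibre. -/
def PrimeDivisor.toComponent {s : F.S} (hs : IsClosed {s}) (W : F.PrimeDivisor)
    (h : F.π W.pt = s) : Component s :=
  ⟨W, h, fun y hy hyW => by
    by_contra hne
    have h1 := coheight_lt_of_specializes hyW hne (W.coheight_pt ▸ ENat.one_lt_top)
    rw [W.coheight_pt, Order.lt_one_iff] at h1
    rw [eq_genericPoint_of_coheight_eq_zero h1, map_genericPoint] at hy
    exact ne_genericPoint hs hy.symm⟩

theorem Component.not_isHorizontal {s : F.S} (hs : IsClosed {s}) (C : Component s) :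
    ¬ C.1.IsHorizontal := fun h => ne_genericPoint hs (C.2.1.symm.trans h)

theorem isLink_of_specializes {s : F.S} (hs : IsClosed {s}) {C C' : Component s} (hne : C ≠ C')
    {x : F.X} (h : C.1.pt ⤳ x) (h' : C'.1.pt ⤳ x) : (reductionGraph s).IsLink x C C' := by
  have hne' : C.1 ≠ C'.1 := fun h => hne (Component.ext_pt h)
  obtain ⟨-, h1, h2, h3⟩ := multiplicity_eq_one hs hne' C.2.1 C'.2.1 h h'
  refine ⟨h1, h2, fun B => ⟨fun hB => ?_, ?_⟩⟩
  · exact (h3 B.1 B.2.1 hB).imp Component.ext_pt Component.ext_pt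
  · rintro (rfl | rfl)
    exacts [h, h']

theorem specializes_of_isLink {s : F.S} {C C' : Component s} {x : F.X}
    (h : (reductionGraph s).IsLink x C C') : C.1.pt ⤳ x ∧ C'.1.pt ⤳ x :=
  ⟨(h.2.2 C).2 (Or.inl rfl), (h.2.2 C').2 (Or.inr rfl)⟩

open scoped Classical in
theorem multiplicity_eq_ite {s : F.S} (hs : IsClosed {s}) {C C' : Component s} (hne : C ≠ C')
    (x : F.X) :
    (multiplicity C.1 C'.1 x : ℚ) = if (reductionGraph s).IsLink x C C' then 1 else 0 := by
  have hne' : C.1 ≠ C'.1 := fun h => hne (Component.ext_pt h)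
  split_ifs with h
  · obtain ⟨h1, h2⟩ := specializes_of_isLink h
    rw [(multiplicity_eq_one hs hne' C.2.1 C'.2.1 h1 h2).1, Nat.cast_one]
  · by_cases h1 : C.1.pt ⤳ x
    · rw [multiplicity_eq_zero_right fun h2 => h (isLink_of_specializes hs hne h1 h2),
        Nat.cast_zero]
    · rw [multiplicity_eq_zero_left h1, Nat.cast_zero]

/-- The intersection number of two components of a fibre is the number of edges between them. -/
theorem properIntersection_eq_neg_laplacian {s : F.S} (hs : IsClosed {s}) {C C' : Component s}
    (hne : C ≠ C') :
    properIntersection s C.1 C'.1 = -GraphGreen.laplacian (reductionGraph s) C C' := by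
  classical
  rw [GraphGreen.laplacian_apply_of_ne _ hne, neg_neg]
  unfold properIntersection
  simp only [multiplicity_eq_ite hs hne]
  refine (finsum_subtype_eq_finsum (p := fun x => F.π x = s)
    (f := fun x => if (reductionGraph s).IsLink x C C' then (1 : ℚ) else 0) fun x hx =>
      if_neg fun h => hx h.1).trans ?_
  refine (finsum_subtype_eq_finsum (p := fun x => x ∈ (reductionGraph s).edgeSet) fun x hx =>
      if_neg fun h => hx ?_).symm
  exact ((reductionGraph s).edge_mem_iff_exists_isLink x).2 ⟨C, C', h⟩

theorem finite_setOf_source_ne_target {s : F.S} :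
    {e : (reductionGraph s).edgeSet | GraphGreen.source (reductionGraph s) e ≠
      GraphGreen.target (reductionGraph s) e}.Finite := by
  have h1 : (⋃ p : Component s × Component s, {x : F.X | p.1 ≠ p.2 ∧ p.1.1.pt ⤳ x ∧
      p.2.1.pt ⤳ x}).Finite := by
    refine Set.finite_iUnion fun p => ?_
    by_cases hp : p.1 = p.2
    · simp [hp]
    · exact (finite_setOf_specializes fun h => hp (Component.ext_pt h)).subset fun x hx => hx.2
  refine (h1.preimage Subtype.val_injective.injOn).subset fun e he => ?_
  have h2 := specializes_of_isLink (GraphGreen.isLink_source_target (reductionGraph s) e)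
  exact Set.mem_iUnion.2 ⟨(_, _), he, h2⟩

section Sums

variable {s : F.S} (hs : IsClosed {s}) {t : F.S.presheaf.stalk s}
  (ht : maximalIdeal (F.S.presheaf.stalk s) = Ideal.span {t})

theorem finite_support_ord_mul_rat (f : F.X.functionField) (c : F.PrimeDivisor → ℚ) :
    (Function.support fun W : F.PrimeDivisor => (ord f W.pt : ℚ) * c W).Finite :=
  (finite_setOf_ord_pt_ne_zero f).subset fun _ hW => by
    exact_mod_cast left_ne_zero_of_mul hW

include hs ht

theorem finsum_ord_pullbackFunction_mul (P : F.PrimeDivisor → ℚ)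
    (hP : ∀ W : F.PrimeDivisor, F.π W.pt ≠ s → ¬ W.IsHorizontal → P W = 0) :
    ∑ᶠ W : F.PrimeDivisor, (ord (pullbackFunction (F := F) t) W.pt : ℚ) * P W =
      ∑ C : Component s, P C.1 := by
  have h1 : ∀ C : Component s,
      (ord (pullbackFunction (F := F) t) C.1.pt : ℚ) * P C.1 = P C.1 := fun C => by
    rw [ord_pullbackFunction_of_map_eq hs ht C.1 C.2.1, Int.cast_one, one_mul]
  rw [finsum_eq_sum_of_support_subset (s := Finset.univ.map ⟨fun C : Component s => C.1,
    fun C C' h => Component.ext_pt h⟩), Finset.sum_map]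
  · exact Finset.sum_congr rfl fun C _ => h1 C
  · intro W hW
    have h2 : F.π W.pt = s := by
      by_contra h
      by_cases hW' : W.IsHorizontal
      · exact hW (by simp only [ord_pullbackFunction_of_isHorizontal hs ht W hW', Int.cast_zero,
          zero_mul])
      · exact hW (by simp only [hP W h hW', mul_zero])
    simp only [Finset.coe_map, Finset.coe_univ, Set.image_univ]
    exact ⟨W.toComponent hs h2, rfl⟩

open scoped Classical in
/-- The self-intersection of a component: the function of `movingFunction` may be replaced with a
local parameter of the base curve, whose divisor near the fibre is the whole fibre. -/
theorem selfIntersection_eq (C : Component s) :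
    selfIntersection s C.1 =
      -∑ C' : Component s, if C'.1 = C.1 then 0 else properIntersection s C'.1 C.1 := by
  have hg1 := ord_pullbackFunction_of_map_eq hs ht C.1 C.2.1
  set g : F.X.functionField := pullbackFunction t with hg
  have hf1 : ord (movingFunction C.1) C.1.pt = 1 :=
    Classical.epsilon_spec (p := fun f => ord f C.1.pt = 1) ⟨g, hg1⟩
  set f := movingFunction C.1 with hf
  have hne : ∀ f : F.X.functionField, ord f C.1.pt = 1 → f ≠ 0 := by
    rintro _ h rfl
    rw [ord_zero] at h
    exact absurd h (by simp)
  have hfg : ∀ W, ord (f * g⁻¹) W = ord f W - ord g W := fun W => by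
    rw [ord_mul (hne f hf1) (inv_ne_zero (hne g hg1)), ord_inv _ (hne g hg1), sub_eq_add_neg]
  obtain ⟨ϖ, hϖ⟩ := C.1.exists_maximalIdeal_eq_span
  obtain ⟨u, hu, huf⟩ := exists_isUnit_of_ord_eq_zero C.1.coheight_pt hϖ
    (mul_ne_zero (hne f hf1) (inv_ne_zero (hne g hg1))) (by rw [hfg, hf1, hg1, sub_self])
  have h1 := finsum_ord_mul_properIntersection_eq_zero hs C.2.1 hu
  rw [huf] at h1
  let P : F.PrimeDivisor → ℚ := fun W => if W = C.1 then 0 else properIntersection s W C.1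
  have h2 : ∀ W : F.PrimeDivisor, (ord (f * g⁻¹) W.pt : ℚ) * properIntersection s W C.1 =
      (ord f W.pt : ℚ) * P W - (ord g W.pt : ℚ) * P W := by
    intro W
    by_cases hW : W = C.1
    · subst hW
      simp [P, hfg, hf1, hg1]
    · simp only [P, if_neg hW, hfg]
      push_cast
      ring
  simp only [h2] at h1
  rw [finsum_sub_distrib (finite_support_ord_mul_rat f P) (finite_support_ord_mul_rat g P),
    sub_eq_zero] at h1
  have h3 := finsum_ord_pullbackFunction_mul hs ht P fun W h h' => by
    simp only [P]
    split_ifs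
    · rfl
    · exact properIntersection_eq_zero hs h h'
  have h4 : selfIntersection s C.1 = ∑ᶠ W : F.PrimeDivisor, -((ord f W.pt : ℚ) * P W) := by
    unfold selfIntersection
    rw [← finsum_subtype_eq_finsum (p := fun W => W ≠ C.1)]
    · refine finsum_congr fun W => ?_
      simp only [P, if_neg W.2]
      ring
    · intro W hW
      simp [P, not_not.1 hW]
  rw [h4, finsum_neg_distrib, h1, h3]

end Sums

variable {s : F.S} (hs : IsClosed {s}) (c : F.PrimeDivisor → ℚ)

theorem primePairing_comm (Z W : F.PrimeDivisor) :
    primePairing c s Z W = primePairing c s W Z := by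
  unfold primePairing
  by_cases h : Z = W
  · rw [h]
  · rw [if_neg h, if_neg (Ne.symm h), properIntersection_comm]

theorem primePairing_of_ne {Z W : F.PrimeDivisor} (h : Z ≠ W) :
    primePairing c s Z W = properIntersection s Z W := if_neg h

include hs

theorem primePairing_eq_zero {Z : F.PrimeDivisor} (hZ : F.π Z.pt ≠ s) (hZ' : ¬ Z.IsHorizontal)
    (W : F.PrimeDivisor) : primePairing c s Z W = 0 := by
  unfold primePairing
  split_ifs
  · rfl
  · exact properIntersection_eq_zero hs hZ hZ'

theorem sum_primePairing_component (C : Component s) :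
    ∑ C' : Component s, primePairing c s C'.1 C.1 = 0 := by
  classical
  obtain ⟨t, ht⟩ := exists_maximalIdeal_stalk_eq_span F.structureMap hs
  have h1 := selfIntersection_eq hs ht C
  rw [← Finset.add_sum_erase _ _ (Finset.mem_univ C)] at h1 ⊢
  rw [if_pos rfl, zero_add] at h1
  have h2 : primePairing c s C.1 C.1 = selfIntersection s C.1 := by
    rw [primePairing, if_pos rfl, if_pos C.2.1]
  rw [h2, h1, neg_add_eq_zero]
  refine Finset.sum_congr rfl fun C' hC' => ?_
  have hne : C'.1 ≠ C.1 := fun h => (Finset.mem_erase.1 hC').1 (Component.ext_pt h)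
  rw [if_neg hne, primePairing_of_ne c hne]

theorem primePairing_component_eq (C C' : Component s) :
    primePairing c s C.1 C'.1 = -GraphGreen.laplacian (reductionGraph s) C C' := by
  classical
  have hoff : ∀ C C' : Component s, C ≠ C' → primePairing c s C.1 C'.1 =
      -GraphGreen.laplacian (reductionGraph s) C C' := fun C C' h => by
    rw [primePairing_of_ne c fun h' => h (Component.ext_pt h'),
      properIntersection_eq_neg_laplacian hs h]
  by_cases h : C = C'
  · subst h
    have h1 := sum_primePairing_component hs c C
    have h2 := congrFun (GraphGreen.laplacian_mulVec_one (reductionGraph s)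
      finite_setOf_source_ne_target) C
    simp only [Matrix.mulVec, dotProduct, mul_one, Pi.zero_apply] at h2
    rw [← Finset.add_sum_erase _ _ (Finset.mem_univ C)] at h1 h2
    have h3 : ∑ C' ∈ Finset.univ.erase C, primePairing c s C'.1 C.1 =
        -∑ C' ∈ Finset.univ.erase C, GraphGreen.laplacian (reductionGraph s) C C' := by
      rw [← Finset.sum_neg_distrib]
      refine Finset.sum_congr rfl fun C' hC' => ?_
      rw [primePairing_comm, hoff C C' (Finset.mem_erase.1 hC').1.symm]
    linarith
  · exact hoff C C' h

theorem sum_primePairing_of_isHorizontal {Z : F.PrimeDivisor} (hZ : Z.IsHorizontal) :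
    ∑ C : Component s, primePairing c s Z C.1 = F.π.residueDegree Z.pt := by
  obtain ⟨t, ht⟩ := exists_maximalIdeal_stalk_eq_span F.structureMap hs
  rw [← finsum_ord_mul_properIntersection_eq_residueDegree hZ hs ht,
    finsum_ord_pullbackFunction_mul hs ht _ fun W h h' => properIntersection_eq_zero hs h h']
  refine Finset.sum_congr rfl fun C _ => ?_
  rw [primePairing_of_ne, properIntersection_comm]
  rintro rfl
  exact C.not_isHorizontal hs hZ

end SemistableSurface

/-! ### The kernel of the Laplacian -/

namespace SemistableSurface

open IsLocalRing AlgebraicGeometry.Scheme GraphGreen Matrix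

variable {F : SemistableSurface} {s : F.S}

theorem laplacian_nonpos (hs : IsClosed {s}) {C C' : Component s} (hne : C ≠ C') :
    laplacian (reductionGraph s) C C' ≤ 0 := by
  rw [← neg_nonneg, ← properIntersection_eq_neg_laplacian hs hne]
  exact finsum_nonneg fun x => Nat.cast_nonneg _

theorem laplacian_ne_zero (hs : IsClosed {s}) {C C' : Component s} (hne : C ≠ C') {x : F.X}
    (h : C.1.pt ⤳ x) (h' : C'.1.pt ⤳ x) : laplacian (reductionGraph s) C C' ≠ 0 := by
  classical
  have hne' : C.1 ≠ C'.1 := fun h => hne (Component.ext_pt h)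
  have h1 := properIntersection_eq_neg_laplacian hs hne
  obtain ⟨hm, hx, -⟩ := multiplicity_eq_one hs hne' C.2.1 C'.2.1 h h'
  have h2 : 0 < properIntersection s C.1 C'.1 := by
    refine finsum_pos (fun x => Nat.cast_nonneg _) ⟨⟨x, hx⟩, by simp [hm]⟩ ?_
    refine ((finite_setOf_specializes hne').preimage Subtype.val_injective.injOn).subset ?_
    intro y hy
    by_contra hn
    refine hy ?_
    simp only [multiplicity_eq_ite hs hne]
    exact if_neg fun hl => hn (specializes_of_isLink hl)
  intro h0
  rw [h1, h0, neg_zero] at h2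
  exact h2.false

/-- Every function in the kernel of the Laplacian is constant, since the fibre is connected: two
components with a common point are joined by an edge. -/
theorem eq_of_laplacian_mulVec_eq_zero (hs : IsClosed {s}) {f : Component s → ℚ}
    (hf : laplacian (reductionGraph s) *ᵥ f = 0) (C C' : Component s) : f C = f C' := by
  classical
  by_contra hne
  have hclosed : ∀ p : Component s → Prop,
      IsClosed (⋃ B : {B : Component s // p B}, closure {B.1.1.pt}) := fun p =>
    isClosed_iUnion_of_finite fun _ => isClosed_closure
  have hself : ∀ B : Component s, B.1.pt ∈ F.π ⁻¹' {s} := fun B => B.2.1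
  have hcover : F.π ⁻¹' {s} ⊆ (⋃ B : {B : Component s // f B = f C}, closure {B.1.1.pt}) ∪
      ⋃ B : {B : Component s // f B ≠ f C}, closure {B.1.1.pt} := fun x hx => by
    obtain ⟨W, hW, hWx⟩ := exists_specializes_of_map_eq hs hx
    by_cases h : f (W.toComponent hs hW) = f C
    · exact Or.inl (Set.mem_iUnion.2 ⟨⟨_, h⟩, specializes_iff_mem_closure.1 hWx⟩)
    · exact Or.inr (Set.mem_iUnion.2 ⟨⟨_, h⟩, specializes_iff_mem_closure.1 hWx⟩)
  obtain ⟨x, -, hx, hx'⟩ := isPreconnected_closed_iff.1 (F.connected_fibers s).isPreconnected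
    _ _ (hclosed fun B => f B = f C) (hclosed fun B => f B ≠ f C) hcover
    ⟨C.1.pt, hself C, Set.mem_iUnion.2 ⟨⟨C, rfl⟩, subset_closure rfl⟩⟩
    ⟨C'.1.pt, hself C', Set.mem_iUnion.2 ⟨⟨C', Ne.symm hne⟩, subset_closure rfl⟩⟩
  obtain ⟨⟨B, hB⟩, hBx⟩ := Set.mem_iUnion.1 hx
  obtain ⟨⟨B', hB'⟩, hBx'⟩ := Set.mem_iUnion.1 hx'
  have hBB' : B ≠ B' := fun h => hB' (h ▸ hB)
  refine hB' ((eq_of_mulVec_eq_zero (laplacian_isSymm _)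
    (laplacian_mulVec_one _ finite_setOf_source_ne_target)
    (fun v w h => laplacian_nonpos hs h) hf (laplacian_ne_zero hs hBB'
      (specializes_iff_mem_closure.2 hBx) (specializes_iff_mem_closure.2 hBx'))).symm.trans hB)

/-! ### Bilinearity of the local intersection pairing -/

variable (c : F.PrimeDivisor → ℚ)

theorem pairing_comm (D E : F.RatDivisor) : pairing c s D E = pairing c s E D := by
  unfold pairing
  rw [Finsupp.sum_comm]
  refine Finsupp.sum_congr fun Z _ => Finsupp.sum_congr fun W _ => ?_
  rw [primePairing_comm, mul_comm (D W)]

theorem pairing_add_left (D D' E : F.RatDivisor) :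
    pairing c s (D + D') E = pairing c s D E + pairing c s D' E := by
  classical
  refine Finsupp.sum_add_index' (h := fun Z a => E.sum fun W b => a * b * primePairing c s Z W)
    (fun Z => ?_) fun Z a a' => ?_
  · simp [Finsupp.sum]
  · simp only [add_mul, Finsupp.sum_add]

theorem pairing_add_right (D E E' : F.RatDivisor) :
    pairing c s D (E + E') = pairing c s D E + pairing c s D E' := by
  rw [pairing_comm, pairing_add_left, pairing_comm c E, pairing_comm c E']

theorem reduction_apply (D : F.RatDivisor) (C : Component s) :
    reduction c s D C = D.sum fun Z a => a * primePairing c s Z C.1 := by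
  unfold reduction pairing
  refine Finsupp.sum_congr fun Z _ => ?_
  rw [Component.toDivisor]
  exact (Finsupp.sum_single_index (h := fun W b => D Z * b * primePairing c s Z W)
    (by ring)).trans (by rw [mul_one])

theorem reduction_add (D D' : F.RatDivisor) :
    reduction c s (D + D') = reduction c s D + reduction c s D' :=
  funext fun _ => pairing_add_left c _ _ _

/-- A vertical divisor enters the pairing only through its coefficients at the components of the
fibre over `s`. -/
theorem sum_mul_eq_sum_component (hs : IsClosed {s}) {φ : F.RatDivisor}
    (hφ : ∀ Z ∈ φ.support, ¬ Z.IsHorizontal) {P : F.PrimeDivisor → ℚ}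
    (hP : ∀ Z : F.PrimeDivisor, F.π Z.pt ≠ s → ¬ Z.IsHorizontal → P Z = 0) :
    φ.sum (fun Z a => a * P Z) = ∑ C : Component s, φ C.1 * P C.1 := by
  classical
  let i : Component s ↪ F.PrimeDivisor := ⟨fun C => C.1, fun C C' h => Component.ext_pt h⟩
  let M : Finset F.PrimeDivisor := Finset.univ.map i
  have h1 : ∑ C : Component s, φ C.1 * P C.1 = ∑ Z ∈ M, φ Z * P Z :=
    (Finset.sum_map Finset.univ i fun Z => φ Z * P Z).symm
  rw [h1, Finsupp.sum_of_support_subset φ (s := φ.support ∪ M) Finset.subset_union_left _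
    (by simp)]
  refine (Finset.sum_subset Finset.subset_union_right fun Z hZ hZM => ?_).symm
  have hZφ : Z ∈ φ.support := (Finset.mem_union.1 hZ).resolve_right hZM
  rw [hP Z (fun h => hZM (Finset.mem_map.2 ⟨Z.toComponent hs h, Finset.mem_univ _, rfl⟩))
    (hφ Z hZφ), mul_zero]

theorem pairing_eq_sum_of_vertical (hs : IsClosed {s}) {φ : F.RatDivisor}
    (hφ : ∀ Z ∈ φ.support, ¬ Z.IsHorizontal) (E : F.RatDivisor) :
    pairing c s φ E = ∑ C : Component s, φ C.1 * reduction c s E C := by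
  have h1 : pairing c s φ E = φ.sum fun Z a => a * E.sum fun W b => b * primePairing c s Z W := by
    unfold pairing
    refine Finsupp.sum_congr fun Z _ => ?_
    rw [Finsupp.mul_sum]
    exact Finsupp.sum_congr fun W _ => mul_assoc _ _ _
  rw [h1, sum_mul_eq_sum_component hs hφ]
  · refine Finset.sum_congr rfl fun C _ => congrArg _ ?_
    rw [reduction_apply]
    exact Finsupp.sum_congr fun W _ => by rw [primePairing_comm]
  · intro Z hZ hZ'
    simp [primePairing_eq_zero hs c hZ hZ', Finsupp.sum]

theorem reduction_eq_neg_laplacian_mulVec (hs : IsClosed {s}) {φ : F.RatDivisor}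
    (hφ : ∀ Z ∈ φ.support, ¬ Z.IsHorizontal) :
    reduction c s φ = -(laplacian (reductionGraph s) *ᵥ fun C => φ C.1) := by
  funext C
  rw [reduction_apply,
    sum_mul_eq_sum_component hs hφ fun Z hZ hZ' => primePairing_eq_zero hs c hZ hZ' C.1,
    Pi.neg_apply, mulVec, dotProduct, ← Finset.sum_neg_distrib]
  refine Finset.sum_congr rfl fun C' _ => ?_
  rw [primePairing_component_eq hs, (laplacian_isSymm (reductionGraph s)).apply C C']
  ring

theorem isVerticalCorrection_iff (hs : IsClosed {s}) {D φ : F.RatDivisor} :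
    IsVerticalCorrection c s D φ ↔ (∀ Z ∈ φ.support, ¬ Z.IsHorizontal) ∧
      laplacian (reductionGraph s) *ᵥ (fun C => φ C.1) = reduction c s D := by
  refine ⟨fun h => ⟨h.vertical, ?_⟩, fun h => ⟨h.1, ?_⟩⟩
  · have h1 : reduction c s (D + φ) = 0 := funext h.orthogonal
    rw [reduction_add, reduction_eq_neg_laplacian_mulVec c hs h.vertical, ← sub_eq_add_neg,
      sub_eq_zero] at h1
    exact h1.symm
  · refine congrFun (?_ : reduction c s (D + φ) = 0)
    rw [reduction_add, reduction_eq_neg_laplacian_mulVec c hs h.1, h.2, add_neg_cancel]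

/-! ### The local Néron pairing -/

/-- The total degree of the reduction of a divisor is its relative degree. -/
theorem sum_reduction_toRat (hs : IsClosed {s}) (D : F.Divisor) :
    ∑ C, reduction c s D.toRat C = D.relDegree := by
  classical
  have h1 : ∀ C, reduction c s D.toRat C = D.sum fun Z a => (a : ℚ) * primePairing c s Z C.1 :=
    fun C => by
      rw [reduction_apply, Divisor.toRat, Finsupp.sum_mapRange_index fun _ => zero_mul _]
  simp only [h1, Finsupp.sum, Divisor.relDegree]
  rw [Finset.sum_comm, Int.cast_sum]
  refine Finset.sum_congr rfl fun Z _ => ?_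
  rw [← Finset.mul_sum]
  split_ifs with hZ
  · rw [sum_primePairing_of_isHorizontal hs c hZ]
    push_cast
    ring
  · rw [Int.cast_zero]
    refine mul_eq_zero_of_right _ ?_
    by_cases hZs : F.π Z.pt = s
    · rw [← sum_primePairing_component hs c (Z.toComponent hs hZs)]
      exact Finset.sum_congr rfl fun C _ => primePairing_comm c _ _
    · exact Finset.sum_eq_zero fun C _ => primePairing_eq_zero hs c hZs hZ _

theorem exists_isVerticalCorrection (hs : IsClosed {s}) {D : F.RatDivisor}
    (hD : ∑ C, reduction c s D C = 0) : ∃ φ, IsVerticalCorrection c s D φ := by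
  classical
  let f : Component s → ℚ := MoorePenrose.pinv (laplacian (reductionGraph s)) *ᵥ reduction c s D
  let φ : F.RatDivisor := ∑ C : Component s, Finsupp.single C.1 (f C)
  have hφ : ∀ C : Component s, φ C.1 = f C := fun C => by
    simp only [φ, Finsupp.finsetSum_apply]
    rw [Finset.sum_eq_single C, Finsupp.single_eq_same]
    · intro C' _ hne
      exact Finsupp.single_eq_of_ne fun h => hne (Component.ext_pt h.symm)
    · exact fun h => absurd (Finset.mem_univ C) h
  refine ⟨φ, (isVerticalCorrection_iff c hs).2 ⟨fun Z hZ hZh => ?_, ?_⟩⟩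
  · obtain ⟨C, -, hC⟩ := Finset.mem_biUnion.1 (Finsupp.support_finsetSum hZ)
    obtain rfl := Finset.mem_singleton.1 (Finsupp.support_single_subset hC)
    exact C.not_isHorizontal hs hZh
  · rw [funext hφ]
    exact mulVec_pinv_mulVec (laplacian_isSymm _)
      (laplacian_mulVec_one _ finite_setOf_source_ne_target)
      (fun _ hg => eq_of_laplacian_mulVec_eq_zero hs hg) hD

theorem pairing_add_eq_add_green (hs : IsClosed {s}) {D φ E : F.RatDivisor}
    (hφ : IsVerticalCorrection c s D φ) (hE : ∑ C, reduction c s E C = 0) :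
    pairing c s (D + φ) E = pairing c s D E +
      green (reductionGraph s) (reduction c s D) (reduction c s E) := by
  classical
  obtain ⟨h1, h2⟩ := (isVerticalCorrection_iff c hs).1 hφ
  rw [pairing_add_left, pairing_eq_sum_of_vertical c hs h1, sum_mul_eq_pinv (laplacian_isSymm _)
    (fun _ hg => eq_of_laplacian_mulVec_eq_zero hs hg) hE, h2]
  rfl

end SemistableSurface

theorem corollary7p5 (F : SemistableSurface) (s : F.S) (hs : IsClosed {s})
    (c : F.PrimeDivisor → ℚ) (D E : F.Divisor) (hD : D.relDegree = 0) (hE : E.relDegree = 0) :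
    (∃ φD, SemistableSurface.IsVerticalCorrection c s D.toRat φD) ∧
    (∃ φE, SemistableSurface.IsVerticalCorrection c s E.toRat φE) ∧
    ∀ φD φE : F.RatDivisor,
      SemistableSurface.IsVerticalCorrection c s D.toRat φD →
      SemistableSurface.IsVerticalCorrection c s E.toRat φE →
      SemistableSurface.pairing c s (D.toRat + φD) (E.toRat + φE) =
          SemistableSurface.pairing c s D.toRat E.toRat +
            GraphGreen.green (SemistableSurface.reductionGraph s)
              (SemistableSurface.reduction c s D.toRat)
              (SemistableSurface.reduction c s E.toRat) ∧
      SemistableSurface.pairing c s (D.toRat + φD) E.toRat =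
          SemistableSurface.pairing c s D.toRat E.toRat +
            GraphGreen.green (SemistableSurface.reductionGraph s)
              (SemistableSurface.reduction c s D.toRat)
              (SemistableSurface.reduction c s E.toRat) := by
  have hD' : ∑ C, SemistableSurface.reduction c s D.toRat C = 0 := by
    rw [SemistableSurface.sum_reduction_toRat c hs, hD, Int.cast_zero]
  have hE' : ∑ C, SemistableSurface.reduction c s E.toRat C = 0 := by
    rw [SemistableSurface.sum_reduction_toRat c hs, hE, Int.cast_zero]
  refine ⟨SemistableSurface.exists_isVerticalCorrection c hs hD',
    SemistableSurface.exists_isVerticalCorrection c hs hE', fun φD φE hφD hφE => ?_⟩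
  have h1 := SemistableSurface.pairing_add_eq_add_green c hs hφD hE'
  refine ⟨?_, h1⟩
  -- `φE` is a combination of components, each of which is orthogonal to `D + φD`.
  have h2 : SemistableSurface.pairing c s (D.toRat + φD) φE = 0 := by
    rw [SemistableSurface.pairing_comm, SemistableSurface.pairing_eq_sum_of_vertical c hs
      hφE.vertical]
    exact Finset.sum_eq_zero fun C _ => mul_eq_zero_of_right _ (hφD.orthogonal C)
  rw [SemistableSurface.pairing_add_right, h2, add_zero, h1]

end
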